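/- Let $k$ be an algebraically closed field of characteristic zero (for example $k=\mathbb C$), let $n\ge 2$, let $E\in \mathrm{GL}_n(k)$ and put $F=E^{t}E^{-1}$. Let $H(F)$ be the universal cosovereign Hopf algebra: the $k$-algebra generated by $u_{ij},v_{ij}$ ($1\le i,j\le n$), with $u=(u_{ij})$, $v=(v_{ij})$, subject to $$uv^{t}=v^{t}u=I_n,\qquad vFu^{t}F^{-1}=Fu^{t}F^{-1}v=I_n,$$ with $\Delta(u_{ij})=\sum_l u_{il}\otimes u_{lj}$, $\Delta(v_{ij})=\sum_l v_{il}\otimes v_{lj}$, $\varepsilon(u_{ij})=\varepsilon(v_{ij})=\delta_{ij}$, $S(u)=v^{t}$, $S(v)=Fu^{t}F^{-1}$. Let $\mathcal B(E)$ be the universal Hopf algebra of the bilinear form associated to $E$: the $k$-algebra generated by $a_{ij}$ ($1\le i,j\le n$), with $a=(a_{ij})$, subject to $E^{-1}a^{t}Ea=I_n=aE^{-1}a^{t}E$, with $\Delta(a_{ij})=\sum_l a_{il}\otimes a_{lj}$, $\varepsilon(a_{ij})=\delta_{ij}$, $S(a)=E^{-1}a^{t}E$. Let $\mathcal B(E)*\mathcal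 B(E)$ be the free product algebra with the unique Hopf algebra structure for which the two canonical maps from $\mathcal B(E)$ are Hopf algebra maps. For a Hopf algebra $A$ over $k$ put $$\mathrm{cd}(A)=\sup\{m : H^m(A,M)\ne 0 \text{ for some } A\text{-bimodule } M\}\in\mathbb N\cup\{\infty\},$$ where $H^{*}(A,M)=\mathrm{Ext}^{*}_{A\otimes A^{\mathrm{op}}}(A,M)$ is Hochschild cohomology, and $$\mathrm{cd}_{\mathrm{GS}}(A)=\sup\{m : \mathrm{Ext}^m_{\mathcal{YD}^A_A}(k,V)\ne 0 \text{ for some } V\in\mathcal{YD}^A_A\}\in\mathbb N\cup\{\infty\},$$ where $\mathcal{YD}^A_A$ is the category of right-right Yetter-Drinfeld modules, i.e. right $A$-modules and right $A$-comodules $V$ with $(v\cdot a)_{(0)}\otimes(v\cdot a)_{(1)}=v_{(0)}\cdot a_{(2)}\otimes S(a_{(1)})v_{(1)}a_{(3)}$, and $k$ is its trivial object (Gerstenhaber-Schack cohomology). Then $$\mathrm{cd}(H(F))=\mathrm{cd}(\mathcal B(E)*\mathcal B(E)).$$ If moreover $F$ is generic, then $$\mathrm{cd}_{\mathrm{GS}}(H(F))=\mathrm{cd}_{\mathrm{GS}}(\mathcal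 B(E)*\mathcal B(E)).$$ Here $F$ is generic if $\mathrm{tr}(F)$ and $\mathrm{tr}(F^{-1})$ are both nonzero or both zero, and no solution $q$ of $q^2-\sqrt{\mathrm{tr}(F)\mathrm{tr}(F^{-1})}\,q+1=0$ is a root of unity of order $\ge 3$ (this does not depend on the choice of the square root). -/

import Mathlib

open TensorProduct CategoryTheory MulOpposite
open scoped Matrix MatrixGroups

universe u

noncomputable section

section YetterDrinfeld

variable (k : Type u) [Field k] (A : Type u) [Ring A] [HopfAlgebra k A]

/-- The iterated comultiplication `a ↦ a₍₁₎ ⊗ (a₍₂₎ ⊗ a₍₃₎)`. -/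
def comulTwice : A →ₗ[k] A ⊗[k] (A ⊗[k] A) :=
  (Coalgebra.comul (R := k) (A := A)).lTensor A ∘ₗ Coalgebra.comul

section naturality

variable {k A} {M N : Type u} [AddCommGroup M] [Module k M] [AddCommGroup N] [Module k N]

theorem assoc_rTensor (f : M →ₗ[k] N) (z : (M ⊗[k] A) ⊗[k] A) :
    TensorProduct.assoc k N A A ((f.rTensor A).rTensor A z) =
      f.rTensor (A ⊗[k] A) (TensorProduct.assoc k M A A z) := by
  have : (TensorProduct.assoc k N A A).toLinearMap ∘ₗ (f.rTensor A).rTensor A =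
      f.rTensor (A ⊗[k] A) ∘ₗ (TensorProduct.assoc k M A A).toLinearMap := by ext; simp
  exact LinearMap.congr_fun this z

theorem comul_rTensor (f : M →ₗ[k] N) (z : M ⊗[k] A) :
    (Coalgebra.comul (R := k) (A := A)).lTensor N (f.rTensor A z) =
      f.rTensor (A ⊗[k] A) ((Coalgebra.comul (R := k) (A := A)).lTensor M z) := by
  rw [← LinearMap.comp_apply, ← LinearMap.comp_apply, LinearMap.lTensor_comp_rTensor,
    LinearMap.rTensor_comp_lTensor]

theorem counit_rTensor (f : M →ₗ[k] N) (z : M ⊗[k] A) :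
    TensorProduct.rid k N ((Coalgebra.counit (R := k) (A := A)).lTensor N (f.rTensor A z)) =
      f (TensorProduct.rid k M ((Coalgebra.counit (R := k) (A := A)).lTensor M z)) := by
  have : (TensorProduct.rid k N).toLinearMap ∘ₗ
      (Coalgebra.counit (R := k) (A := A)).lTensor N ∘ₗ f.rTensor A =
      f ∘ₗ (TensorProduct.rid k M).toLinearMap ∘ₗ
        (Coalgebra.counit (R := k) (A := A)).lTensor M := by ext; simp
  exact LinearMap.congr_fun this z

end naturality

section

variable (V : Type u) [AddCommGroup V] [Module k V] [Module Aᵐᵒᵖ V] [IsScalarTower k Aᵐᵒᵖ V]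

/-- The action `a ↦ (v ↦ v · a)` on a right `A`-module `V`, that is, a module over the opposite
algebra `Aᵐᵒᵖ`. -/
def rightAct : A →ₗ[k] Module.End k V :=
  (Algebra.lsmul k k V).toLinearMap ∘ₗ (opLinearEquiv k : A ≃ₗ[k] Aᵐᵒᵖ).toLinearMap

/-- The linear map sending `a ⊗ (b ⊗ c)` to the endomorphism
`v ⊗ x ↦ (v · b) ⊗ S(a) x c` of `V ⊗ A`. -/
def ydTwist : A ⊗[k] (A ⊗[k] A) →ₗ[k] Module.End k (V ⊗[k] A) :=
  TensorProduct.homTensorHomMap (RingHom.id k) V A V A ∘ₗ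
    TensorProduct.map (rightAct k A V)
      (LinearMap.mul' k (Module.End k A) ∘ₗ
        TensorProduct.map (LinearMap.mul k A ∘ₗ HopfAlgebra.antipode k) (LinearMap.mul k A).flip) ∘ₗ
    (TensorProduct.leftComm k A A A).toLinearMap

variable {k A V}

@[simp]
theorem rightAct_apply (a : A) (v : V) : rightAct k A V a v = op a • v := rfl

@[simp]
theorem ydTwist_tmul (a b c : A) (v : V) (x : A) :
    ydTwist k A V (a ⊗ₜ (b ⊗ₜ c)) (v ⊗ₜ x) =
      (op b • v) ⊗ₜ (HopfAlgebra.antipode k a * (x * c)) := by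
  simp [ydTwist]

theorem ydTwist_naturality {W : Type u} [AddCommGroup W] [Module k W] [Module Aᵐᵒᵖ W]
    [IsScalarTower k Aᵐᵒᵖ W] (f : V →ₗ[Aᵐᵒᵖ] W) (t : A ⊗[k] (A ⊗[k] A)) (z : V ⊗[k] A) :
    (f.restrictScalars k).rTensor A (ydTwist k A V t z) =
      ydTwist k A W t ((f.restrictScalars k).rTensor A z) := by
  induction z with
  | zero => simp
  | add x y hx hy => simp only [map_add, hx, hy]
  | tmul v x =>
    induction t with
    | zero => simp
    | add t t' h h' => simp only [map_add, LinearMap.add_apply, h, h']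
    | tmul a s =>
      induction s with
      | zero => simp
      | add t t' h h' => simp only [map_add, tmul_add, LinearMap.add_apply, h, h']
      | tmul b c => simp

end

/-- A right-right Yetter-Drinfeld module over the Hopf algebra `A`: a right `A`-module `V` (a module
over `Aᵐᵒᵖ`) and right `A`-comodule such that
`(v · a)₍₀₎ ⊗ (v · a)₍₁₎ = v₍₀₎ · a₍₂₎ ⊗ S(a₍₁₎) v₍₁₎ a₍₃₎`. -/
structure YetterDrinfeld where
  /-- the underlying vector space -/
  carrier : Type u
  [addCommGroup : AddCommGroup carrier]
  [module : Module k carrier]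
  [moduleOp : Module Aᵐᵒᵖ carrier]
  [isScalarTower : IsScalarTower k Aᵐᵒᵖ carrier]
  /-- the right coaction -/
  coact : carrier →ₗ[k] carrier ⊗[k] A
  coact_coassoc : (TensorProduct.assoc k carrier A A).toLinearMap ∘ₗ coact.rTensor A ∘ₗ coact =
    (Coalgebra.comul (R := k) (A := A)).lTensor carrier ∘ₗ coact
  coact_counit : (TensorProduct.rid k carrier).toLinearMap ∘ₗ
    (Coalgebra.counit (R := k) (A := A)).lTensor carrier ∘ₗ coact = LinearMap.id
  coact_smul : ∀ (a : A) (v : carrier),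
    coact (op a • v) = ydTwist k A carrier (comulTwice k A a) (coact v)

namespace YetterDrinfeld

attribute [instance] addCommGroup module moduleOp isScalarTower

variable {k A}

/-- A morphism of Yetter-Drinfeld modules: an `A`-linear and `A`-colinear map. -/
@[ext]
structure Hom (V W : YetterDrinfeld k A) where
  /-- the underlying `A`-linear map -/
  lin : V.carrier →ₗ[Aᵐᵒᵖ] W.carrier
  colinear : ∀ v, W.coact (lin v) = (lin.restrictScalars k).rTensor A (V.coact v)

instance : Category (YetterDrinfeld k A) where
  Hom := Hom
  id V := ⟨LinearMap.id, fun v => by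
    change _ = (LinearMap.id : V.carrier →ₗ[k] V.carrier).rTensor A _; simp⟩
  comp f g := ⟨g.lin ∘ₗ f.lin, fun v => by
    have : ((g.lin ∘ₗ f.lin).restrictScalars k) = g.lin.restrictScalars k ∘ₗ f.lin.restrictScalars k := rfl
    rw [this, LinearMap.rTensor_comp_apply, ← f.colinear, ← g.colinear]; rfl⟩

variable {V W X : YetterDrinfeld k A}

@[ext]
theorem hom_ext {f g : V ⟶ W} (h : ∀ v, Hom.lin f v = Hom.lin g v) : f = g :=
  Hom.ext (LinearMap.ext h)

@[simp] theorem id_lin (v : V.carrier) : Hom.lin (𝟙 V) v = v := rfl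
@[simp] theorem comp_lin (f : V ⟶ W) (g : W ⟶ X) (v : V.carrier) :
    Hom.lin (f ≫ g) v = Hom.lin g (Hom.lin f v) := rfl

instance : Zero (V ⟶ W) := ⟨⟨0, fun v => by simp⟩⟩
instance : Add (V ⟶ W) := ⟨fun f g => ⟨Hom.lin f + Hom.lin g, fun v => by
  simp [LinearMap.restrictScalars_add, LinearMap.rTensor_add, Hom.colinear]⟩⟩
instance : Neg (V ⟶ W) := ⟨fun f => ⟨-Hom.lin f, fun v => by
  simp [LinearMap.restrictScalars_neg, LinearMap.rTensor_neg, Hom.colinear]⟩⟩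

@[simp] theorem zero_lin (v : V.carrier) : Hom.lin (0 : V ⟶ W) v = 0 := rfl
@[simp] theorem add_lin (f g : V ⟶ W) (v : V.carrier) :
    Hom.lin (f + g) v = Hom.lin f v + Hom.lin g v := rfl
@[simp] theorem neg_lin (f : V ⟶ W) (v : V.carrier) : Hom.lin (-f) v = -Hom.lin f v := rfl

instance : AddCommGroup (V ⟶ W) where
  add_assoc _ _ _ := by ext; simp [add_assoc]
  zero_add _ := by ext; simp
  add_zero _ := by ext; simp
  add_comm _ _ := by ext; simp [add_comm]
  neg_add_cancel _ := by ext; simp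
  nsmul := nsmulRec
  zsmul := zsmulRec

instance : Preadditive (YetterDrinfeld k A) where
  add_comp _ _ _ _ _ _ := by ext; simp
  comp_add _ _ _ _ _ _ := by ext; simp

/-! ### Subobjects and quotients -/

section sub

variable (V) (p : Submodule Aᵐᵒᵖ V.carrier)

/-- Condition for a right submodule to be a subcomodule. -/
def IsStable : Prop := ∀ v ∈ p,
  V.coact v ∈ LinearMap.range ((p.subtype.restrictScalars k).rTensor A)

variable {V p}

theorem incl_injective (p : Submodule Aᵐᵒᵖ V.carrier) (M : Type u) [AddCommGroup M] [Module k M] :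
    Function.Injective ((p.subtype.restrictScalars k).rTensor M) :=
  Module.Flat.rTensor_preserves_injective_linearMap _ p.injective_subtype

/-- The coaction of a stable submodule. -/
def subCoact (hp : IsStable V p) : p →ₗ[k] p ⊗[k] A :=
  (LinearEquiv.ofInjective _ (incl_injective p A)).symm.toLinearMap ∘ₗ
    LinearMap.codRestrict _ (V.coact ∘ₗ p.subtype.restrictScalars k) (fun v => hp v.1 v.2)

theorem incl_subCoact (hp : IsStable V p) (v : p) :
    (p.subtype.restrictScalars k).rTensor A (subCoact hp v) = V.coact v :=
  congrArg Subtype.val ((LinearEquiv.ofInjective _ (incl_injective p A)).apply_symm_apply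
    ⟨V.coact v, hp v.1 v.2⟩)

theorem incl_comp_subCoact (hp : IsStable V p) :
    (p.subtype.restrictScalars k).rTensor A ∘ₗ subCoact hp =
      V.coact ∘ₗ p.subtype.restrictScalars k :=
  LinearMap.ext (incl_subCoact hp)

/-- A stable submodule as a Yetter-Drinfeld module. -/
def sub (hp : IsStable V p) : YetterDrinfeld k A where
  carrier := p
  coact := subCoact hp
  coact_coassoc := by
    apply LinearMap.ext; intro v
    apply incl_injective p (A ⊗[k] A)
    simp only [LinearMap.comp_apply, LinearEquiv.coe_coe]
    rw [← assoc_rTensor, ← comul_rTensor, incl_subCoact, ← LinearMap.rTensor_comp_apply,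
      incl_comp_subCoact, LinearMap.rTensor_comp_apply, incl_subCoact]
    exact LinearMap.congr_fun V.coact_coassoc v
  coact_counit := by
    apply LinearMap.ext; intro v
    apply p.injective_subtype
    refine (counit_rTensor (p.subtype.restrictScalars k) _).symm.trans ?_
    rw [incl_subCoact]
    exact LinearMap.congr_fun V.coact_counit v
  coact_smul a v := by
    apply incl_injective p A
    rw [incl_subCoact, ydTwist_naturality, incl_subCoact]
    exact V.coact_smul a v

/-- The inclusion of a stable submodule. -/
def subι (hp : IsStable V p) : sub hp ⟶ V :=
  Hom.mk (V := sub hp) p.subtype fun v => (incl_subCoact hp v).symm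

/-- Corestriction of a morphism to a stable submodule. -/
def subLift (hp : IsStable V p) (f : W ⟶ V) (h : ∀ w, Hom.lin f w ∈ p) : W ⟶ sub hp :=
  Hom.mk (W := sub hp) (LinearMap.codRestrict p (Hom.lin f) h) fun w => by
    apply incl_injective p A
    refine (incl_subCoact hp _).trans ?_
    exact (Hom.colinear f w).trans (LinearMap.rTensor_comp_apply A
      (p.subtype.restrictScalars k) ((LinearMap.codRestrict p (Hom.lin f) h).restrictScalars k) _)

/-- The coaction on the quotient by a stable submodule. -/
def quotCoact (hp : IsStable V p) : (V.carrier ⧸ p) →ₗ[k] (V.carrier ⧸ p) ⊗[k] A :=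
  (Submodule.liftQ (p.restrictScalars k) ((p.mkQ.restrictScalars k).rTensor A ∘ₗ V.coact) (by
    intro v hv
    obtain ⟨z, hz⟩ := hp v hv
    have : p.mkQ.restrictScalars k ∘ₗ p.subtype.restrictScalars k = 0 := by
      ext x; simp
    rw [LinearMap.mem_ker, LinearMap.comp_apply, ← hz, ← LinearMap.rTensor_comp_apply, this]
    simp)) ∘ₗ (Submodule.Quotient.restrictScalarsEquiv k p).symm.toLinearMap

theorem quotCoact_mk (hp : IsStable V p) (v : V.carrier) :
    quotCoact hp (p.mkQ v) = (p.mkQ.restrictScalars k).rTensor A (V.coact v) := rfl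

theorem quotCoact_comp (hp : IsStable V p) :
    quotCoact hp ∘ₗ p.mkQ.restrictScalars k = (p.mkQ.restrictScalars k).rTensor A ∘ₗ V.coact := rfl

/-- The quotient by a stable submodule as a Yetter-Drinfeld module. -/
def quot (hp : IsStable V p) : YetterDrinfeld k A where
  carrier := V.carrier ⧸ p
  coact := quotCoact hp
  coact_coassoc := by
    apply LinearMap.ext; intro v
    obtain ⟨v, rfl⟩ := p.mkQ_surjective v
    simp only [LinearMap.comp_apply, LinearEquiv.coe_coe]
    rw [quotCoact_mk, ← LinearMap.rTensor_comp_apply, quotCoact_comp,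
      LinearMap.rTensor_comp_apply, assoc_rTensor, comul_rTensor]
    exact congrArg _ (LinearMap.congr_fun V.coact_coassoc v)
  coact_counit := by
    apply LinearMap.ext; intro v
    obtain ⟨v, rfl⟩ := p.mkQ_surjective v
    refine (counit_rTensor (p.mkQ.restrictScalars k) _).trans ?_
    exact congrArg p.mkQ (LinearMap.congr_fun V.coact_counit v)
  coact_smul a v := by
    obtain ⟨v, rfl⟩ := p.mkQ_surjective v
    rw [← map_smul, quotCoact_mk, quotCoact_mk, V.coact_smul, ydTwist_naturality]

/-- The projection onto the quotient by a stable submodule. -/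
def quotπ (hp : IsStable V p) : V ⟶ quot hp :=
  Hom.mk (W := quot hp) p.mkQ fun v => quotCoact_mk hp v

/-- Morphisms out of the quotient by a stable submodule. -/
def quotDesc (hp : IsStable V p) (f : V ⟶ W) (h : p ≤ LinearMap.ker (Hom.lin f)) : quot hp ⟶ W :=
  Hom.mk (V := quot hp) (p.liftQ (Hom.lin f) h) fun v => by
    obtain ⟨v, rfl⟩ := p.mkQ_surjective v
    refine (Hom.colinear f v).trans ?_
    exact LinearMap.rTensor_comp_apply A ((p.liftQ (Hom.lin f) h).restrictScalars k)
      (p.mkQ.restrictScalars k) _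

end sub

theorem isStable_ker (f : V ⟶ W) : IsStable V (LinearMap.ker (Hom.lin f)) := by
  intro v hv
  have h : Function.Exact ((LinearMap.ker (Hom.lin f)).subtype.restrictScalars k)
      ((Hom.lin f).restrictScalars k) := LinearMap.exact_subtype_ker_map (Hom.lin f)
  refine (Module.Flat.rTensor_exact A h (V.coact v)).1 ?_
  rw [← Hom.colinear, LinearMap.mem_ker.1 hv, map_zero]

theorem isStable_range (f : V ⟶ W) : IsStable W (LinearMap.range (Hom.lin f)) := by
  rintro _ ⟨v, rfl⟩
  refine ⟨((Hom.lin f).rangeRestrict.restrictScalars k).rTensor A (V.coact v), ?_⟩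
  rw [← LinearMap.rTensor_comp_apply, Hom.colinear]
  rfl

/-! ### Finite products -/

instance : Limits.HasZeroObject (YetterDrinfeld k A) :=
  ⟨⟨{ carrier := PUnit, coact := 0, coact_coassoc := by simp, coact_counit := by ext,
      coact_smul := by intros; simp }, by
    rw [Limits.IsZero.iff_id_eq_zero]; rfl⟩⟩

/-- The coaction on the direct sum of two Yetter-Drinfeld modules. -/
def prodCoact (V W : YetterDrinfeld k A) :
    V.carrier × W.carrier →ₗ[k] (V.carrier × W.carrier) ⊗[k] A :=
  LinearMap.coprod ((LinearMap.inl k V.carrier W.carrier).rTensor A ∘ₗ V.coact)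
    ((LinearMap.inr k V.carrier W.carrier).rTensor A ∘ₗ W.coact)

theorem prodCoact_comp_inl (V W : YetterDrinfeld k A) :
    prodCoact V W ∘ₗ LinearMap.inl k V.carrier W.carrier =
      (LinearMap.inl k V.carrier W.carrier).rTensor A ∘ₗ V.coact :=
  LinearMap.coprod_inl _ _

theorem prodCoact_comp_inr (V W : YetterDrinfeld k A) :
    prodCoact V W ∘ₗ LinearMap.inr k V.carrier W.carrier =
      (LinearMap.inr k V.carrier W.carrier).rTensor A ∘ₗ W.coact :=
  LinearMap.coprod_inr _ _

theorem rTensor_fst_comp_prodCoact (V W : YetterDrinfeld k A) :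
    (LinearMap.fst k V.carrier W.carrier).rTensor A ∘ₗ prodCoact V W =
      V.coact ∘ₗ LinearMap.fst k V.carrier W.carrier := by
  apply LinearMap.prod_ext
  · rw [LinearMap.comp_assoc, prodCoact_comp_inl, ← LinearMap.comp_assoc,
      ← LinearMap.rTensor_comp, LinearMap.fst_comp_inl, LinearMap.comp_assoc,
      LinearMap.fst_comp_inl]
    simp
  · rw [LinearMap.comp_assoc, prodCoact_comp_inr, ← LinearMap.comp_assoc,
      ← LinearMap.rTensor_comp, LinearMap.fst_comp_inr, LinearMap.comp_assoc,
      LinearMap.fst_comp_inr]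
    simp

theorem rTensor_snd_comp_prodCoact (V W : YetterDrinfeld k A) :
    (LinearMap.snd k V.carrier W.carrier).rTensor A ∘ₗ prodCoact V W =
      W.coact ∘ₗ LinearMap.snd k V.carrier W.carrier := by
  apply LinearMap.prod_ext
  · rw [LinearMap.comp_assoc, prodCoact_comp_inl, ← LinearMap.comp_assoc,
      ← LinearMap.rTensor_comp, LinearMap.snd_comp_inl, LinearMap.comp_assoc,
      LinearMap.snd_comp_inl]
    simp
  · rw [LinearMap.comp_assoc, prodCoact_comp_inr, ← LinearMap.comp_assoc,
      ← LinearMap.rTensor_comp, LinearMap.snd_comp_inr, LinearMap.comp_assoc,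
      LinearMap.snd_comp_inr]
    simp

/-- The direct sum of two Yetter-Drinfeld modules. -/
def prod (V W : YetterDrinfeld k A) : YetterDrinfeld k A where
  carrier := V.carrier × W.carrier
  coact := prodCoact V W
  coact_coassoc := by
    have h1 (v) := LinearMap.congr_fun V.coact_coassoc v
    have h2 (w) := LinearMap.congr_fun W.coact_coassoc w
    have i1 (v) := LinearMap.congr_fun (prodCoact_comp_inl V W) v
    have i2 (w) := LinearMap.congr_fun (prodCoact_comp_inr V W) w
    simp only [LinearMap.comp_apply, LinearEquiv.coe_coe] at h1 h2 i1 i2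
    apply LinearMap.prod_ext <;> apply LinearMap.ext <;> intro v <;>
      simp only [LinearMap.comp_apply, LinearEquiv.coe_coe]
    · rw [i1, ← LinearMap.rTensor_comp_apply, prodCoact_comp_inl, LinearMap.rTensor_comp_apply,
        assoc_rTensor, comul_rTensor, h1]
    · rw [i2, ← LinearMap.rTensor_comp_apply, prodCoact_comp_inr, LinearMap.rTensor_comp_apply,
        assoc_rTensor, comul_rTensor, h2]
  coact_counit := by
    have h1 (v) := LinearMap.congr_fun V.coact_counit v
    have h2 (w) := LinearMap.congr_fun W.coact_counit w
    have i1 (v) := LinearMap.congr_fun (prodCoact_comp_inl V W) v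
    have i2 (w) := LinearMap.congr_fun (prodCoact_comp_inr V W) w
    simp only [LinearMap.comp_apply, LinearEquiv.coe_coe] at h1 h2 i1 i2
    apply LinearMap.prod_ext <;> apply LinearMap.ext <;> intro v <;>
      simp only [LinearMap.comp_apply, LinearEquiv.coe_coe]
    · rw [i1, counit_rTensor, h1]; rfl
    · rw [i2, counit_rTensor, h2]; rfl
  coact_smul a v := by
    have h1 := ydTwist_naturality (k := k) (LinearMap.inl Aᵐᵒᵖ V.carrier W.carrier)
    have h2 := ydTwist_naturality (k := k) (LinearMap.inr Aᵐᵒᵖ V.carrier W.carrier)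
    have e1 : (LinearMap.inl Aᵐᵒᵖ V.carrier W.carrier).restrictScalars k =
      LinearMap.inl k _ _ := rfl
    have e2 : (LinearMap.inr Aᵐᵒᵖ V.carrier W.carrier).restrictScalars k =
      LinearMap.inr k _ _ := rfl
    rw [e1] at h1
    rw [e2] at h2
    simp [prodCoact, coact_smul, h1, h2]

instance : Limits.HasBinaryBiproducts (YetterDrinfeld k A) :=
  ⟨fun V W => Limits.HasBinaryBiproduct.mk
    (Limits.BinaryBiproductData.mk _ (Limits.isBinaryBilimitOfTotal
    { pt := prod V W
      fst := Hom.mk (V := prod V W) (LinearMap.fst Aᵐᵒᵖ _ _) fun v =>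
        (LinearMap.congr_fun (rTensor_fst_comp_prodCoact V W) v).symm
      snd := Hom.mk (V := prod V W) (LinearMap.snd Aᵐᵒᵖ _ _) fun v =>
        (LinearMap.congr_fun (rTensor_snd_comp_prodCoact V W) v).symm
      inl := Hom.mk (W := prod V W) (LinearMap.inl Aᵐᵒᵖ _ _) fun v =>
        LinearMap.congr_fun (prodCoact_comp_inl V W) v
      inr := Hom.mk (W := prod V W) (LinearMap.inr Aᵐᵒᵖ _ _) fun v =>
        LinearMap.congr_fun (prodCoact_comp_inr V W) v
      inl_fst := rfl
      inl_snd := rfl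
      inr_fst := rfl
      inr_snd := rfl } (by
        apply hom_ext
        rintro ⟨v, w⟩
        exact Prod.ext (add_zero v) (zero_add w))))⟩

instance : Limits.HasFiniteProducts (YetterDrinfeld k A) :=
  hasFiniteProducts_of_has_binary_and_terminal

/-! ### The category is abelian -/

/-- The linear map out of the image induced by a linear map vanishing on the kernel. -/
def rangeDesc (f : V ⟶ W) (g : V ⟶ X)
    (h : LinearMap.ker (Hom.lin f) ≤ LinearMap.ker (Hom.lin g)) :
    sub (isStable_range f) ⟶ X :=
  Hom.mk (V := sub (isStable_range f))
    ((LinearMap.ker (Hom.lin f)).liftQ (Hom.lin g) h ∘ₗ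
      (Hom.lin f).quotKerEquivRange.symm.toLinearMap) (by
    set l := (LinearMap.ker (Hom.lin f)).liftQ (Hom.lin g) h ∘ₗ
      (Hom.lin f).quotKerEquivRange.symm.toLinearMap with hl
    have hl' : l ∘ₗ (Hom.lin f).rangeRestrict = Hom.lin g := by
      ext v
      exact congrArg ((LinearMap.ker (Hom.lin f)).liftQ (Hom.lin g) h)
        ((Hom.lin f).quotKerEquivRange_symm_apply_image v ⟨v, rfl⟩)
    have key : l.restrictScalars k ∘ₗ (Hom.lin f).rangeRestrict.restrictScalars k =
        (Hom.lin g).restrictScalars k := by rw [← hl']; rfl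
    have hs : ∀ v, subCoact (isStable_range f) ((Hom.lin f).rangeRestrict v) =
        ((Hom.lin f).rangeRestrict.restrictScalars k).rTensor A (V.coact v) := by
      intro v
      apply incl_injective _ A
      rw [incl_subCoact, ← LinearMap.rTensor_comp_apply]
      exact Hom.colinear f v
    intro y
    obtain ⟨v, rfl⟩ := (Hom.lin f).surjective_rangeRestrict y
    refine (congrArg X.coact (LinearMap.congr_fun hl' v)).trans ?_
    refine Eq.trans ?_ (congrArg ((l.restrictScalars k).rTensor A) (hs v).symm)
    rw [← LinearMap.rTensor_comp_apply, key]
    exact Hom.colinear g v)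

theorem lin_rangeDesc (f : V ⟶ W) (g : V ⟶ X)
    (h : LinearMap.ker (Hom.lin f) ≤ LinearMap.ker (Hom.lin g)) (v : V.carrier) :
    Hom.lin (rangeDesc f g h) (⟨Hom.lin f v, v, rfl⟩ : LinearMap.range (Hom.lin f)) =
      Hom.lin g v := by
  exact congrArg ((LinearMap.ker (Hom.lin f)).liftQ (Hom.lin g) h)
    ((Hom.lin f).quotKerEquivRange_symm_apply_image v ⟨v, rfl⟩)

theorem ker_le_ker (f : V ⟶ W) (g : V ⟶ X) (hg : subι (isStable_ker f) ≫ g = 0) :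
    LinearMap.ker (Hom.lin f) ≤ LinearMap.ker (Hom.lin g) := fun v hv =>
  congrArg (fun q : sub (isStable_ker f) ⟶ X =>
    Hom.lin q (⟨v, hv⟩ : LinearMap.ker (Hom.lin f))) hg

/-- The kernel, cokernel and image of a morphism. -/
def abelianStruct (f : V ⟶ W) : Abelian.AbelianStruct f where
  kernelFork := Limits.KernelFork.ofι (subι (isStable_ker f)) (by
    ext v; exact v.2)
  isLimitKernelFork := Limits.KernelFork.IsLimit.ofι _ _
    (fun g h => subLift _ g fun x => by
      have := congrArg (fun q => Hom.lin q x) h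
      exact this)
    (fun _ _ => rfl)
    (fun g h m hm => by
      apply hom_ext; intro x
      apply Subtype.ext
      exact congrArg (fun q => Hom.lin q x) hm)
  cokernelCofork := Limits.CokernelCofork.ofπ (quotπ (isStable_range f)) (by
    ext v; exact (Submodule.Quotient.mk_eq_zero _).2 ⟨v, rfl⟩)
  isColimitCokernelCofork := Limits.CokernelCofork.IsColimit.ofπ _ _
    (fun g h => quotDesc _ g (by
      rintro _ ⟨v, rfl⟩
      exact congrArg (fun q => Hom.lin q v) h))
    (fun _ _ => rfl)
    (fun g h m hm => by
      apply hom_ext; intro x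
      obtain ⟨x, rfl⟩ := Submodule.mkQ_surjective _ x
      exact congrArg (fun q => Hom.lin q x) hm)
  image := sub (isStable_range f)
  imageπ := subLift _ f fun v => ⟨v, rfl⟩
  ι_imageπ := by
    apply hom_ext; rintro ⟨v, hv⟩; exact Subtype.ext hv
  imageIsCokernel := Limits.CokernelCofork.IsColimit.ofπ _ _
    (fun g hg => rangeDesc f g (ker_le_ker f g hg))
    (fun g hg => hom_ext fun v => lin_rangeDesc f g (ker_le_ker f g hg) v)
    (fun g hg m hm => by
      apply hom_ext
      rintro ⟨_, v, rfl⟩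
      exact (congrArg (fun q => Hom.lin q v) hm).trans (lin_rangeDesc f g (ker_le_ker f g hg) v).symm)
  imageι := subι _
  imageι_π := by
    apply hom_ext; rintro ⟨v, hv⟩; exact (Submodule.Quotient.mk_eq_zero _).2 hv
  imageIsKernel := Limits.KernelFork.IsLimit.ofι _ _
    (fun g h => subLift _ g fun x => by
      have := congrArg (fun q => Hom.lin q x) h
      exact (Submodule.Quotient.mk_eq_zero _).1 this)
    (fun _ _ => rfl)
    (fun g h m hm => by
      apply hom_ext; intro x
      apply Subtype.ext
      exact congrArg (fun q => Hom.lin q x) hm)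
  fac := rfl

instance : Abelian (YetterDrinfeld k A) := Abelian.mk' fun _ _ f => ⟨abelianStruct f⟩

/-! ### The trivial object -/

/-- The right action of `A` on the base field through the counit. -/
@[reducible]
def trivModule : Module Aᵐᵒᵖ k :=
  Module.compHom k ((Bialgebra.counitAlgHom k A).fromOpposite fun _ _ => Commute.all _ _).toRingHom

theorem trivModule_isScalarTower :
    letI := trivModule (k := k) (A := A)
    IsScalarTower k Aᵐᵒᵖ k :=
  letI := trivModule (k := k) (A := A)
  ⟨fun r a x => by
    change Coalgebra.counit (R := k) (unop (r • a)) * x = r • (Coalgebra.counit (unop a) * x)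
    simp [mul_assoc]⟩

theorem ydTwist_triv (c : k) (t : A ⊗[k] (A ⊗[k] A)) :
    letI := trivModule (k := k) (A := A)
    letI := trivModule_isScalarTower (k := k) (A := A)
    ydTwist k A k t (c ⊗ₜ 1) = c ⊗ₜ LinearMap.mul' k A ((HopfAlgebra.antipode k).rTensor A
      (((TensorProduct.lid k A).toLinearMap ∘ₗ
        (Coalgebra.counit (R := k) (A := A)).rTensor A).lTensor A t)) := by
  let _ := trivModule (k := k) (A := A)
  let _ := trivModule_isScalarTower (k := k) (A := A)
  induction t with
  | zero => simp
  | add t t' h h' => simp only [map_add, LinearMap.add_apply, tmul_add, h, h']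
  | tmul a s =>
    induction s with
    | zero => simp
    | add t t' h h' => simp only [map_add, tmul_add, LinearMap.add_apply, h, h']
    | tmul x y =>
      have : op x • c = Coalgebra.counit (R := k) x • c := rfl
      rw [ydTwist_tmul, this, smul_tmul]
      simp

variable (k A) in
/-- The trivial Yetter-Drinfeld module: the base field with action `c · a = ε(a) c` and
coaction `c ↦ c ⊗ 1`. -/
def triv : YetterDrinfeld k A :=
  letI := trivModule (k := k) (A := A)
  letI := trivModule_isScalarTower (k := k) (A := A)
  { carrier := k
    coact := (TensorProduct.mk k k A).flip 1
    coact_coassoc := by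
      ext
      simp [Algebra.TensorProduct.one_def]
    coact_counit := by
      ext
      simp
    coact_smul := fun a c => by
      have h : ((TensorProduct.lid k A).toLinearMap ∘ₗ
          (Coalgebra.counit (R := k) (A := A)).rTensor A).lTensor A (comulTwice k A a) =
          Coalgebra.comul a := by
        rw [comulTwice, LinearMap.comp_apply, ← LinearMap.lTensor_comp_apply]
        have : ((TensorProduct.lid k A).toLinearMap ∘ₗ
          (Coalgebra.counit (R := k) (A := A)).rTensor A) ∘ₗ Coalgebra.comul = LinearMap.id := by
          ext x; simp
        rw [this]; simp
      refine Eq.trans ?_ (ydTwist_triv c (comulTwice k A a)).symm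
      rw [h, HopfAlgebra.mul_antipode_rTensor_comul_apply]
      have : op a • c = Coalgebra.counit (R := k) a • c := rfl
      rw [this, Algebra.algebraMap_eq_smul_one, ← smul_tmul]
      rfl }

end YetterDrinfeld

end YetterDrinfeld

/-! ### Cohomological dimensions -/

section Dimensions

variable (k : Type u) [Field k]

section Hochschild

variable (A : Type u) [Ring A] [Algebra k A]

/-- The `A`-bimodule `A`, as a module over the enveloping algebra `A ⊗ Aᵐᵒᵖ`:
`(a ⊗ b) · x = a x b`. -/
def regularBimodule : ModuleCat.{u} (A ⊗[k] Aᵐᵒᵖ) :=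
  letI : Module (A ⊗[k] Aᵐᵒᵖ) A := TensorProduct.Algebra.module
  ModuleCat.of (A ⊗[k] Aᵐᵒᵖ) A

/-- The Hochschild cohomology `H^m(A, M) = Ext^m(A, M)`, computed in the category of
`A`-bimodules, that is, of modules over the enveloping algebra `A ⊗ Aᵐᵒᵖ`. -/
abbrev HochschildCohomology (M : ModuleCat.{u} (A ⊗[k] Aᵐᵒᵖ)) (m : ℕ) : Type u :=
  Abelian.Ext (regularBimodule k A) M m

/-- The Hochschild cohomological dimension
`cd(A) = sup {m | H^m(A, M) ≠ 0 for some A-bimodule M}`. -/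
def hochschildDim : ℕ∞ :=
  sSup {d : ℕ∞ | ∃ (m : ℕ) (M : ModuleCat.{u} (A ⊗[k] Aᵐᵒᵖ)),
    Nontrivial (HochschildCohomology k A M m) ∧ d = m}

end Hochschild

section GerstenhaberSchack

variable (A : Type u) [Ring A] [HopfAlgebra k A]

instance : HasExt.{u + 1} (YetterDrinfeld k A) := HasExt.standard _

/-- The Gerstenhaber-Schack cohomology `H_GS^m(A, V) = Ext^m(k, V)`, computed in the abelian
category of Yetter-Drinfeld modules over `A`, where `k` is the trivial Yetter-Drinfeld module. -/
abbrev GSCohomology (V : YetterDrinfeld k A) (m : ℕ) : Type (u + 1) :=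
  Abelian.Ext (YetterDrinfeld.triv k A) V m

/-- The Gerstenhaber-Schack cohomological dimension
`cd_GS(A) = sup {m | H_GS^m(A, V) ≠ 0 for some Yetter-Drinfeld module V}`. -/
def gerstenhaberSchackDim : ℕ∞ :=
  sSup {d : ℕ∞ | ∃ (m : ℕ) (V : YetterDrinfeld k A), Nontrivial (GSCohomology k A V m) ∧ d = m}

end GerstenhaberSchack

end Dimensions

section Generation

variable {k : Type*} [Field k] {A : Type*} [Ring A] [Bialgebra k A]

theorem mul_rTensor_mul_tmul (S : A →ₐ[k] Aᵐᵒᵖ) (z : A ⊗[k] A) (c d : A) :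
    LinearMap.mul' k A (((opLinearEquiv k).symm.toLinearMap ∘ₗ S.toLinearMap).rTensor A
      (z * c ⊗ₜ d)) =
      unop (S c) * LinearMap.mul' k A
        (((opLinearEquiv k).symm.toLinearMap ∘ₗ S.toLinearMap).rTensor A z) * d := by
  induction z with
  | zero => simp
  | add x y hx hy => simp only [add_mul, mul_add, map_add, hx, hy]
  | tmul a b => simp [mul_assoc]

theorem mul_lTensor_tmul_mul (S : A →ₐ[k] Aᵐᵒᵖ) (z : A ⊗[k] A) (a b : A) :
    LinearMap.mul' k A (((opLinearEquiv k).symm.toLinearMap ∘ₗ S.toLinearMap).lTensor A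
      (a ⊗ₜ b * z)) =
      a * LinearMap.mul' k A
        (((opLinearEquiv k).symm.toLinearMap ∘ₗ S.toLinearMap).lTensor A z) * unop (S b) := by
  induction z with
  | zero => simp
  | add x y hx hy => simp only [add_mul, mul_add, map_add, hx, hy]
  | tmul c d => simp [mul_assoc]

/-- A bialgebra with an anti-endomorphism satisfying the antipode identities on a set of
generators is a Hopf algebra. -/
@[reducible]
def hopfAlgebraOfGenerators (S : A →ₐ[k] Aᵐᵒᵖ) (s : Set A) (hs : Algebra.adjoin k s = ⊤)
    (h1 : ∀ x ∈ s, LinearMap.mul' k A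
      (((opLinearEquiv k).symm.toLinearMap ∘ₗ S.toLinearMap).rTensor A
        (Coalgebra.comul (R := k) x)) = algebraMap k A (Coalgebra.counit x))
    (h2 : ∀ x ∈ s, LinearMap.mul' k A
      (((opLinearEquiv k).symm.toLinearMap ∘ₗ S.toLinearMap).lTensor A
        (Coalgebra.comul (R := k) x)) = algebraMap k A (Coalgebra.counit x)) :
    HopfAlgebra k A where
  antipode := (opLinearEquiv k).symm.toLinearMap ∘ₗ S.toLinearMap
  mul_antipode_rTensor_comul := by
    apply LinearMap.ext
    intro x
    simp only [LinearMap.comp_apply, Algebra.linearMap_apply]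
    have hx : x ∈ Algebra.adjoin k s := hs ▸ trivial
    induction hx using Algebra.adjoin_induction with
    | mem x hx => exact h1 x hx
    | algebraMap r => simp [Algebra.TensorProduct.algebraMap_apply]
    | add x y _ _ hx hy => simp only [map_add, hx, hy]
    | mul x y _ _ hx hy =>
      have key : ∀ t : A ⊗[k] A, LinearMap.mul' k A
          (((opLinearEquiv k).symm.toLinearMap ∘ₗ S.toLinearMap).rTensor A
            (Coalgebra.comul (R := k) x * t)) = algebraMap k A (Coalgebra.counit x) *
          LinearMap.mul' k A
            (((opLinearEquiv k).symm.toLinearMap ∘ₗ S.toLinearMap).rTensor A t) := by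
        intro t
        induction t with
        | zero => simp
        | add t t' h h' => simp only [mul_add, map_add, h, h']
        | tmul c d =>
          rw [mul_rTensor_mul_tmul, hx, ← Algebra.commutes]
          simp [mul_assoc]
      rw [Bialgebra.comul_mul, key, hy, Bialgebra.counit_mul, map_mul]
  mul_antipode_lTensor_comul := by
    apply LinearMap.ext
    intro x
    simp only [LinearMap.comp_apply, Algebra.linearMap_apply]
    have hx : x ∈ Algebra.adjoin k s := hs ▸ trivial
    induction hx using Algebra.adjoin_induction with
    | mem x hx => exact h2 x hx
    | algebraMap r => simp [Algebra.TensorProduct.algebraMap_apply]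
    | add x y _ _ hx hy => simp only [map_add, hx, hy]
    | mul x y _ _ hx hy =>
      have key : ∀ t : A ⊗[k] A, LinearMap.mul' k A
          (((opLinearEquiv k).symm.toLinearMap ∘ₗ S.toLinearMap).lTensor A
            (t * Coalgebra.comul (R := k) y)) = algebraMap k A (Coalgebra.counit y) *
          LinearMap.mul' k A
            (((opLinearEquiv k).symm.toLinearMap ∘ₗ S.toLinearMap).lTensor A t) := by
        intro t
        induction t with
        | zero => simp
        | add t t' h h' => simp only [add_mul, mul_add, map_add, h, h']
        | tmul c d =>
          rw [mul_lTensor_tmul_mul, hy, ← Algebra.commutes]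
          simp [mul_assoc]
      rw [Bialgebra.comul_mul, key, hx, Bialgebra.counit_mul, map_mul, Algebra.commutes]

end Generation

section Matrices

variable {n : ℕ} {R : Type*} [Ring R]

theorem transpose_mul_of_commute (M N : Matrix (Fin n) (Fin n) R)
    (h : ∀ i j i' j', Commute (M i j) (N i' j')) : (M * N)ᵀ = Nᵀ * Mᵀ := by
  ext i j
  simp only [Matrix.transpose_apply, Matrix.mul_apply]
  exact Finset.sum_congr rfl fun l _ => h _ _ _ _

theorem map_op_mul_map_op (M N : Matrix (Fin n) (Fin n) R) :
    M.map op * N.map op = ((Nᵀ * Mᵀ)ᵀ).map op := by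
  ext i j
  simp [Matrix.mul_apply]

variable {k : Type*} [Field k] [Algebra k R]

variable (R) in
/-- A scalar matrix, viewed over a `k`-algebra. -/
abbrev scalarMat (F : Matrix (Fin n) (Fin n) k) : Matrix (Fin n) (Fin n) R :=
  F.map (algebraMap k R)

theorem scalarMat_mul (F G : Matrix (Fin n) (Fin n) k) :
    scalarMat R F * scalarMat R G = scalarMat R (F * G) :=
  (Matrix.map_mul (f := algebraMap k R)).symm

theorem scalarMat_one : scalarMat R (1 : Matrix (Fin n) (Fin n) k) = 1 := by
  simp [scalarMat]

variable (R) in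
theorem scalarMat_mul_inv (F : GL (Fin n) k) :
    scalarMat R F.val * scalarMat R F⁻¹.val = 1 := by
  rw [scalarMat_mul, ← Units.val_mul, mul_inv_cancel, Units.val_one, scalarMat_one]

variable (R) in
theorem scalarMat_inv_mul (F : GL (Fin n) k) :
    scalarMat R F⁻¹.val * scalarMat R F.val = 1 := by
  rw [scalarMat_mul, ← Units.val_mul, inv_mul_cancel, Units.val_one, scalarMat_one]

theorem transpose_scalarMat_mul (F : Matrix (Fin n) (Fin n) k) (M : Matrix (Fin n) (Fin n) R) :
    (scalarMat R F * M)ᵀ = Mᵀ * (scalarMat R F)ᵀ :=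
  transpose_mul_of_commute _ _ fun _ _ _ _ => Algebra.commutes _ _

theorem transpose_mul_scalarMat (F : Matrix (Fin n) (Fin n) k) (M : Matrix (Fin n) (Fin n) R) :
    (M * scalarMat R F)ᵀ = (scalarMat R F)ᵀ * Mᵀ :=
  transpose_mul_of_commute _ _ fun _ _ _ _ => (Algebra.commutes _ _).symm

theorem scalarMat_map {S : Type*} [Ring S] [Algebra k S] (f : R →ₐ[k] S)
    (F : Matrix (Fin n) (Fin n) k) : (scalarMat R F).map f = scalarMat S F := by
  ext; simp

theorem map_eq_one_mat {S : Type*} [Ring S] [Algebra k S] (f : R →ₐ[k] S)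
    {M : Matrix (Fin n) (Fin n) R}
    (h : ∀ i j, f (M i j) = f ((1 : Matrix (Fin n) (Fin n) R) i j)) : M.map f = 1 := by
  ext i j
  rw [Matrix.map_apply, h, Matrix.one_apply, Matrix.one_apply]
  split_ifs <;> simp

theorem map_mul_mat {S : Type*} [Ring S] [Algebra k S] (f : R →ₐ[k] S)
    (M N : Matrix (Fin n) (Fin n) R) : (M * N).map f = M.map f * N.map f :=
  Matrix.map_mul (f := (f : R →+* S))

theorem apply_eq_apply_one {S : Type*} [Ring S] [Algebra k S] (f : R →ₐ[k] S)
    {M : Matrix (Fin n) (Fin n) R} (hM : M.map f = 1) (i j : Fin n) :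
    f (M i j) = f ((1 : Matrix (Fin n) (Fin n) R) i j) := by
  rw [← Matrix.map_apply (f := f), hM, Matrix.one_apply, Matrix.one_apply]
  split_ifs <;> simp

theorem includeLeft_mul_includeRight_apply (M N : Matrix (Fin n) (Fin n) R) (i j : Fin n) :
    (M.map (Algebra.TensorProduct.includeLeft : R →ₐ[k] R ⊗[k] R) *
      N.map (Algebra.TensorProduct.includeRight : R →ₐ[k] R ⊗[k] R)) i j =
      ∑ l, M i l ⊗ₜ[k] N l j := by
  simp [Matrix.mul_apply]

theorem transpose_includeLeft_mul_includeRight (M N : Matrix (Fin n) (Fin n) R) :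
    (M.map (Algebra.TensorProduct.includeLeft : R →ₐ[k] R ⊗[k] R) *
      N.map (Algebra.TensorProduct.includeRight : R →ₐ[k] R ⊗[k] R))ᵀ =
    Nᵀ.map (Algebra.TensorProduct.includeRight : R →ₐ[k] R ⊗[k] R) *
      Mᵀ.map (Algebra.TensorProduct.includeLeft : R →ₐ[k] R ⊗[k] R) :=
  transpose_mul_of_commute _ _ fun _ _ _ _ => by simp [Commute, SemiconjBy]

theorem scalarMat_op (F : Matrix (Fin n) (Fin n) k) :
    scalarMat Rᵐᵒᵖ F = (scalarMat R F).map op := by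
  ext; simp

theorem map_op_eq_one {M : Matrix (Fin n) (Fin n) R} (h : M = 1) : Mᵀ.map op = 1 := by
  subst h
  ext i j
  rw [Matrix.transpose_one, Matrix.map_apply, Matrix.one_apply, Matrix.one_apply]
  split_ifs <;> rfl

theorem algebraMap_one_apply (i j : Fin n) :
    algebraMap k R ((1 : Matrix (Fin n) (Fin n) k) i j) = (1 : Matrix (Fin n) (Fin n) R) i j := by
  rw [Matrix.one_apply, Matrix.one_apply]
  split_ifs <;> simp

variable (R) in
theorem scalarMat_transpose_mul_inv (F : GL (Fin n) k) :
    (scalarMat R F.val)ᵀ * (scalarMat R F⁻¹.val)ᵀ = 1 := by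
  rw [← transpose_scalarMat_mul, scalarMat_inv_mul, Matrix.transpose_one]

variable (R) in
theorem scalarMat_transpose_inv_mul (F : GL (Fin n) k) :
    (scalarMat R F⁻¹.val)ᵀ * (scalarMat R F.val)ᵀ = 1 := by
  rw [← transpose_scalarMat_mul, scalarMat_mul_inv, Matrix.transpose_one]

end Matrices

section Cosovereign

variable {k : Type u} [Field k] {n : ℕ}

/-- The generators `u i j` and `v i j`. -/
inductive CosovGen (n : ℕ) : Type
  | u (i j : Fin n)
  | v (i j : Fin n)

variable (k n) in
/-- The matrix of free generators `u i j`. -/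
def freeU : Matrix (Fin n) (Fin n) (FreeAlgebra k (CosovGen n)) :=
  .of fun i j => FreeAlgebra.ι k (CosovGen.u i j)

variable (k n) in
/-- The matrix of free generators `v i j`. -/
def freeV : Matrix (Fin n) (Fin n) (FreeAlgebra k (CosovGen n)) :=
  .of fun i j => FreeAlgebra.ι k (CosovGen.v i j)

/-- The relations `u vᵗ = vᵗ u = 1` and `v F uᵗ F⁻¹ = F uᵗ F⁻¹ v = 1`, entry by entry. -/
inductive CosovRel (F : GL (Fin n) k) :
    FreeAlgebra k (CosovGen n) → FreeAlgebra k (CosovGen n) → Prop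
  | u_vt (i j : Fin n) : CosovRel F ((freeU k n * (freeV k n)ᵀ) i j)
      ((1 : Matrix (Fin n) (Fin n) (FreeAlgebra k (CosovGen n))) i j)
  | vt_u (i j : Fin n) : CosovRel F (((freeV k n)ᵀ * freeU k n) i j)
      ((1 : Matrix (Fin n) (Fin n) (FreeAlgebra k (CosovGen n))) i j)
  | v_ut (i j : Fin n) : CosovRel F
      ((freeV k n * scalarMat (FreeAlgebra k (CosovGen n)) F.val * (freeU k n)ᵀ *
        scalarMat (FreeAlgebra k (CosovGen n)) F⁻¹.val) i j)
      ((1 : Matrix (Fin n) (Fin n) (FreeAlgebra k (CosovGen n))) i j)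
  | ut_v (i j : Fin n) : CosovRel F
      ((scalarMat (FreeAlgebra k (CosovGen n)) F.val * (freeU k n)ᵀ *
        scalarMat (FreeAlgebra k (CosovGen n)) F⁻¹.val * freeV k n) i j)
      ((1 : Matrix (Fin n) (Fin n) (FreeAlgebra k (CosovGen n))) i j)

/-- The universal cosovereign Hopf algebra `H(F)`. -/
def CosovHopf (F : GL (Fin n) k) : Type u := RingQuot (CosovRel F)

namespace CosovHopf

variable (F : GL (Fin n) k)

instance : Ring (CosovHopf F) := inferInstanceAs (Ring (RingQuot (CosovRel F)))

instance : Algebra k (CosovHopf F) := inferInstanceAs (Algebra k (RingQuot (CosovRel F)))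

/-- The quotient map from the free algebra. -/
def mk : FreeAlgebra k (CosovGen n) →ₐ[k] CosovHopf F := RingQuot.mkAlgHom k (CosovRel F)

/-- The matrix `u` of generators. -/
def u : Matrix (Fin n) (Fin n) (CosovHopf F) := (freeU k n).map (mk F)

/-- The matrix `v` of generators. -/
def v : Matrix (Fin n) (Fin n) (CosovHopf F) := (freeV k n).map (mk F)

theorem mk_rel {x y} (h : CosovRel F x y) : mk F x = mk F y := RingQuot.mkAlgHom_rel k h

theorem u_mul_vt : u F * (v F)ᵀ = 1 := by
  have := map_eq_one_mat (mk F) fun i j => mk_rel F (CosovRel.u_vt i j)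
  rwa [map_mul_mat, Matrix.transpose_map] at this

theorem vt_mul_u : (v F)ᵀ * u F = 1 := by
  have := map_eq_one_mat (mk F) fun i j => mk_rel F (CosovRel.vt_u i j)
  rwa [map_mul_mat, Matrix.transpose_map] at this

theorem v_mul_ut : v F * scalarMat _ F.val * (u F)ᵀ * scalarMat _ F⁻¹.val = 1 := by
  have := map_eq_one_mat (mk F) fun i j => mk_rel F (CosovRel.v_ut i j)
  rwa [map_mul_mat, map_mul_mat, map_mul_mat, scalarMat_map, scalarMat_map,
    Matrix.transpose_map] at this

theorem ut_mul_v : scalarMat _ F.val * (u F)ᵀ * scalarMat _ F⁻¹.val * v F = 1 := by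
  have := map_eq_one_mat (mk F) fun i j => mk_rel F (CosovRel.ut_v i j)
  rwa [map_mul_mat, map_mul_mat, map_mul_mat, scalarMat_map, scalarMat_map,
    Matrix.transpose_map] at this

variable {F}

theorem algHom_ext {R : Type*} [Ring R] [Algebra k R] {f g : CosovHopf F →ₐ[k] R}
    (hu : ∀ i j, f (u F i j) = g (u F i j)) (hv : ∀ i j, f (v F i j) = g (v F i j)) : f = g := by
  apply RingQuot.ringQuot_ext' k
  apply FreeAlgebra.hom_ext
  ext x
  cases x with
  | u i j => exact hu i j
  | v i j => exact hv i j

variable (F) in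
theorem adjoin_eq_top :
    Algebra.adjoin k (Set.range (fun x => mk F (FreeAlgebra.ι k x))) = ⊤ := by
  have h : Set.range (fun x => mk F (FreeAlgebra.ι k x)) =
      mk F '' Set.range (FreeAlgebra.ι k) := (Set.range_comp _ _)
  rw [h, ← AlgHom.map_adjoin, FreeAlgebra.adjoin_range_ι, Algebra.map_top, AlgHom.range_eq_top]
  exact RingQuot.mkAlgHom_surjective k _

variable (F) in
/-- The algebra map out of `H(F)` given by two matrices that satisfy the relations. -/
def lift {R : Type*} [Ring R] [Algebra k R] (x y : Matrix (Fin n) (Fin n) R)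
    (h1 : x * yᵀ = 1) (h2 : yᵀ * x = 1)
    (h3 : y * scalarMat R F.val * xᵀ * scalarMat R F⁻¹.val = 1)
    (h4 : scalarMat R F.val * xᵀ * scalarMat R F⁻¹.val * y = 1) : CosovHopf F →ₐ[k] R :=
  RingQuot.liftAlgHom k ⟨FreeAlgebra.lift k fun
    | .u i j => x i j
    | .v i j => y i j, by
    set f : FreeAlgebra k (CosovGen n) →ₐ[k] R := FreeAlgebra.lift k fun
      | .u i j => x i j
      | .v i j => y i j with hf
    have hx : (freeU k n).map f = x := by ext i j; simp [hf, freeU]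
    have hy : (freeV k n).map f = y := by ext i j; simp [hf, freeV]
    intro a b hab
    cases hab with
    | u_vt i j => exact apply_eq_apply_one f (by rw [map_mul_mat, Matrix.transpose_map, hx, hy, h1]) i j
    | vt_u i j => exact apply_eq_apply_one f (by rw [map_mul_mat, Matrix.transpose_map, hx, hy, h2]) i j
    | v_ut i j =>
      exact apply_eq_apply_one f (by rw [map_mul_mat, map_mul_mat, map_mul_mat, scalarMat_map, scalarMat_map,
        Matrix.transpose_map, hx, hy, h3]) i j
    | ut_v i j =>
      exact apply_eq_apply_one f (by rw [map_mul_mat, map_mul_mat, map_mul_mat, scalarMat_map, scalarMat_map,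
        Matrix.transpose_map, hx, hy, h4]) i j⟩

section lift

variable {R : Type*} [Ring R] [Algebra k R] (x y : Matrix (Fin n) (Fin n) R)
    (h1 : x * yᵀ = 1) (h2 : yᵀ * x = 1)
    (h3 : y * scalarMat R F.val * xᵀ * scalarMat R F⁻¹.val = 1)
    (h4 : scalarMat R F.val * xᵀ * scalarMat R F⁻¹.val * y = 1)

@[simp]
theorem lift_u (i j : Fin n) : lift F x y h1 h2 h3 h4 (u F i j) = x i j := by
  have : u F i j = RingQuot.mkAlgHom k (CosovRel F) (FreeAlgebra.ι k (.u i j)) := rfl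
  rw [this, lift]
  refine (RingQuot.liftAlgHom_mkAlgHom_apply _ _ _ _).trans ?_
  simp

@[simp]
theorem lift_v (i j : Fin n) : lift F x y h1 h2 h3 h4 (v F i j) = y i j := by
  have : v F i j = RingQuot.mkAlgHom k (CosovRel F) (FreeAlgebra.ι k (.v i j)) := rfl
  rw [this, lift]
  refine (RingQuot.liftAlgHom_mkAlgHom_apply _ _ _ _).trans ?_
  simp

end lift

section structureMaps

variable (F)

section

variable {R : Type*} [Ring R] [Algebra k R] (f : CosovHopf F →ₐ[k] R)

theorem map_u_mul_vt : (u F).map f * (v F)ᵀ.map f = 1 := by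
  rw [← map_mul_mat, u_mul_vt]; simp

theorem map_vt_mul_u : (v F)ᵀ.map f * (u F).map f = 1 := by
  rw [← map_mul_mat, vt_mul_u]; simp

theorem map_v_mul_ut :
    (v F).map f * scalarMat R F.val * (u F)ᵀ.map f * scalarMat R F⁻¹.val = 1 := by
  rw [← scalarMat_map f, ← scalarMat_map f, ← map_mul_mat, ← map_mul_mat,
    ← map_mul_mat, v_mul_ut]
  simp

theorem map_ut_mul_v :
    scalarMat R F.val * (u F)ᵀ.map f * scalarMat R F⁻¹.val * (v F).map f = 1 := by
  rw [← scalarMat_map f, ← scalarMat_map f, ← map_mul_mat, ← map_mul_mat,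
    ← map_mul_mat, ut_mul_v]
  simp

theorem map_v_mul_ut' :
    (v F).map f * scalarMat R F.val * (u F)ᵀ.map f = scalarMat R F.val := by
  have := congrArg (· * scalarMat R F.val) (map_v_mul_ut F f)
  simpa only [mul_assoc, scalarMat_inv_mul, mul_one, one_mul] using this

theorem map_ut_mul_v' :
    (u F)ᵀ.map f * scalarMat R F⁻¹.val * (v F).map f = scalarMat R F⁻¹.val := by
  have := congrArg (scalarMat R F⁻¹.val * ·) (map_ut_mul_v F f)
  simpa only [← mul_assoc, scalarMat_inv_mul, mul_one, one_mul] using this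

end

/-- The comultiplication `Δ(u) = u ⊗ u`, `Δ(v) = v ⊗ v` as an algebra map. -/
def comulHom : CosovHopf F →ₐ[k] CosovHopf F ⊗[k] CosovHopf F :=
  lift F
    ((u F).map (Algebra.TensorProduct.includeLeft : _ →ₐ[k] CosovHopf F ⊗[k] CosovHopf F) *
      (u F).map (Algebra.TensorProduct.includeRight : _ →ₐ[k] CosovHopf F ⊗[k] CosovHopf F))
    ((v F).map (Algebra.TensorProduct.includeLeft : _ →ₐ[k] CosovHopf F ⊗[k] CosovHopf F) *
      (v F).map (Algebra.TensorProduct.includeRight : _ →ₐ[k] CosovHopf F ⊗[k] CosovHopf F))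
    (by
      rw [transpose_includeLeft_mul_includeRight, mul_assoc,
        ← mul_assoc (Matrix.map _ _) (Matrix.map _ _) (Matrix.map _ _),
        map_u_mul_vt, one_mul, map_u_mul_vt])
    (by
      rw [transpose_includeLeft_mul_includeRight, mul_assoc,
        ← mul_assoc (Matrix.map _ _) (Matrix.map _ _) (Matrix.map _ _),
        map_vt_mul_u, one_mul, map_vt_mul_u])
    (by
      rw [transpose_includeLeft_mul_includeRight]
      refine Eq.trans ?_ (map_v_mul_ut F Algebra.TensorProduct.includeLeft)
      conv_rhs => rw [← map_v_mul_ut' F Algebra.TensorProduct.includeRight]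
      simp only [mul_assoc])
    (by
      rw [transpose_includeLeft_mul_includeRight]
      refine Eq.trans ?_ (map_ut_mul_v F Algebra.TensorProduct.includeRight)
      conv_rhs => rw [← map_ut_mul_v' F Algebra.TensorProduct.includeLeft]
      simp only [mul_assoc])

/-- The counit as an algebra map. -/
def counitHom : CosovHopf F →ₐ[k] k :=
  lift F 1 1 (by simp) (by simp)
    (by simp) (by simp)

/-- The matrix `F uᵗ F⁻¹`. -/
def antipodeV : Matrix (Fin n) (Fin n) (CosovHopf F) :=
  scalarMat (CosovHopf F) F.val * (u F)ᵀ * scalarMat (CosovHopf F) F⁻¹.val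

theorem antipodeV_transpose : (antipodeV F)ᵀ =
    (scalarMat (CosovHopf F) F⁻¹.val)ᵀ * (u F * (scalarMat (CosovHopf F) F.val)ᵀ) := by
  rw [antipodeV, transpose_mul_scalarMat, transpose_scalarMat_mul, Matrix.transpose_transpose]

theorem antipodeV_mul : antipodeV F * v F = 1 := ut_mul_v F

theorem mul_antipodeV : v F * antipodeV F = 1 := by
  simpa only [antipodeV, mul_assoc] using v_mul_ut F

/-- The antipode `S(u) = vᵗ`, `S(v) = F uᵗ F⁻¹` as an algebra map to the opposite algebra. -/
def antipodeHom : CosovHopf F →ₐ[k] (CosovHopf F)ᵐᵒᵖ :=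
  lift F ((v F)ᵀ.map op) ((antipodeV F).map op)
    (by
      rw [← Matrix.transpose_map, map_op_mul_map_op]
      exact map_op_eq_one (antipodeV_mul F))
    (by
      rw [← Matrix.transpose_map, map_op_mul_map_op]
      exact map_op_eq_one (mul_antipodeV F))
    (by
      rw [← Matrix.transpose_map, Matrix.transpose_transpose, scalarMat_op, scalarMat_op,
        map_op_mul_map_op, map_op_mul_map_op, map_op_mul_map_op]
      apply map_op_eq_one
      simp only [Matrix.transpose_transpose]
      rw [antipodeV_transpose, ← mul_assoc (scalarMat (CosovHopf F) F.val)ᵀ,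
        scalarMat_transpose_mul_inv, one_mul, ← mul_assoc (v F)ᵀ, vt_mul_u, one_mul,
        scalarMat_transpose_inv_mul])
    (by
      rw [← Matrix.transpose_map, Matrix.transpose_transpose, scalarMat_op, scalarMat_op,
        map_op_mul_map_op, map_op_mul_map_op, map_op_mul_map_op]
      apply map_op_eq_one
      simp only [Matrix.transpose_transpose]
      rw [antipodeV_transpose, mul_assoc, mul_assoc,
        ← mul_assoc (scalarMat (CosovHopf F) F.val)ᵀ (scalarMat (CosovHopf F) F⁻¹.val)ᵀ,
        scalarMat_transpose_mul_inv, one_mul, ← mul_assoc (u F), u_mul_vt, one_mul,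
        scalarMat_transpose_inv_mul])

theorem comulHom_u (i j : Fin n) : comulHom F (u F i j) = ∑ l, u F i l ⊗ₜ[k] u F l j := by
  rw [comulHom, lift_u, includeLeft_mul_includeRight_apply]

theorem comulHom_v (i j : Fin n) : comulHom F (v F i j) = ∑ l, v F i l ⊗ₜ[k] v F l j := by
  rw [comulHom, lift_v, includeLeft_mul_includeRight_apply]

theorem counitHom_u (i j : Fin n) :
    counitHom F (u F i j) = (1 : Matrix (Fin n) (Fin n) k) i j := by
  rw [counitHom, lift_u]

theorem counitHom_v (i j : Fin n) :
    counitHom F (v F i j) = (1 : Matrix (Fin n) (Fin n) k) i j := by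
  rw [counitHom, lift_v]

instance : Bialgebra k (CosovHopf F) :=
  Bialgebra.ofAlgHom (comulHom F) (counitHom F)
    (by
      apply algHom_ext <;> intro i j
      · simp [comulHom_u, tmul_sum, sum_tmul]
        exact Finset.sum_comm
      · simp [comulHom_v, tmul_sum, sum_tmul]
        exact Finset.sum_comm)
    (by
      apply algHom_ext <;> intro i j
      · simp [comulHom_u, counitHom_u, Matrix.one_apply, ite_tmul]
      · simp [comulHom_v, counitHom_v, Matrix.one_apply, ite_tmul])
    (by
      apply algHom_ext <;> intro i j
      · simp [comulHom_u, counitHom_u, Matrix.one_apply, tmul_ite]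
      · simp [comulHom_v, counitHom_v, Matrix.one_apply, tmul_ite])

theorem comul_u (i j : Fin n) :
    Coalgebra.comul (R := k) (u F i j) = ∑ l, u F i l ⊗ₜ[k] u F l j := comulHom_u F i j

theorem comul_v (i j : Fin n) :
    Coalgebra.comul (R := k) (v F i j) = ∑ l, v F i l ⊗ₜ[k] v F l j := comulHom_v F i j

theorem counit_u (i j : Fin n) :
    Coalgebra.counit (u F i j) = (1 : Matrix (Fin n) (Fin n) k) i j := counitHom_u F i j

theorem counit_v (i j : Fin n) :
    Coalgebra.counit (v F i j) = (1 : Matrix (Fin n) (Fin n) k) i j := counitHom_v F i j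

theorem unop_antipodeHom_u (i j : Fin n) : unop (antipodeHom F (u F i j)) = (v F)ᵀ i j := by
  rw [antipodeHom, lift_u]; rfl

theorem unop_antipodeHom_v (i j : Fin n) :
    unop (antipodeHom F (v F i j)) = antipodeV F i j := by
  rw [antipodeHom, lift_v]; rfl

instance : HopfAlgebra k (CosovHopf F) :=
  hopfAlgebraOfGenerators (antipodeHom F) _ (adjoin_eq_top F)
    (by
      rintro _ ⟨⟨i, j⟩ | ⟨i, j⟩, rfl⟩
      · change LinearMap.mul' k _ (LinearMap.rTensor _ _ (Coalgebra.comul (u F i j))) =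
          algebraMap k _ (Coalgebra.counit (u F i j))
        rw [comul_u, counit_u, algebraMap_one_apply, ← vt_mul_u]
        simp [unop_antipodeHom_u, Matrix.mul_apply]
      · change LinearMap.mul' k _ (LinearMap.rTensor _ _ (Coalgebra.comul (v F i j))) =
          algebraMap k _ (Coalgebra.counit (v F i j))
        rw [comul_v, counit_v, algebraMap_one_apply, ← antipodeV_mul]
        simp [unop_antipodeHom_v, Matrix.mul_apply])
    (by
      rintro _ ⟨⟨i, j⟩ | ⟨i, j⟩, rfl⟩
      · change LinearMap.mul' k _ (LinearMap.lTensor _ _ (Coalgebra.comul (u F i j))) =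
          algebraMap k _ (Coalgebra.counit (u F i j))
        rw [comul_u, counit_u, algebraMap_one_apply, ← u_mul_vt]
        simp [unop_antipodeHom_u, Matrix.mul_apply]
      · change LinearMap.mul' k _ (LinearMap.lTensor _ _ (Coalgebra.comul (v F i j))) =
          algebraMap k _ (Coalgebra.counit (v F i j))
        rw [comul_v, counit_v, algebraMap_one_apply, ← mul_antipodeV]
        simp [unop_antipodeHom_v, Matrix.mul_apply])

end structureMaps

end CosovHopf
end Cosovereign

section BilinearForm

variable {k : Type u} [Field k] {n : ℕ}

variable (k n) in
/-- The matrix of free generators `a i j`. -/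
def freeA : Matrix (Fin n) (Fin n) (FreeAlgebra k (Fin n × Fin n)) :=
  .of fun i j => FreeAlgebra.ι k (i, j)

/-- The relations `E⁻¹ aᵗ E a = a E⁻¹ aᵗ E = 1`, entry by entry. -/
inductive BilinRel (E : GL (Fin n) k) :
    FreeAlgebra k (Fin n × Fin n) → FreeAlgebra k (Fin n × Fin n) → Prop
  | at_a (i j : Fin n) : BilinRel E
      ((scalarMat (FreeAlgebra k (Fin n × Fin n)) E⁻¹.val * (freeA k n)ᵀ *
        scalarMat (FreeAlgebra k (Fin n × Fin n)) E.val * freeA k n) i j)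
      ((1 : Matrix (Fin n) (Fin n) (FreeAlgebra k (Fin n × Fin n))) i j)
  | a_at (i j : Fin n) : BilinRel E
      ((freeA k n * scalarMat (FreeAlgebra k (Fin n × Fin n)) E⁻¹.val * (freeA k n)ᵀ *
        scalarMat (FreeAlgebra k (Fin n × Fin n)) E.val) i j)
      ((1 : Matrix (Fin n) (Fin n) (FreeAlgebra k (Fin n × Fin n))) i j)

/-- The universal Hopf algebra `B(E)` of the bilinear form associated to `E`
(Dubois-Violette and Launer). -/
def BilinHopf (E : GL (Fin n) k) : Type u := RingQuot (BilinRel E)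

namespace BilinHopf

variable (E : GL (Fin n) k)

instance : Ring (BilinHopf E) := inferInstanceAs (Ring (RingQuot (BilinRel E)))

instance : Algebra k (BilinHopf E) := inferInstanceAs (Algebra k (RingQuot (BilinRel E)))

/-- The quotient map from the free algebra. -/
def mk : FreeAlgebra k (Fin n × Fin n) →ₐ[k] BilinHopf E := RingQuot.mkAlgHom k (BilinRel E)

/-- The matrix `a` of generators. -/
def a : Matrix (Fin n) (Fin n) (BilinHopf E) := (freeA k n).map (mk E)

theorem mk_rel {x y} (h : BilinRel E x y) : mk E x = mk E y := RingQuot.mkAlgHom_rel k h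

/-- The matrix `E⁻¹ aᵗ E`. -/
def antipodeA : Matrix (Fin n) (Fin n) (BilinHopf E) :=
  scalarMat (BilinHopf E) E⁻¹.val * (a E)ᵀ * scalarMat (BilinHopf E) E.val

theorem antipodeA_mul : antipodeA E * a E = 1 := by
  have := map_eq_one_mat (mk E) fun i j => mk_rel E (BilinRel.at_a i j)
  rwa [map_mul_mat, map_mul_mat, map_mul_mat, scalarMat_map, scalarMat_map,
    Matrix.transpose_map] at this

theorem mul_antipodeA : a E * antipodeA E = 1 := by
  have := map_eq_one_mat (mk E) fun i j => mk_rel E (BilinRel.a_at i j)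
  rw [map_mul_mat, map_mul_mat, map_mul_mat, scalarMat_map, scalarMat_map,
    Matrix.transpose_map] at this
  simpa only [antipodeA, a, mul_assoc] using this

theorem antipodeA_transpose : (antipodeA E)ᵀ =
    (scalarMat (BilinHopf E) E.val)ᵀ * (a E * (scalarMat (BilinHopf E) E⁻¹.val)ᵀ) := by
  rw [antipodeA, transpose_mul_scalarMat, transpose_scalarMat_mul, Matrix.transpose_transpose]

variable {E}

theorem algHom_ext {R : Type*} [Ring R] [Algebra k R] {f g : BilinHopf E →ₐ[k] R}
    (h : ∀ i j, f (a E i j) = g (a E i j)) : f = g := by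
  apply RingQuot.ringQuot_ext' k
  apply FreeAlgebra.hom_ext
  ext x
  exact h x.1 x.2

variable (E) in
theorem adjoin_eq_top :
    Algebra.adjoin k (Set.range (fun x => mk E (FreeAlgebra.ι k x))) = ⊤ := by
  have h : Set.range (fun x => mk E (FreeAlgebra.ι k x)) =
      mk E '' Set.range (FreeAlgebra.ι k) := (Set.range_comp _ _)
  rw [h, ← AlgHom.map_adjoin, FreeAlgebra.adjoin_range_ι, Algebra.map_top, AlgHom.range_eq_top]
  exact RingQuot.mkAlgHom_surjective k _

variable (E) in
/-- The algebra map out of `B(E)` given by a matrix that satisfies the relations. -/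
def lift {R : Type*} [Ring R] [Algebra k R] (x : Matrix (Fin n) (Fin n) R)
    (h1 : scalarMat R E⁻¹.val * xᵀ * scalarMat R E.val * x = 1)
    (h2 : x * scalarMat R E⁻¹.val * xᵀ * scalarMat R E.val = 1) : BilinHopf E →ₐ[k] R :=
  RingQuot.liftAlgHom k ⟨FreeAlgebra.lift k fun p => x p.1 p.2, by
    set f : FreeAlgebra k (Fin n × Fin n) →ₐ[k] R := FreeAlgebra.lift k fun p => x p.1 p.2 with hf
    have hx : (freeA k n).map f = x := by ext i j; simp [hf, freeA]
    intro a b hab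
    cases hab with
    | at_a i j =>
      exact apply_eq_apply_one f (by rw [map_mul_mat, map_mul_mat, map_mul_mat,
        scalarMat_map, scalarMat_map, Matrix.transpose_map, hx, h1]) i j
    | a_at i j =>
      exact apply_eq_apply_one f (by rw [map_mul_mat, map_mul_mat, map_mul_mat,
        scalarMat_map, scalarMat_map, Matrix.transpose_map, hx, h2]) i j⟩

@[simp]
theorem lift_a {R : Type*} [Ring R] [Algebra k R] (x : Matrix (Fin n) (Fin n) R)
    (h1 : scalarMat R E⁻¹.val * xᵀ * scalarMat R E.val * x = 1)
    (h2 : x * scalarMat R E⁻¹.val * xᵀ * scalarMat R E.val = 1) (i j : Fin n) :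
    lift E x h1 h2 (a E i j) = x i j := by
  have : a E i j = RingQuot.mkAlgHom k (BilinRel E) (FreeAlgebra.ι k (i, j)) := rfl
  rw [this, lift]
  refine (RingQuot.liftAlgHom_mkAlgHom_apply _ _ _ _).trans ?_
  simp

section structureMaps

variable (E)

section

variable {R : Type*} [Ring R] [Algebra k R] (f : BilinHopf E →ₐ[k] R)

theorem map_at_mul_a :
    scalarMat R E⁻¹.val * (a E)ᵀ.map f * scalarMat R E.val * (a E).map f = 1 := by
  rw [← scalarMat_map f, ← scalarMat_map f, ← map_mul_mat, ← map_mul_mat,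
    ← map_mul_mat]
  refine (congrArg (fun M => Matrix.map M f) (antipodeA_mul E)).trans ?_
  simp

theorem map_a_mul_at :
    (a E).map f * scalarMat R E⁻¹.val * (a E)ᵀ.map f * scalarMat R E.val = 1 := by
  rw [← scalarMat_map f, ← scalarMat_map f, ← map_mul_mat, ← map_mul_mat,
    ← map_mul_mat]
  have h : a E * scalarMat (BilinHopf E) E⁻¹.val * (a E)ᵀ * scalarMat (BilinHopf E) E.val = 1 := by
    simpa only [antipodeA, mul_assoc] using mul_antipodeA E
  refine (congrArg (fun M => Matrix.map M f) h).trans ?_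
  simp

theorem map_at_mul_a' :
    (a E)ᵀ.map f * scalarMat R E.val * (a E).map f = scalarMat R E.val := by
  have := congrArg (scalarMat R E.val * ·) (map_at_mul_a E f)
  simpa only [← mul_assoc, scalarMat_mul_inv, mul_one, one_mul] using this

theorem map_a_mul_at' :
    (a E).map f * scalarMat R E⁻¹.val * (a E)ᵀ.map f = scalarMat R E⁻¹.val := by
  have := congrArg (· * scalarMat R E⁻¹.val) (map_a_mul_at E f)
  simpa only [mul_assoc, scalarMat_mul_inv, mul_one, one_mul] using this

end

/-- The comultiplication `Δ(a) = a ⊗ a` as an algebra map. -/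
def comulHom : BilinHopf E →ₐ[k] BilinHopf E ⊗[k] BilinHopf E :=
  lift E
    ((a E).map (Algebra.TensorProduct.includeLeft : _ →ₐ[k] BilinHopf E ⊗[k] BilinHopf E) *
      (a E).map (Algebra.TensorProduct.includeRight : _ →ₐ[k] BilinHopf E ⊗[k] BilinHopf E))
    (by
      rw [transpose_includeLeft_mul_includeRight]
      refine Eq.trans ?_ (map_at_mul_a E Algebra.TensorProduct.includeRight)
      conv_rhs => rw [← map_at_mul_a' E Algebra.TensorProduct.includeLeft]
      simp only [mul_assoc])
    (by
      rw [transpose_includeLeft_mul_includeRight]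
      refine Eq.trans ?_ (map_a_mul_at E Algebra.TensorProduct.includeLeft)
      conv_rhs => rw [← map_a_mul_at' E Algebra.TensorProduct.includeRight]
      simp only [mul_assoc])

/-- The counit `ε(a) = 1` as an algebra map. -/
def counitHom : BilinHopf E →ₐ[k] k := lift E 1 (by simp) (by simp)

/-- The antipode `S(a) = E⁻¹ aᵗ E` as an algebra map to the opposite algebra. -/
def antipodeHom : BilinHopf E →ₐ[k] (BilinHopf E)ᵐᵒᵖ :=
  lift E ((antipodeA E).map op)
    (by
      rw [← Matrix.transpose_map, scalarMat_op, scalarMat_op,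
        map_op_mul_map_op, map_op_mul_map_op, map_op_mul_map_op]
      apply map_op_eq_one
      simp only [Matrix.transpose_transpose]
      rw [antipodeA_transpose, mul_assoc, mul_assoc,
        ← mul_assoc (scalarMat (BilinHopf E) E⁻¹.val)ᵀ (scalarMat (BilinHopf E) E.val)ᵀ,
        scalarMat_transpose_inv_mul, one_mul, ← mul_assoc (a E), mul_antipodeA, one_mul,
        scalarMat_transpose_mul_inv])
    (by
      rw [← Matrix.transpose_map, scalarMat_op, scalarMat_op,
        map_op_mul_map_op, map_op_mul_map_op, map_op_mul_map_op]
      apply map_op_eq_one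
      simp only [Matrix.transpose_transpose]
      rw [antipodeA_transpose, ← mul_assoc (scalarMat (BilinHopf E) E⁻¹.val)ᵀ,
        scalarMat_transpose_inv_mul, one_mul, ← mul_assoc (antipodeA E), antipodeA_mul, one_mul,
        scalarMat_transpose_mul_inv])

theorem comulHom_a (i j : Fin n) : comulHom E (a E i j) = ∑ l, a E i l ⊗ₜ[k] a E l j := by
  rw [comulHom, lift_a, includeLeft_mul_includeRight_apply]

theorem counitHom_a (i j : Fin n) :
    counitHom E (a E i j) = (1 : Matrix (Fin n) (Fin n) k) i j := by
  rw [counitHom, lift_a]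

instance : Bialgebra k (BilinHopf E) :=
  Bialgebra.ofAlgHom (comulHom E) (counitHom E)
    (by
      apply algHom_ext; intro i j
      simp [comulHom_a, tmul_sum, sum_tmul]
      exact Finset.sum_comm)
    (by
      apply algHom_ext; intro i j
      simp [comulHom_a, counitHom_a, Matrix.one_apply, ite_tmul])
    (by
      apply algHom_ext; intro i j
      simp [comulHom_a, counitHom_a, Matrix.one_apply, tmul_ite])

theorem comul_a (i j : Fin n) :
    Coalgebra.comul (R := k) (a E i j) = ∑ l, a E i l ⊗ₜ[k] a E l j := comulHom_a E i j

theorem counit_a (i j : Fin n) :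
    Coalgebra.counit (a E i j) = (1 : Matrix (Fin n) (Fin n) k) i j := counitHom_a E i j

theorem unop_antipodeHom_a (i j : Fin n) :
    unop (antipodeHom E (a E i j)) = antipodeA E i j := by
  rw [antipodeHom, lift_a]; rfl

instance : HopfAlgebra k (BilinHopf E) :=
  hopfAlgebraOfGenerators (antipodeHom E) _ (adjoin_eq_top E)
    (by
      rintro _ ⟨⟨i, j⟩, rfl⟩
      change LinearMap.mul' k _ (LinearMap.rTensor _ _ (Coalgebra.comul (a E i j))) =
        algebraMap k _ (Coalgebra.counit (a E i j))
      rw [comul_a, counit_a, algebraMap_one_apply, ← antipodeA_mul]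
      simp [unop_antipodeHom_a, Matrix.mul_apply])
    (by
      rintro _ ⟨⟨i, j⟩, rfl⟩
      change LinearMap.mul' k _ (LinearMap.lTensor _ _ (Coalgebra.comul (a E i j))) =
        algebraMap k _ (Coalgebra.counit (a E i j))
      rw [comul_a, counit_a, algebraMap_one_apply, ← mul_antipodeA]
      simp [unop_antipodeHom_a, Matrix.mul_apply])

end structureMaps

end BilinHopf

end BilinearForm

section FreeProduct

variable (k : Type u) [Field k] {I : Type} [DecidableEq I]
  (A : I → Type u) [∀ i, Ring (A i)] [∀ i, HopfAlgebra k (A i)]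

/-- The free product (coproduct of algebras) of a family of Hopf algebras. -/
def HopfFreeProduct : Type u := LinearAlgebra.FreeProduct k A

namespace HopfFreeProduct

open LinearAlgebra

instance : Ring (HopfFreeProduct k A) := inferInstanceAs (Ring (FreeProduct k A))

instance : Algebra k (HopfFreeProduct k A) := inferInstanceAs (Algebra k (FreeProduct k A))

/-- The canonical map from a factor. -/
def ι (i : I) : A i →ₐ[k] HopfFreeProduct k A := FreeProduct.ι k A i

variable {A}

/-- The algebra map out of the free product given by algebra maps on the factors. -/
def lift {R : Type*} [Ring R] [Algebra k R] (m : ∀ i, A i →ₐ[k] R) : HopfFreeProduct k A →ₐ[k] R :=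
  FreeProduct.lift k A fun {i} => m i

variable {k}

theorem algHom_ext {R : Type*} [Ring R] [Algebra k R] {f g : HopfFreeProduct k A →ₐ[k] R}
    (h : ∀ i (x : A i), f (ι k A i x) = g (ι k A i x)) : f = g := by
  apply (FreeProduct.lift k A).symm.injective
  ext i x
  exact h i x

@[simp]
theorem lift_ι {R : Type*} [Ring R] [Algebra k R] (m : ∀ i, A i →ₐ[k] R) (i : I) (x : A i) :
    lift k m (ι k A i x) = m i x :=
  DFunLike.congr_fun (FreeProduct.lift_comp_ι k A (fun {i} => m i)) x

variable (k A)

theorem adjoin_eq_top : Algebra.adjoin k (⋃ i, Set.range (ι k A i)) = ⊤ := by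
  set B := Algebra.adjoin k (⋃ i, Set.range (ι k A i)) with hB
  have hm : ∀ i (x : A i), ι k A i x ∈ B := fun i x =>
    Algebra.subset_adjoin (Set.mem_iUnion.2 ⟨i, x, rfl⟩)
  have h : B.val.comp (lift k fun i => (ι k A i).codRestrict B (hm i)) = AlgHom.id k _ := by
    apply algHom_ext
    intro i x
    exact congrArg B.val (lift_ι (fun i => (ι k A i).codRestrict B (hm i)) i x)
  rw [eq_top_iff]
  intro x _
  have := DFunLike.congr_fun h x
  rw [← AlgHom.id_apply (R := k) x, ← this]
  exact Subtype.prop _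

/-- The comultiplication: the algebra map extending those of the factors. -/
def comulHom : HopfFreeProduct k A →ₐ[k] HopfFreeProduct k A ⊗[k] HopfFreeProduct k A :=
  lift k fun i => (Algebra.TensorProduct.map (ι k A i) (ι k A i)).comp
    (Bialgebra.comulAlgHom k (A i))

/-- The counit: the algebra map extending those of the factors. -/
def counitHom : HopfFreeProduct k A →ₐ[k] k := lift k fun i => Bialgebra.counitAlgHom k (A i)

/-- The antipode of a Hopf algebra as an algebra map to the opposite algebra. -/
def antipodeOp (B : Type u) [Ring B] [HopfAlgebra k B] : B →ₐ[k] Bᵐᵒᵖ :=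
  AlgHom.ofLinearMap ((opLinearEquiv k).toLinearMap ∘ₗ HopfAlgebra.antipode k)
    (by simp) (by intro x y; simp [HopfAlgebra.antipode_mul_antidistrib])

/-- The antipode: the anti-homomorphism extending those of the factors. -/
def antipodeHom : HopfFreeProduct k A →ₐ[k] (HopfFreeProduct k A)ᵐᵒᵖ :=
  lift k fun i => (AlgHom.op (ι k A i)).comp (antipodeOp k (A i))

theorem comulHom_ι (i : I) (x : A i) : comulHom k A (ι k A i x) =
    TensorProduct.map (ι k A i).toLinearMap (ι k A i).toLinearMap (Coalgebra.comul x) := by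
  rw [comulHom, lift_ι]; rfl

theorem counitHom_ι (i : I) (x : A i) : counitHom k A (ι k A i x) = Coalgebra.counit x := by
  rw [counitHom, lift_ι]; rfl

theorem antipodeHom_ι (i : I) (x : A i) :
    antipodeHom k A (ι k A i x) = op (ι k A i (HopfAlgebra.antipode k x)) := by
  rw [antipodeHom, lift_ι]; rfl

instance : Bialgebra k (HopfFreeProduct k A) :=
  Bialgebra.ofAlgHom (comulHom k A) (counitHom k A)
    (by
      apply algHom_ext; intro i x
      have h := congrArg (TensorProduct.map (ι k A i).toLinearMap
        (TensorProduct.map (ι k A i).toLinearMap (ι k A i).toLinearMap))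
        (Coalgebra.coassoc_apply (R := k) x)
      rw [AlgHom.comp_apply, AlgHom.comp_apply, AlgHom.comp_apply, comulHom_ι]
      refine Eq.trans ?_ (h.trans ?_)
      · generalize Coalgebra.comul (R := k) x = z
        induction z with
        | zero => simp
        | add y z hy hz => simp only [map_add, hy, hz]
        | tmul y z =>
          simp [comulHom_ι]
          generalize Coalgebra.comul (R := k) y = w
          induction w with
          | zero => simp
          | add y z hy hz => simp only [map_add, add_tmul, hy, hz]
          | tmul y z => simp
      · generalize Coalgebra.comul (R := k) x = z
        induction z with
        | zero => simp
        | add y z hy hz => simp only [map_add, hy, hz]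
        | tmul y z => simp [comulHom_ι])
    (by
      apply algHom_ext; intro i x
      have h := congrArg (TensorProduct.map LinearMap.id (ι k A i).toLinearMap)
        (Coalgebra.rTensor_counit_comul (R := k) x)
      rw [AlgHom.comp_apply, comulHom_ι]
      refine Eq.trans ?_ (h.trans ?_)
      · generalize Coalgebra.comul (R := k) x = z
        induction z with
        | zero => simp
        | add y z hy hz => simp only [map_add, hy, hz]
        | tmul y z => simp [counitHom_ι]
      · simp)
    (by
      apply algHom_ext; intro i x
      have h := congrArg (TensorProduct.map (ι k A i).toLinearMap LinearMap.id)
        (Coalgebra.lTensor_counit_comul (R := k) x)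
      rw [AlgHom.comp_apply, comulHom_ι]
      refine Eq.trans ?_ (h.trans ?_)
      · generalize Coalgebra.comul (R := k) x = z
        induction z with
        | zero => simp
        | add y z hy hz => simp only [map_add, hy, hz]
        | tmul y z => simp [counitHom_ι]
      · simp)

theorem comul_ι (i : I) (x : A i) : Coalgebra.comul (R := k) (ι k A i x) =
    TensorProduct.map (ι k A i).toLinearMap (ι k A i).toLinearMap (Coalgebra.comul x) :=
  comulHom_ι k A i x

theorem counit_ι (i : I) (x : A i) :
    Coalgebra.counit (R := k) (ι k A i x) = Coalgebra.counit x := counitHom_ι k A i x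

instance : HopfAlgebra k (HopfFreeProduct k A) :=
  hopfAlgebraOfGenerators (antipodeHom k A) _ (adjoin_eq_top k A)
    (by
      intro y hy
      obtain ⟨i, x, rfl⟩ := Set.mem_iUnion.1 hy
      have h := congrArg (ι k A i) (HopfAlgebra.mul_antipode_rTensor_comul_apply (R := k) x)
      rw [comul_ι, counit_ι, ← AlgHom.commutes (ι k A i), ← h]
      generalize Coalgebra.comul (R := k) x = z
      induction z with
      | zero => simp
      | add y z hy hz => simp only [map_add, hy, hz]
      | tmul y z => simp [antipodeHom_ι])
    (by
      intro y hy
      obtain ⟨i, x, rfl⟩ := Set.mem_iUnion.1 hy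
      have h := congrArg (ι k A i) (HopfAlgebra.mul_antipode_lTensor_comul_apply (R := k) x)
      rw [comul_ι, counit_ι, ← AlgHom.commutes (ι k A i), ← h]
      generalize Coalgebra.comul (R := k) x = z
      induction z with
      | zero => simp
      | add y z hy hz => simp only [map_add, hy, hz]
      | tmul y z => simp [antipodeHom_ι])

end HopfFreeProduct

end FreeProduct

section Generic

variable {k : Type*} [Field k] {n : ℕ}

/-- `F` is normalizable if `tr F` and `tr F⁻¹` are both nonzero or both zero. -/
def IsNormalizable (F : GL (Fin n) k) : Prop :=
  (F.val.trace ≠ 0 ∧ F⁻¹.val.trace ≠ 0) ∨ (F.val.trace = 0 ∧ F⁻¹.val.trace = 0)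

/-- `F` is generic if it is normalizable and no solution `q` of `q² - s q + 1 = 0`, where `s` is a
square root of `tr F · tr F⁻¹`, is a root of unity of order at least `3`. -/
def IsGeneric (F : GL (Fin n) k) : Prop :=
  IsNormalizable F ∧ ∀ s q : k, s ^ 2 = F.val.trace * F⁻¹.val.trace → q ^ 2 - s * q + 1 = 0 →
    ∀ m : ℕ, 3 ≤ m → ¬ IsPrimitiveRoot q m

end Generic

end

/-!
Both Hopf algebras are of index two in a third one. Let `C = B(E) * k[ℤ/2]` be obtained from `B(E)`
by adjoining freely a grouplike involution `g`. The free product `A = B(E) * B(E)` embeds in `C` by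
sending the two copies of `b` to `b` and `g b g`, and `C = A ⊕ A g`. The algebra `H(F)` embeds in
`C` by `u ↦ a g`, `v ↦ Eᵗ g a E⁻ᵗ`, and again `C = H(F) ⊕ H(F) g`; this is where `F = Eᵗ E⁻¹` is
used. In terms of `w = E⁻ᵗ v Eᵗ`, the relations of `H(F)` say that `E⁻¹ wᵗ E` is inverse to `u` and
that `E⁻¹ uᵗ E` is inverse to `w` (`CosovHopf.liftPair`), which is symmetric in `u` and `w`, and
conjugation by `g` exchanges them. The directness of both sums is seen on the representation of `C`
by two-by-two matrices over the subalgebra, in which `g` is the exchange of coordinates and an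
element `x` of the subalgebra is `diag(x, g x g)` (`IndexTwoExtension.ofMatrix`). The two extensions
are `InvolutionHopf.squareExtension` and `CosovHopf.involutionExtension`.

It remains to see that an extension of index two changes neither cohomological dimension. Let `Res`
and `Ind` be functors between abelian categories that are adjoint to each other on both sides; they
are then exact. If `X` is a retract of `Res Z` and `Z` is a retract of `Ind X`, then
`Ext X` and `Ext Z` are nonzero in the same degrees
(`CategoryTheory.Abelian.Ext.exists_nontrivial_iff_of_ambidextrous`): a nonzero class in
`Ext (L X) Y` has a nonzero transpose in `Ext X (R Y)` for every adjunction `L ⊣ R` of exact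
functors. Neither enough injectives nor enough projectives are needed, since classes of
positive degree are products of classes of short exact sequences.

* For Hochschild cohomology, the categories are those of bimodules. The enveloping algebra of `C` is
  a Frobenius extension of that of the subalgebra, so that coextension of scalars is adjoint to
  restriction on both sides. The retractions exist because `1 · 1 + g · g = 2` is invertible.
* For Gerstenhaber-Schack cohomology, the restriction of a Yetter-Drinfeld module over `C` is its
  part of degree zero for the `ℤ/2`-grading that comes from the coalgebra decomposition
  `C = A ⊕ A g`; it is a submodule because the grading of `C` is cocentral. The induction of `W`
  is `W ⊗_A C`. They are adjoint on both sides (`HopfIndexTwo.indResAdj`,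
  `HopfIndexTwo.resIndAdj`), and the composite `k → Ind k → k` is multiplication by two.

The second equality is obtained in this way for every `F` of the form `Eᵗ E⁻¹`.
-/

noncomputable section

/-! ### Extension groups and functors adjoint on both sides -/

section ExtAdjunction

open Limits Abelian

universe w w' v v' u₁ u₂

namespace CochainComplex

open HomologicalComplex

/-- Let `L` be a cochain complex concentrated in degrees `≥ i`, quasi-isomorphic to `Y` placed in
degree `i` through `s`. Then `Y` embeds in `L.X i`, and the embedding factors through `s` because
`L` projects onto its bottom term. -/
lemma exists_mono_comp_eq_single_map {C : Type u₁} [Category.{v} C] [Abelian C]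
    {Y : C} {L : CochainComplex C ℤ} {i : ℤ}
    (s : (single C (ComplexShape.up ℤ) i).obj Y ⟶ L) [L.IsStrictlyGE i] [hs : QuasiIsoAt s i] :
    ∃ (m : Y ⟶ L.X i) (_ : Mono m) (r : L ⟶ (single C (ComplexShape.up ℤ) i).obj (L.X i)),
      s ≫ r = (single C (ComplexShape.up ℤ) i).map m := by
  let e := L.pOpcyclesIso (i - 1) i (by simp)
    ((L.isZero_of_isStrictlyGE i (i - 1) (by simp)).eq_of_src _ _)
  let α := (singleObjHomologySelfIso _ _ _).inv ≫ homologyMap s i ≫ L.homologyι i ≫ e.inv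
  have hα : s.f i = (singleObjXSelf (ComplexShape.up ℤ) i Y).hom ≫ α := by
    rw [← cancel_mono e.hom]
    dsimp [α, e]
    rw [Category.assoc, Category.assoc, Category.assoc, Category.assoc, Iso.inv_hom_id,
      Category.comp_id, homologyι_naturality, singleObjHomologySelfIso_inv_homologyι_assoc,
      ← pOpcycles_singleObjOpcyclesSelfIso_inv_assoc, Iso.inv_hom_id_assoc, p_opcyclesMap]
    rfl
  have : IsIso (homologyMap s i) := inferInstance
  have hm : Mono α := by dsimp only [α]; infer_instance
  refine ⟨α, hm, mkHomToSingle (𝟙 _) (by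
      rintro j rfl
      apply (L.isZero_of_isStrictlyGE (j + 1) j (by simp)).eq_of_src), ?_⟩
  apply HomologicalComplex.to_single_hom_ext
  rw [comp_f, mkHomToSingle_f, Category.id_comp, hα, single_map_f_self,
    Category.assoc]

end CochainComplex

namespace DerivedCategory

variable {C : Type u₁} [Category.{v} C] [Abelian C] [HasDerivedCategory.{w} C]

/-- A morphism in the derived category from a complex in degrees `≥ n` to an object placed in a
degree less than `n` dies along some monomorphism. -/
lemma exists_mono_comp_eq_zero {Y : C} {K : CochainComplex C ℤ} {i : ℤ}
    (φ : Q.obj K ⟶ Q.obj ((HomologicalComplex.single C (ComplexShape.up ℤ) i).obj Y))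
    (n : ℤ) (hn : i < n) [K.IsStrictlyGE n] :
    ∃ (J : C) (m : Y ⟶ J) (_ : Mono m),
      φ ≫ Q.map ((HomologicalComplex.single C (ComplexShape.up ℤ) i).map m) = 0 := by
  have : CochainComplex.IsStrictlyGE
      ((HomologicalComplex.single C (ComplexShape.up ℤ) i).obj Y) i :=
    inferInstanceAs (CochainComplex.IsStrictlyGE ((CochainComplex.singleFunctor C i).obj Y) i)
  obtain ⟨L, _, g, s, h, rfl⟩ := left_fac_of_isStrictlyGE φ i
  rw [isIso_Q_map_iff_quasiIso] at h
  obtain ⟨m, hm, r, hr⟩ := CochainComplex.exists_mono_comp_eq_single_map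
    (Y := Y) (s := s) (hs := h.quasiIsoAt i)
  refine ⟨_, m, hm, ?_⟩
  have hgr : g ≫ r = 0 := by
    apply HomologicalComplex.to_single_hom_ext
    apply (K.isZero_of_isStrictlyGE n i hn).eq_of_src
  rw [← hr, Q.map_comp, Category.assoc, IsIso.inv_hom_id_assoc, ← Q.map_comp, hgr, Q.map_zero]

end DerivedCategory

namespace CategoryTheory.Abelian.Ext

open _root_.DerivedCategory

variable {C : Type u₁} [Category.{v} C] [Abelian C] [HasExt.{w} C]

/-- Extension classes of positive degree are effaceable: each of them dies along some
monomorphism. No injective objects are needed. -/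
lemma exists_mono_comp_eq_zero {X Y : C} {n : ℕ} (e : Ext X Y (n + 1)) :
    ∃ (J : C) (m : Y ⟶ J) (_ : Mono m), e.comp (mk₀ m) (add_zero _) = 0 := by
  let K := (CochainComplex.singleFunctor C 0).obj X
  have := K.isStrictlyGE_of_ge (-n) 0 (by lia)
  let := HasDerivedCategory.standard C
  let I := (singleFunctors C).shiftIso ((n + 1 : ℕ) : ℤ) (-(n + 1 : ℕ)) 0 (by lia)
  obtain ⟨J, m, hm, h⟩ := DerivedCategory.exists_mono_comp_eq_zero (K := K)
    (e.hom ≫ I.hom.app Y) (-n) (by push_cast; lia)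
  refine ⟨J, m, hm, ?_⟩
  apply homEquiv.injective
  change (e.comp (mk₀ m) (add_zero _)).hom = (0 : Ext X J (n + 1)).hom
  rw [comp_hom, mk₀_hom, ShiftedHom.comp_mk₀, zero_hom, ← cancel_mono (I.hom.app J)]
  refine Eq.trans ?_ (h.trans Limits.zero_comp.symm)
  exact (Category.assoc _ _ _).trans
    ((congrArg (e.hom ≫ ·) (I.hom.naturality m)).trans (Category.assoc _ _ _).symm)

/-- Every extension class of positive degree is the product of a class of one degree less with the
class of a short exact sequence. -/
lemma exists_eq_comp_extClass {X Y : C} {n : ℕ} (e : Ext X Y (n + 1)) :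
    ∃ (J : C) (m : Y ⟶ J) (_ : Mono m)
      (hS : (ShortComplex.mk m (cokernel.π m) (cokernel.condition m)).ShortExact)
      (x : Ext X (cokernel m) n), x.comp hS.extClass rfl = e := by
  obtain ⟨J, m, hm, h⟩ := exists_mono_comp_eq_zero e
  have hS : (ShortComplex.mk m (cokernel.π m) (cokernel.condition m)).ShortExact :=
    { exact := ShortComplex.exact_cokernel m }
  obtain ⟨x, hx⟩ := covariant_sequence_exact₁ X hS e h rfl
  exact ⟨J, m, hm, hS, x, hx⟩

variable {D : Type u₂} [Category.{v'} D] [Abelian D] [HasExt.{w'} D]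

/-- A natural transformation from a composite of two exact functors to the identity is natural with
respect to extension classes. -/
lemma mapExactFunctor_comp_app (R : D ⥤ C) (L : C ⥤ D) [R.Additive] [L.Additive]
    [PreservesFiniteLimits R] [PreservesFiniteColimits R] [PreservesFiniteLimits L]
    [PreservesFiniteColimits L] (τ : R ⋙ L ⟶ 𝟭 D) {X Y : D} {n : ℕ} (e : Ext X Y n) :
    ((e.mapExactFunctor R).mapExactFunctor L).comp (mk₀ (τ.app Y)) (add_zero n) =
      (mk₀ (τ.app X)).comp e (zero_add n) := by
  induction n generalizing Y with
  | zero =>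
    obtain ⟨f, rfl⟩ := (mk₀_bijective X Y).2 e
    rw [mapExactFunctor_mk₀, mapExactFunctor_mk₀, mk₀_comp_mk₀, mk₀_comp_mk₀]
    exact congrArg mk₀ (τ.naturality f)
  | succ n ih =>
    obtain ⟨J, m, hm, hS, x, rfl⟩ := exists_eq_comp_extClass e
    let S := ShortComplex.mk m (cokernel.π m) (cokernel.condition m)
    let f : (S.map R).map L ⟶ S :=
      { τ₁ := τ.app _, τ₂ := τ.app _, τ₃ := τ.app _
        comm₁₂ := (τ.naturality m).symm
        comm₂₃ := (τ.naturality (cokernel.π m)).symm }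
    have h := ShortComplex.ShortExact.extClass_naturality
      ((hS.map_of_exact R).map_of_exact L) hS f
    have h1 : (hS.extClass.mapExactFunctor R).mapExactFunctor L =
        ((hS.map_of_exact R).map_of_exact L).extClass :=
      (congrArg (mapExactFunctor L) (mapExactFunctor_extClass R hS)).trans
        (mapExactFunctor_extClass L _)
    have h2 : ((hS.extClass.mapExactFunctor R).mapExactFunctor L).comp (mk₀ (τ.app Y))
        (add_zero 1) = (mk₀ (τ.app (cokernel m))).comp hS.extClass (zero_add 1) :=
      (congrArg (fun z => comp z (mk₀ (τ.app Y)) (add_zero 1)) h1).trans h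
    rw [mapExactFunctor_comp, mapExactFunctor_comp, comp_assoc_of_third_deg_zero, h2,
      ← comp_assoc_of_second_deg_zero]
    refine (congrArg (fun z => comp z hS.extClass rfl) (ih x)).trans ?_
    exact comp_assoc _ _ _ (zero_add n) rfl (by lia)

/-- For an adjunction between exact functors, a nonzero class in `Ext (L X) Y` yields a nonzero
class in `Ext X (R Y)`: the class is recovered from its transpose through the counit. -/
lemma nontrivial_of_adjunction {L : C ⥤ D} {R : D ⥤ C} (adj : L ⊣ R) [R.Additive] [L.Additive]
    [PreservesFiniteLimits R] [PreservesFiniteColimits R] [PreservesFiniteLimits L]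
    [PreservesFiniteColimits L] {X : C} {Y : D} {n : ℕ} (h : Nontrivial (Ext (L.obj X) Y n)) :
    Nontrivial (Ext X (R.obj Y) n) := by
  obtain ⟨e, he⟩ := exists_ne (0 : Ext (L.obj X) Y n)
  refine ⟨(mk₀ (adj.unit.app X)).comp (e.mapExactFunctor R) (zero_add n), 0, fun h0 => he ?_⟩
  have h1 := congrArg (mapExactFunctor L) h0
  rw [mapExactFunctor_comp, mapExactFunctor_mk₀, mapExactFunctor_zero] at h1
  have h2 := congrArg (fun z => comp z (mk₀ (adj.counit.app Y)) (add_zero n)) h1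
  rw [zero_comp, comp_assoc_of_third_deg_zero] at h2
  erw [mapExactFunctor_comp_app R L adj.counit e] at h2
  erw [mk₀_comp_mk₀_assoc, adj.left_triangle_components, mk₀_id_comp] at h2
  exact h2

/-- A retract of an object has nonzero `Ext` only where the object has. -/
lemma nontrivial_of_retract {X X' Y : C} (s : X ⟶ X') (r : X' ⟶ X) [IsIso (s ≫ r)] {n : ℕ}
    (h : Nontrivial (Ext X Y n)) : Nontrivial (Ext X' Y n) := by
  obtain ⟨e, he⟩ := exists_ne (0 : Ext X Y n)
  refine ⟨(mk₀ r).comp e (zero_add n), 0, fun h0 => he ?_⟩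
  have h1 := congrArg (fun z => (mk₀ (inv (s ≫ r) ≫ s)).comp z (zero_add n)) h0
  rwa [comp_zero, mk₀_comp_mk₀_assoc, Category.assoc, IsIso.inv_hom_id, mk₀_id_comp] at h1

/-- Let `Res` and `Ind` be functors between abelian categories that are adjoint on both sides. If
`X` is a retract of `Res Z` and `Z` is a retract of `Ind X`, then `Ext X` and `Ext Z` are
nonzero in the same degrees. -/
theorem exists_nontrivial_iff_of_ambidextrous {Ind : C ⥤ D} {Res : D ⥤ C} (adj : Ind ⊣ Res)
    (adj' : Res ⊣ Ind) {X : C} {Z : D}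
    (s : X ⟶ Res.obj Z) (r : Res.obj Z ⟶ X) [IsIso (s ≫ r)]
    (s' : Z ⟶ Ind.obj X) (r' : Ind.obj X ⟶ Z) [IsIso (s' ≫ r')] (n : ℕ) :
    (∃ M : C, Nontrivial (Ext X M n)) ↔ ∃ N : D, Nontrivial (Ext Z N n) := by
  have : PreservesFiniteLimits Ind :=
    have := adj'.rightAdjoint_preservesLimits
    PreservesLimits.preservesFiniteLimits _
  have : PreservesFiniteLimits Res :=
    have := adj.rightAdjoint_preservesLimits
    PreservesLimits.preservesFiniteLimits _
  have : PreservesFiniteColimits Ind :=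
    have := adj.leftAdjoint_preservesColimits
    PreservesColimits.preservesFiniteColimits _
  have : PreservesFiniteColimits Res :=
    have := adj'.leftAdjoint_preservesColimits
    PreservesColimits.preservesFiniteColimits _
  have : Ind.Additive := Functor.additive_of_preserves_binary_products _
  have : Res.Additive := Functor.additive_of_preserves_binary_products _
  constructor
  · rintro ⟨M, hM⟩
    exact ⟨_, nontrivial_of_adjunction adj' (nontrivial_of_retract s r hM)⟩
  · rintro ⟨N, hN⟩
    exact ⟨_, nontrivial_of_adjunction adj (nontrivial_of_retract s' r' hN)⟩

end CategoryTheory.Abelian.Ext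

end ExtAdjunction

/-! ### Frobenius extensions -/

section FrobeniusExtension

/-- A Frobenius extension of `k`-algebras: an algebra map `incl : A → C` together with an
`A`-bimodule map `proj : C → A` and dual bases `x`, `y` of `C` with respect to `proj`. -/
structure FrobeniusExtension (k A C : Type*) [Field k] [Ring A] [Algebra k A] [Ring C]
    [Algebra k C] where
  /-- the algebra map -/
  incl : A →ₐ[k] C
  /-- the Frobenius homomorphism -/
  proj : C →ₗ[k] A
  proj_incl_mul (a : A) (c : C) : proj (incl a * c) = a * proj c
  proj_mul_incl (c : C) (a : A) : proj (c * incl a) = proj c * a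
  /-- the index set of the dual bases -/
  idx : Type
  [fintypeIdx : Fintype idx]
  /-- the right basis -/
  x : idx → C
  /-- the left basis -/
  y : idx → C
  sum_x_mul (c : C) : ∑ j, x j * incl (proj (y j * c)) = c
  sum_mul_y (c : C) : ∑ j, incl (proj (c * x j)) * y j = c

namespace FrobeniusExtension

attribute [instance] fintypeIdx

variable {k A C A' C' : Type*} [Field k] [Ring A] [Algebra k A] [Ring C] [Algebra k C]
  [Ring A'] [Algebra k A'] [Ring C'] [Algebra k C']

/-- The opposite of a Frobenius extension; the dual bases exchange their roles. -/
def opposite (φ : FrobeniusExtension k A C) : FrobeniusExtension k Aᵐᵒᵖ Cᵐᵒᵖ where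
  incl := AlgHom.op φ.incl
  proj := (opLinearEquiv k).toLinearMap ∘ₗ φ.proj ∘ₗ (opLinearEquiv k).symm.toLinearMap
  proj_incl_mul a c := unop_injective (φ.proj_mul_incl (unop c) (unop a))
  proj_mul_incl c a := unop_injective (φ.proj_incl_mul (unop a) (unop c))
  idx := φ.idx
  x j := op (φ.y j)
  y j := op (φ.x j)
  sum_x_mul c := unop_injective ((Finset.unop_sum _ _).trans (φ.sum_mul_y (unop c)))
  sum_mul_y c := unop_injective ((Finset.unop_sum _ _).trans (φ.sum_x_mul (unop c)))

/-- The tensor product of two Frobenius extensions. -/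
def tensor (φ : FrobeniusExtension k A C) (ψ : FrobeniusExtension k A' C') :
    FrobeniusExtension k (A ⊗[k] A') (C ⊗[k] C') where
  incl := Algebra.TensorProduct.map φ.incl ψ.incl
  proj := TensorProduct.map φ.proj ψ.proj
  proj_incl_mul a c := by
    induction a with
    | zero => simp
    | add a b ha hb => simp only [map_add, add_mul, ha, hb]
    | tmul a a' =>
      induction c with
      | zero => simp
      | add c d hc hd => simp only [map_add, mul_add, hc, hd]
      | tmul c c' => simp [proj_incl_mul]
  proj_mul_incl c a := by
    induction a with
    | zero => simp
    | add a b ha hb => simp only [map_add, mul_add, ha, hb]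
    | tmul a a' =>
      induction c with
      | zero => simp
      | add c d hc hd => simp only [map_add, add_mul, hc, hd]
      | tmul c c' => simp [proj_mul_incl]
  idx := φ.idx × ψ.idx
  x j := φ.x j.1 ⊗ₜ ψ.x j.2
  y j := φ.y j.1 ⊗ₜ ψ.y j.2
  sum_x_mul c := by
    induction c with
    | zero => simp
    | add c d hc hd => simp only [map_add, mul_add, Finset.sum_add_distrib, hc, hd]
    | tmul c c' =>
      conv_rhs => rw [← φ.sum_x_mul c, ← ψ.sum_x_mul c']
      simp only [Fintype.sum_prod_type, sum_tmul, tmul_sum, Algebra.TensorProduct.tmul_mul_tmul,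
        TensorProduct.map_tmul, Algebra.TensorProduct.map_tmul]
      exact Finset.sum_comm
  sum_mul_y c := by
    induction c with
    | zero => simp
    | add c d hc hd => simp only [map_add, add_mul, Finset.sum_add_distrib, hc, hd]
    | tmul c c' =>
      conv_rhs => rw [← φ.sum_mul_y c, ← ψ.sum_mul_y c']
      simp only [Fintype.sum_prod_type, sum_tmul, tmul_sum, Algebra.TensorProduct.tmul_mul_tmul,
        TensorProduct.map_tmul, Algebra.TensorProduct.map_tmul]
      exact Finset.sum_comm

end FrobeniusExtension

namespace FrobeniusExtension

variable {k A C : Type u} [Field k] [Ring A] [Algebra k A] [Ring C] [Algebra k C]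
  (φ : FrobeniusExtension k A C)

/-- Restriction of scalars along a Frobenius extension. -/
abbrev res : ModuleCat.{u} C ⥤ ModuleCat.{u} A := ModuleCat.restrictScalars φ.incl.toRingHom

/-- Coextension of scalars along a Frobenius extension. -/
abbrev coext : ModuleCat.{u} A ⥤ ModuleCat.{u} C := ModuleCat.coextendScalars φ.incl.toRingHom

/-- An element of the coextended module, from an additive map `f` with `f (a c) = a f c`. -/
def mkCoext {M : ModuleCat.{u} A} (f : C →+ M) (hf : ∀ (a : A) (c : C), f (φ.incl a * c) = a • f c) :
    φ.coext.obj M :=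
  (ModuleCat.CoextendScalars.equiv _ M).symm
    { toFun := fun c : C => f c
      map_add' := fun c d : C => f.map_add c d
      map_smul' := fun a (c : C) => hf a c }

/-- Evaluation of an element of the coextended module. -/
def evalCoext {M : ModuleCat.{u} A} (h : φ.coext.obj M) : C →+ M :=
  (ModuleCat.CoextendScalars.equiv φ.incl.toRingHom M h).toAddMonoidHom

/-- Evaluation of an element coextended from a restricted module, with values in the original
module. -/
def evalRes {N : ModuleCat.{u} C} (h : φ.coext.obj (φ.res.obj N)) : C →+ N := φ.evalCoext h

variable {φ}

theorem evalRes_incl_mul {N : ModuleCat.{u} C} (h : φ.coext.obj (φ.res.obj N)) (a : A) (c : C) :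
    φ.evalRes h (φ.incl a * c) = φ.incl a • φ.evalRes h c :=
  (ModuleCat.CoextendScalars.equiv φ.incl.toRingHom (φ.res.obj N) h).map_smul a c

theorem evalCoext_incl_mul {M : ModuleCat.{u} A} (h : φ.coext.obj M) (a : A) (c : C) :
    φ.evalCoext h (φ.incl a * c) = a • φ.evalCoext h c :=
  (ModuleCat.CoextendScalars.equiv φ.incl.toRingHom M h).map_smul a c

theorem coext_ext {M : ModuleCat.{u} A} {h h' : φ.coext.obj M}
    (H : ∀ c, φ.evalCoext h c = φ.evalCoext h' c) : h = h' :=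
  ModuleCat.CoextendScalars.ext (LinearMap.ext fun c : C => H c)

variable (φ)

/-- The unit of the adjunction in which coextension is the left adjoint. -/
def coextResUnit : 𝟭 (ModuleCat.{u} A) ⟶ φ.coext ⋙ φ.res where
  app M := ModuleCat.ofHom (Y := φ.res.obj (φ.coext.obj M))
    { toFun := fun m => φ.mkCoext
        (AddMonoidHom.mk' (fun c => φ.proj c • m) fun c d => by rw [map_add, add_smul])
        fun a c => by
          change φ.proj (φ.incl a * c) • m = a • φ.proj c • m
          rw [φ.proj_incl_mul, mul_smul]
      map_add' := fun m m' => coext_ext fun c => smul_add (φ.proj c) m m'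
      map_smul' := fun a m => coext_ext fun c => by
        change φ.proj c • a • m = φ.proj (c * φ.incl a) • m
        rw [φ.proj_mul_incl, mul_smul] }
  naturality M M' f := by
    ext m
    exact coext_ext fun c => (f.hom.map_smul (φ.proj c) m).symm

variable {φ} in
/-- The value `∑ x h(y)` of the counit is linear over `C`, because `∑ x ⊗ y` is a Casimir element. -/
theorem sum_smul_evalRes_mul {N : ModuleCat.{u} C} (h : φ.coext.obj (φ.res.obj N)) (s : C) :
    ∑ j, φ.x j • φ.evalRes h (φ.y j * s) = s • ∑ j, φ.x j • φ.evalRes h (φ.y j) := by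
  have h1 (j : φ.idx) : φ.evalRes h (φ.y j * s) =
      ∑ l, φ.incl (φ.proj (φ.y j * (s * φ.x l))) • φ.evalRes h (φ.y l) := by
    conv_lhs => rw [← φ.sum_mul_y (φ.y j * s), map_sum]
    refine Finset.sum_congr rfl fun l _ => ?_
    rw [evalRes_incl_mul, mul_assoc]
  simp_rw [h1, Finset.smul_sum]
  rw [Finset.sum_comm]
  refine Finset.sum_congr rfl fun l _ => ?_
  simp_rw [← mul_smul]
  rw [← Finset.sum_smul, φ.sum_x_mul]

/-- The counit of the adjunction in which coextension is the left adjoint. -/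
def coextResCounit : φ.res ⋙ φ.coext ⟶ 𝟭 (ModuleCat.{u} C) where
  app N := ModuleCat.ofHom (X := φ.coext.obj (φ.res.obj N)) (Y := N)
    { toFun := fun h => ∑ j, φ.x j • φ.evalRes h (φ.y j)
      map_add' := fun h h' => by
        have h1 (c : C) : φ.evalRes (h + h') c = φ.evalRes h c + φ.evalRes h' c := rfl
        simp only [h1, smul_add, Finset.sum_add_distrib]
      map_smul' := fun s h => sum_smul_evalRes_mul h s }
  naturality N N' f := by
    ext h
    change ∑ j, φ.x j • f.hom (φ.evalRes h (φ.y j)) = f.hom (∑ j, φ.x j • φ.evalRes h (φ.y j))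
    simp only [map_sum, map_smul]

/-- Along a Frobenius extension, coextension of scalars is also left adjoint to restriction. -/
def coextResAdj : φ.coext ⊣ φ.res :=
  Adjunction.mkOfUnitCounit
    { unit := φ.coextResUnit
      counit := φ.coextResCounit
      left_triangle := by
        ext M h
        refine coext_ext fun c => ?_
        have h0 (m : M) (d : C) : φ.evalCoext ((φ.coextResUnit.app M).hom m) d = φ.proj d • m := rfl
        have h1 : φ.evalCoext (((φ.coextResCounit.app _).hom
            ((φ.coext.map (φ.coextResUnit.app M)).hom h) : φ.coext.obj M)) c =
            ∑ j, φ.proj (c * φ.x j) • φ.evalCoext h (φ.y j) :=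
          (map_sum (AddMonoidHom.mk' (fun h' : φ.coext.obj M => φ.evalCoext h' c)
            fun _ _ => rfl) _ _)
        refine h1.trans ?_
        conv_rhs => rw [← φ.sum_mul_y c, map_sum]
        exact Finset.sum_congr rfl fun j _ => (evalCoext_incl_mul h _ _).symm
      right_triangle := by
        ext N n
        let n' : N := n
        change ∑ j, φ.x j • φ.incl (φ.proj (φ.y j)) • n' = n'
        simp_rw [← mul_smul]
        rw [← Finset.sum_smul]
        have := φ.sum_x_mul 1
        simp only [mul_one] at this
        rw [this, one_smul] }

/-! ### Hochschild cohomology along a Frobenius extension -/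

/-- The induced Frobenius extension of enveloping algebras. -/
abbrev enveloping : FrobeniusExtension k (A ⊗[k] Aᵐᵒᵖ) (C ⊗[k] Cᵐᵒᵖ) := φ.tensor φ.opposite

/-- The inclusion of `A` in `C` as a map of `A`-bimodules. -/
def bimoduleIncl : regularBimodule k A ⟶ φ.enveloping.res.obj (regularBimodule k C) :=
  letI : Module (A ⊗[k] Aᵐᵒᵖ) A := TensorProduct.Algebra.module
  letI : Module (C ⊗[k] Cᵐᵒᵖ) C := TensorProduct.Algebra.module
  ModuleCat.ofHom (X := A) (Y := φ.enveloping.res.obj (regularBimodule k C))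
    { toFun := fun a => φ.incl a
      map_add' := fun a b => map_add φ.incl a b
      map_smul' := fun t a => by
        change φ.incl (t • a) = (φ.enveloping.incl t • φ.incl a : C)
        induction t with
        | zero =>
          rw [map_zero]
          exact ((congrArg φ.incl (zero_smul (A ⊗[k] Aᵐᵒᵖ) a)).trans (map_zero _)).trans
            (zero_smul (C ⊗[k] Cᵐᵒᵖ) (φ.incl a)).symm
        | add t t' h h' => simp only [map_add, add_smul, h, h']
        | tmul b b' =>
          change φ.incl (b • b' • a) = φ.incl b • op (φ.incl (unop b')) • φ.incl a
          simp }

/-- The Frobenius homomorphism as a map of `A`-bimodules. -/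
def bimoduleProj : φ.enveloping.res.obj (regularBimodule k C) ⟶ regularBimodule k A :=
  letI : Module (A ⊗[k] Aᵐᵒᵖ) A := TensorProduct.Algebra.module
  letI : Module (C ⊗[k] Cᵐᵒᵖ) C := TensorProduct.Algebra.module
  ModuleCat.ofHom (X := φ.enveloping.res.obj (regularBimodule k C)) (Y := A)
    { toFun := fun c : C => φ.proj c
      map_add' := fun c d : C => map_add φ.proj c d
      map_smul' := fun t (c : C) => by
        change φ.proj (φ.enveloping.incl t • c) = t • φ.proj c
        induction t with
        | zero =>
          rw [map_zero]
          exact ((congrArg φ.proj (zero_smul (C ⊗[k] Cᵐᵒᵖ) c)).trans (map_zero _)).trans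
            (zero_smul (A ⊗[k] Aᵐᵒᵖ) (φ.proj c)).symm
        | add t t' h h' => simp only [map_add, add_smul, h, h']
        | tmul b b' =>
          change φ.proj (φ.incl b * (c * φ.incl (unop b'))) = b * (φ.proj c * unop b')
          rw [φ.proj_incl_mul, φ.proj_mul_incl] }

/-- A Frobenius extension that is split (`proj ∘ incl = id`) and separable (`∑ x y` is an
invertible scalar) preserves the Hochschild cohomological dimension. -/
theorem hochschildDim_eq (h1 : ∀ a, φ.proj (φ.incl a) = a) {r : k} (hr : r ≠ 0)
    (h2 : ∑ j, φ.x j * φ.y j = algebraMap k C r) :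
    hochschildDim k A = hochschildDim k C := by
  let adj := φ.enveloping.coextResAdj
  let adj' := ModuleCat.restrictCoextendScalarsAdj.{u, u, u} φ.enveloping.incl.toRingHom
  let s := φ.bimoduleIncl
  let p := φ.bimoduleProj
  have hs : s ≫ p = 𝟙 _ := by
    ext a
    exact h1 a
  have : IsIso (s ≫ p) := hs ▸ inferInstance
  let s' := (adj'.homEquiv _ _) p
  let r' := (adj.homEquiv _ _).symm s
  have hc (c : C) : (s' ≫ r').hom c = (r • c : C) := by
    -- the composite is `c ↦ ∑ x (∑ proj (y c x) y)`, which collapses to `c ∑ x y`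
    change ∑ j : φ.idx × φ.idx, φ.x j.1 * (φ.incl (φ.proj (φ.y j.1 * (c * φ.x j.2))) * φ.y j.2) = _
    rw [Fintype.sum_prod_type, Finset.sum_comm]
    simp_rw [← mul_assoc, ← Finset.sum_mul]
    simp_rw [mul_assoc (φ.y _), φ.sum_x_mul, mul_assoc]
    rw [← Finset.mul_sum, h2, ← Algebra.commutes, Algebra.smul_def]
  have : IsIso (s' ≫ r') := by
    refine (ConcreteCategory.isIso_iff_bijective _).2 ⟨fun c d h => ?_, fun c => ?_⟩
    · exact smul_right_injective C hr ((hc c).symm.trans (h.trans (hc d)))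
    · exact ⟨(r⁻¹ • (show C from c) : C), (hc _).trans (smul_inv_smul₀ hr (show C from c))⟩
  have key := Abelian.Ext.exists_nontrivial_iff_of_ambidextrous adj adj' s p s' r'
  unfold hochschildDim
  congr 1
  ext d
  constructor
  · rintro ⟨m, M, hM, rfl⟩
    obtain ⟨N, hN⟩ := (key m).1 ⟨M, hM⟩
    exact ⟨m, N, hN, rfl⟩
  · rintro ⟨m, M, hM, rfl⟩
    obtain ⟨N, hN⟩ := (key m).2 ⟨M, hM⟩
    exact ⟨m, N, hN, rfl⟩

end FrobeniusExtension

end FrobeniusExtension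

/-! ### Extensions of index two -/

section IndexTwo

/-- An algebra extension `incl : A → C` of index two that is split by an involution `g`: `C` is
the direct sum of `A` and `A g`, where `g² = 1` and `g` normalizes `A`. Equivalently, `C` is the
crossed product of `A` by `ℤ/2`. -/
structure IndexTwoExtension (k A C : Type*) [Field k] [Ring A] [Algebra k A] [Ring C]
    [Algebra k C] where
  /-- the inclusion -/
  incl : A →ₐ[k] C
  /-- the involution -/
  g : C
  /-- conjugation by the involution -/
  twist : A →ₐ[k] A
  /-- the projection onto `A` along `A g` -/
  proj : C →ₗ[k] A
  g_mul_g : g * g = 1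
  g_mul_incl (a : A) : g * incl a = incl (twist a) * g
  proj_incl (a : A) : proj (incl a) = a
  proj_incl_mul_g (a : A) : proj (incl a * g) = 0
  decomp (c : C) : c = incl (proj c) + incl (proj (c * g)) * g

namespace IndexTwoExtension

section Algebra

variable {k A C : Type*} [Field k] [Ring A] [Algebra k A] [Ring C] [Algebra k C]
  (X : IndexTwoExtension k A C)

@[elab_as_elim]
theorem induction {motive : C → Prop} (h : ∀ a b, motive (X.incl a + X.incl b * X.g)) (c : C) :
    motive c := by
  rw [X.decomp c]
  exact h _ _

theorem incl_injective : Function.Injective X.incl :=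
  Function.LeftInverse.injective X.proj_incl

theorem incl_mul_g (a : A) : X.incl a * X.g = X.g * X.incl (X.twist a) := by
  have h := X.g_mul_incl a
  calc X.incl a * X.g = X.g * (X.g * X.incl a) * X.g := by
        rw [← mul_assoc, X.g_mul_g, one_mul]
    _ = X.g * X.incl (X.twist a) := by rw [h, mul_assoc, mul_assoc, X.g_mul_g, mul_one]

theorem g_mul_incl_mul_g (a : A) : X.g * X.incl a * X.g = X.incl (X.twist a) := by
  rw [X.g_mul_incl, mul_assoc, X.g_mul_g, mul_one]

theorem twist_twist (a : A) : X.twist (X.twist a) = a := by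
  apply X.incl_injective
  rw [← X.g_mul_incl_mul_g, ← X.incl_mul_g, mul_assoc, X.g_mul_g, mul_one]

theorem proj_one : X.proj 1 = 1 := by
  rw [← map_one X.incl, X.proj_incl]

theorem proj_g : X.proj X.g = 0 := by
  have := X.proj_incl_mul_g 1
  rwa [map_one, one_mul] at this

theorem proj_incl_mul (a : A) (c : C) : X.proj (X.incl a * c) = a * X.proj c := by
  induction c using X.induction with
  | h b d => simp only [mul_add, ← mul_assoc, ← map_mul, map_add, X.proj_incl, X.proj_incl_mul_g, mul_zero]

theorem proj_mul_incl (c : C) (a : A) : X.proj (c * X.incl a) = X.proj c * a := by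
  induction c using X.induction with
  | h b d =>
    rw [add_mul, mul_assoc _ X.g, X.g_mul_incl, ← mul_assoc, ← map_mul, ← map_mul]
    simp only [map_add, X.proj_incl, X.proj_incl_mul_g, add_zero]

theorem proj_g_mul_mul_g (c : C) : X.proj (X.g * c * X.g) = X.twist (X.proj c) := by
  induction c using X.induction with
  | h b d =>
    rw [mul_add, add_mul, X.g_mul_incl_mul_g, ← mul_assoc, X.g_mul_incl_mul_g, map_add,
      map_add, map_add, X.proj_incl_mul_g, X.proj_incl_mul_g, X.proj_incl, X.proj_incl, map_zero]

theorem proj_mul (c d : C) :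
    X.proj (c * d) = X.proj c * X.proj d + X.proj (c * X.g) * X.proj (X.g * d) := by
  conv_lhs => rw [X.decomp c]
  rw [add_mul, mul_assoc, map_add, X.proj_incl_mul, X.proj_incl_mul]

theorem decomp_left (c : C) : X.incl (X.proj c) + X.g * X.incl (X.proj (X.g * c)) = c := by
  conv_rhs => rw [X.decomp c]
  have h : X.proj (c * X.g) = X.twist (X.proj (X.g * c)) := by
    rw [← X.proj_g_mul_mul_g, ← mul_assoc, X.g_mul_g, one_mul]
  rw [X.g_mul_incl, h]

/-- An extension of index two is a Frobenius extension, with dual bases `1, g` and `1, g`. -/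
def frobenius : FrobeniusExtension k A C where
  incl := X.incl
  proj := X.proj
  proj_incl_mul := X.proj_incl_mul
  proj_mul_incl := X.proj_mul_incl
  idx := Fin 2
  x := ![1, X.g]
  y := ![1, X.g]
  sum_x_mul c := by simpa using X.decomp_left c
  sum_mul_y c := by simpa using (X.decomp c).symm

end Algebra

/-- An extension of index two preserves the Hochschild cohomological dimension. -/
theorem hochschildDim_eq {k A C : Type u} [Field k] [CharZero k] [Ring A] [Algebra k A] [Ring C]
    [Algebra k C] (X : IndexTwoExtension k A C) : hochschildDim k A = hochschildDim k C :=
  X.frobenius.hochschildDim_eq X.proj_incl (two_ne_zero (α := k)) (by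
    have h : ∑ j : Fin 2, (![1, X.g] : Fin 2 → C) j * (![1, X.g] : Fin 2 → C) j =
        algebraMap k C 2 := by
      rw [Fin.sum_univ_two]
      simp [X.g_mul_g, one_add_one_eq_two, map_ofNat]
    exact h)

end IndexTwoExtension

end IndexTwo

/-! ### Hopf algebra maps -/

section Involution

variable {k C : Type*} [Field k] [Ring C] [Algebra k C]

variable (k) in
/-- Conjugation by an element of square one. -/
def conjInvolution (g : C) (hg : g * g = 1) : C →ₐ[k] C :=
  AlgHom.ofLinearMap (LinearMap.mulRight k g ∘ₗ LinearMap.mulLeft k g) (by simp [hg])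
    (fun x y => by
      simp only [LinearMap.comp_apply, LinearMap.mulLeft_apply, LinearMap.mulRight_apply]
      rw [← mul_assoc (g * x * g), ← mul_assoc (g * x * g), mul_assoc (g * x) g g, hg, mul_one,
        ← mul_assoc g x])

theorem conjInvolution_apply (g : C) (hg : g * g = 1) (x : C) :
    conjInvolution k g hg x = g * x * g := rfl

end Involution

section HopfMaps

open WithConv

/-- An algebra map between Hopf algebras that is also a coalgebra map. -/
structure IsHopfMap {k A C : Type*} [Field k] [Ring A] [HopfAlgebra k A] [Ring C]
    [HopfAlgebra k C] (f : A →ₐ[k] C) : Prop where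
  comul (a : A) : Coalgebra.comul (R := k) (f a) =
    TensorProduct.map f.toLinearMap f.toLinearMap (Coalgebra.comul (R := k) a)
  counit (a : A) : Coalgebra.counit (R := k) (f a) = Coalgebra.counit (R := k) a

variable {k A C : Type*} [Field k] [Ring A] [HopfAlgebra k A] [Ring C] [HopfAlgebra k C]

/-- A bialgebra map between Hopf algebras commutes with the antipodes: both composites are the
convolution inverse of the map. -/
theorem IsHopfMap.antipode {f : A →ₐ[k] C} (hf : IsHopfMap f) (a : A) :
    HopfAlgebra.antipode k (f a) = f (HopfAlgebra.antipode k a) := by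
  let f' : A →ₗc[k] C :=
    { f.toLinearMap with
      counit_comp := LinearMap.ext hf.counit
      map_comp_comul := LinearMap.ext fun a => (hf.comul a).symm }
  have h : HopfAlgebra.antipode k ∘ₗ f.toLinearMap =
      f.toLinearMap ∘ₗ HopfAlgebra.antipode k := by
    apply WithConv.toConv_injective
    apply left_inv_eq_right_inv (a := toConv f.toLinearMap)
    · apply WithConv.ofConv_injective
      refine (LinearMap.convMul_comp_coalgHom_distrib
        (toConv (HopfAlgebra.antipode k (A := C))) (toConv (LinearMap.id : C →ₗ[k] C)) f').symm.trans
        ?_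
      rw [LinearMap.antipode_mul_id]
      ext a
      exact congrArg (algebraMap k C) (hf.counit a)
    · apply WithConv.ofConv_injective
      refine (LinearMap.algHom_comp_convMul_distrib f
        (toConv (LinearMap.id : A →ₗ[k] A)) (toConv (HopfAlgebra.antipode k (A := A)))).symm.trans ?_
      rw [LinearMap.id_mul_antipode]
      ext a
      exact f.commutes _
  exact LinearMap.congr_fun h a

theorem IsHopfMap.comp {D : Type*} [Ring D] [HopfAlgebra k D] {f : C →ₐ[k] D} {f' : A →ₐ[k] C}
    (hf : IsHopfMap f) (hf' : IsHopfMap f') : IsHopfMap (f.comp f') where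
  comul a := by
    rw [AlgHom.comp_apply, hf.comul, hf'.comul, AlgHom.comp_toLinearMap, TensorProduct.map_comp]
    rfl
  counit a := by rw [AlgHom.comp_apply, hf.counit, hf'.counit]

/-- A map is a Hopf map as soon as the two sides of the compatibility conditions, which are algebra
maps, agree. -/
theorem IsHopfMap.of_algHom_eq {f : A →ₐ[k] C}
    (h : (Bialgebra.comulAlgHom k C).comp f =
      (Algebra.TensorProduct.map f f).comp (Bialgebra.comulAlgHom k A))
    (h' : (Bialgebra.counitAlgHom k C).comp f = Bialgebra.counitAlgHom k A) : IsHopfMap f where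
  comul a := DFunLike.congr_fun h a
  counit a := DFunLike.congr_fun h' a

theorem isHopfMap_conjInvolution {g : C} (hg : g * g = 1)
    (h : Coalgebra.comul (R := k) g = g ⊗ₜ[k] g) (h' : Coalgebra.counit (R := k) g = 1) :
    IsHopfMap (conjInvolution k g hg) where
  comul a := by
    rw [conjInvolution_apply, Bialgebra.comul_mul, Bialgebra.comul_mul, h]
    generalize Coalgebra.comul (R := k) a = z
    induction z with
    | zero => simp
    | add x y hx hy => simp only [map_add, mul_add, add_mul, hx, hy]
    | tmul x y => simp [conjInvolution_apply]
  counit a := by simp [conjInvolution_apply, h']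

theorem TensorProduct.assoc_map_map {V W : Type*} [AddCommGroup V] [Module k V] [AddCommGroup W]
    [Module k W] (j : W →ₗ[k] V) (f : A →ₗ[k] C) (z : (W ⊗[k] A) ⊗[k] A) :
    TensorProduct.assoc k V C C (TensorProduct.map (TensorProduct.map j f) f z) =
      TensorProduct.map j (TensorProduct.map f f) (TensorProduct.assoc k W A A z) := by
  have : (TensorProduct.assoc k V C C).toLinearMap ∘ₗ TensorProduct.map (TensorProduct.map j f) f =
      TensorProduct.map j (TensorProduct.map f f) ∘ₗ
        (TensorProduct.assoc k W A A).toLinearMap := by ext; simp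
  exact LinearMap.congr_fun this z

theorem IsHopfMap.lTensor_comul_map {V W : Type*} [AddCommGroup V] [Module k V] [AddCommGroup W]
    [Module k W] {f : A →ₐ[k] C} (hf : IsHopfMap f) (j : W →ₗ[k] V) (z : W ⊗[k] A) :
    (Coalgebra.comul (R := k) (A := C)).lTensor V (TensorProduct.map j f.toLinearMap z) =
      TensorProduct.map j (TensorProduct.map f.toLinearMap f.toLinearMap)
        ((Coalgebra.comul (R := k) (A := A)).lTensor W z) := by
  induction z with
  | zero => simp
  | add x y hx hy => simp only [map_add, hx, hy]
  | tmul w a => simp [hf.comul]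

theorem IsHopfMap.lTensor_counit_map {V W : Type*} [AddCommGroup V] [Module k V] [AddCommGroup W]
    [Module k W] {f : A →ₐ[k] C} (hf : IsHopfMap f) (j : W →ₗ[k] V) (z : W ⊗[k] A) :
    TensorProduct.rid k V ((Coalgebra.counit (R := k) (A := C)).lTensor V
      (TensorProduct.map j f.toLinearMap z)) =
      j (TensorProduct.rid k W ((Coalgebra.counit (R := k) (A := A)).lTensor W z)) := by
  induction z with
  | zero => simp
  | add x y hx hy => simp only [map_add, hx, hy]
  | tmul w a => simp [hf.counit]

end HopfMaps

/-! ### The Yetter-Drinfeld compatibility -/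

section YetterDrinfeldCompat

variable {k A C : Type u} [Field k] [Ring A] [HopfAlgebra k A] [Ring C] [HopfAlgebra k C]

theorem IsHopfMap.comulTwice_map {f : A →ₐ[k] C} (hf : IsHopfMap f) (a : A) :
    comulTwice k C (f a) = TensorProduct.map f.toLinearMap
      (TensorProduct.map f.toLinearMap f.toLinearMap) (comulTwice k A a) := by
  rw [comulTwice, LinearMap.comp_apply, hf.comul, hf.lTensor_comul_map]
  rfl

variable {V W : Type u} [AddCommGroup V] [Module k V] [Module Cᵐᵒᵖ V] [IsScalarTower k Cᵐᵒᵖ V]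
  [AddCommGroup W] [Module k W] [Module Aᵐᵒᵖ W] [IsScalarTower k Aᵐᵒᵖ W]

theorem IsHopfMap.ydTwist_map {f : A →ₐ[k] C} (hf : IsHopfMap f) {j : W →ₗ[k] V}
    (hj : ∀ b w, j (op b • w) = op (f b) • j w) (t : A ⊗[k] (A ⊗[k] A)) (z : W ⊗[k] A) :
    ydTwist k C V (TensorProduct.map f.toLinearMap
      (TensorProduct.map f.toLinearMap f.toLinearMap) t) (TensorProduct.map j f.toLinearMap z) =
      TensorProduct.map j f.toLinearMap (ydTwist k A W t z) := by
  induction z with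
  | zero => simp
  | add x y hx hy => simp only [map_add, hx, hy]
  | tmul w x =>
    induction t with
    | zero => simp
    | add t t' h h' => simp only [map_add, LinearMap.add_apply, h, h']
    | tmul a s =>
      induction s with
      | zero => simp
      | add t t' h h' => simp only [map_add, tmul_add, LinearMap.add_apply, h, h']
      | tmul b c => simp [hf.antipode, hj]

theorem comulTwice_mul (c d : C) :
    comulTwice k C (c * d) = comulTwice k C c * comulTwice k C d := by
  have h (z w : C ⊗[k] C) : (Coalgebra.comul (R := k) (A := C)).lTensor C (z * w) =
      (Coalgebra.comul (R := k) (A := C)).lTensor C z *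
        (Coalgebra.comul (R := k) (A := C)).lTensor C w := by
    exact map_mul (Algebra.TensorProduct.map (AlgHom.id k C) (Bialgebra.comulAlgHom k C)) z w
  rw [comulTwice, LinearMap.comp_apply, Bialgebra.comul_mul, h]
  rfl

theorem ydTwist_mul (s t : C ⊗[k] (C ⊗[k] C)) (z : V ⊗[k] C) :
    ydTwist k C V (s * t) z = ydTwist k C V t (ydTwist k C V s z) := by
  induction z with
  | zero => simp
  | add x y hx hy => simp only [map_add, hx, hy]
  | tmul v x =>
    induction s with
    | zero => simp
    | add s s' h h' => simp only [map_add, add_mul, LinearMap.add_apply, h, h']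
    | tmul a s =>
      induction s with
      | zero => simp
      | add s s' h h' => simp only [map_add, tmul_add, add_mul, LinearMap.add_apply, h, h']
      | tmul b c =>
        induction t with
        | zero => simp
        | add s s' h h' => simp only [map_add, mul_add, LinearMap.add_apply, h, h']
        | tmul a' t =>
          induction t with
          | zero => simp
          | add s s' h h' => simp only [map_add, tmul_add, mul_add, LinearMap.add_apply, h, h']
          | tmul b' c' => simp [HopfAlgebra.antipode_mul_antidistrib, mul_smul, mul_assoc]

theorem ydTwist_comulTwice_one (z : V ⊗[k] C) : ydTwist k C V (comulTwice k C 1) z = z := by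
  have h : comulTwice k C 1 = 1 ⊗ₜ (1 ⊗ₜ 1) := by
    rw [comulTwice, LinearMap.comp_apply, Bialgebra.comul_one, Algebra.TensorProduct.one_def,
      LinearMap.lTensor_tmul, Bialgebra.comul_one, Algebra.TensorProduct.one_def]
  rw [h]
  induction z with
  | zero => simp
  | add x y hx hy => simp only [map_add, hx, hy]
  | tmul v x => simp

end YetterDrinfeldCompat

/-! ### Hopf algebra extensions of index two -/

section HopfIndexTwo

/-- A Hopf algebra extension of index two split by a grouplike involution. -/
structure HopfIndexTwo (k A C : Type*) [Field k] [Ring A] [HopfAlgebra k A] [Ring C]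
    [HopfAlgebra k C] extends IndexTwoExtension k A C where
  isHopfMap_incl : IsHopfMap incl
  comul_g : Coalgebra.comul (R := k) g = g ⊗ₜ[k] g
  counit_g : Coalgebra.counit (R := k) g = 1

namespace HopfIndexTwo

variable {k A C : Type*} [Field k] [Ring A] [HopfAlgebra k A] [Ring C] [HopfAlgebra k C]
  (X : HopfIndexTwo k A C)

theorem antipode_g : HopfAlgebra.antipode k X.g = X.g := by
  have h := HopfAlgebra.mul_antipode_rTensor_comul_apply (R := k) X.g
  rw [X.comul_g, X.counit_g] at h
  simp only [LinearMap.rTensor_tmul, LinearMap.mul'_apply, map_one] at h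
  calc HopfAlgebra.antipode k X.g = HopfAlgebra.antipode k X.g * X.g * X.g := by
        rw [mul_assoc, X.g_mul_g, mul_one]
    _ = X.g := by rw [h, one_mul]

/-- The embedding of `A` twisted by conjugation with the involution. -/
def twistedIncl : A →ₐ[k] C := X.incl.comp X.twist

theorem twistedIncl_apply (a : A) : X.twistedIncl a = X.g * X.incl a * X.g :=
  (X.g_mul_incl_mul_g a).symm

theorem isHopfMap_twistedIncl : IsHopfMap X.twistedIncl := by
  have h : X.twistedIncl = (conjInvolution k X.g X.g_mul_g).comp X.incl :=
    AlgHom.ext X.twistedIncl_apply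
  rw [h]
  exact (isHopfMap_conjInvolution X.g_mul_g X.comul_g X.counit_g).comp X.isHopfMap_incl

/-- The projection of `C` onto the image of `A`, as an endomorphism of `C`. -/
def inclProj : C →ₗ[k] C := X.incl.toLinearMap ∘ₗ X.proj

/-- The projection onto the image of `A` is the contraction of the comultiplication with the
functional `ε ∘ proj`, because `A` and `A g` are subcoalgebras. -/
theorem lid_counit_proj_comul (c : C) : TensorProduct.lid k C
    ((Coalgebra.counit (R := k) ∘ₗ X.proj).rTensor C (Coalgebra.comul (R := k) c)) =
      X.inclProj c := by
  have h1 (z : A ⊗[k] A) : TensorProduct.lid k C ((Coalgebra.counit (R := k) ∘ₗ X.proj).rTensor C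
      (TensorProduct.map X.incl.toLinearMap X.incl.toLinearMap z)) =
      X.incl (TensorProduct.lid k A ((Coalgebra.counit (R := k)).rTensor A z)) := by
    induction z with
    | zero => simp
    | add x y hx hy => simp only [map_add, hx, hy]
    | tmul x y => simp [X.proj_incl]
  have h2 (z : A ⊗[k] A) : TensorProduct.lid k C ((Coalgebra.counit (R := k) ∘ₗ X.proj).rTensor C
      (TensorProduct.map X.incl.toLinearMap X.incl.toLinearMap z * X.g ⊗ₜ[k] X.g)) = 0 := by
    induction z with
    | zero => simp
    | add x y hx hy => simp only [map_add, add_mul, hx, hy, add_zero]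
    | tmul x y => simp [X.proj_incl_mul_g]
  induction c using X.induction with
  | h a b =>
    rw [map_add, map_add, map_add, Bialgebra.comul_mul, X.comul_g, map_add, inclProj,
      LinearMap.comp_apply, LinearMap.comp_apply, X.proj_incl, X.proj_incl_mul_g,
      X.isHopfMap_incl.comul, X.isHopfMap_incl.comul, h1, h2]
    simp

theorem rid_counit_proj_comul (c : C) : TensorProduct.rid k C
    ((Coalgebra.counit (R := k) ∘ₗ X.proj).lTensor C (Coalgebra.comul (R := k) c)) =
      X.inclProj c := by
  have h1 (z : A ⊗[k] A) : TensorProduct.rid k C ((Coalgebra.counit (R := k) ∘ₗ X.proj).lTensor C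
      (TensorProduct.map X.incl.toLinearMap X.incl.toLinearMap z)) =
      X.incl (TensorProduct.rid k A ((Coalgebra.counit (R := k)).lTensor A z)) := by
    induction z with
    | zero => simp
    | add x y hx hy => simp only [map_add, hx, hy]
    | tmul x y => simp [X.proj_incl]
  have h2 (z : A ⊗[k] A) : TensorProduct.rid k C ((Coalgebra.counit (R := k) ∘ₗ X.proj).lTensor C
      (TensorProduct.map X.incl.toLinearMap X.incl.toLinearMap z * X.g ⊗ₜ[k] X.g)) = 0 := by
    induction z with
    | zero => simp
    | add x y hx hy => simp only [map_add, add_mul, hx, hy, add_zero]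
    | tmul x y => simp [X.proj_incl_mul_g]
  induction c using X.induction with
  | h a b =>
    rw [map_add, map_add, map_add, Bialgebra.comul_mul, X.comul_g, map_add, inclProj,
      LinearMap.comp_apply, LinearMap.comp_apply, X.proj_incl, X.proj_incl_mul_g,
      X.isHopfMap_incl.comul, X.isHopfMap_incl.comul, h1, h2]
    simp

end HopfIndexTwo

namespace HopfIndexTwo

variable {k A C : Type u} [Field k] [Ring A] [HopfAlgebra k A] [Ring C] [HopfAlgebra k C]
  (X : HopfIndexTwo k A C) {V : Type u} [AddCommGroup V] [Module k V] [Module Cᵐᵒᵖ V]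
  [IsScalarTower k Cᵐᵒᵖ V]

theorem comulTwice_g : comulTwice k C X.g = X.g ⊗ₜ (X.g ⊗ₜ X.g) := by
  rw [comulTwice, LinearMap.comp_apply, X.comul_g, LinearMap.lTensor_tmul, X.comul_g]

theorem ydTwist_g_tmul (v : V) (x : C) :
    ydTwist k C V (comulTwice k C X.g) (v ⊗ₜ x) = (op X.g • v) ⊗ₜ (X.g * (x * X.g)) := by
  rw [comulTwice_g, ydTwist_tmul, X.antipode_g]

/-- A property of elements of `C` that is additive and multiplicative holds as soon as it holds on
`A` and at the involution. -/
theorem forall_of_incl_of_g {p : C → Prop} (hi : ∀ a, p (X.incl a)) (hg : p X.g)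
    (hadd : ∀ c d, p c → p d → p (c + d)) (hmul : ∀ c d, p c → p d → p (c * d)) (c : C) : p c := by
  rw [X.decomp c]
  exact hadd _ _ (hi _) (hmul _ _ (hi _) hg)

/-- The Yetter-Drinfeld condition need only be checked on `A` and at the involution. -/
theorem coact_smul_of (coact : V →ₗ[k] V ⊗[k] C)
    (hi : ∀ a v, coact (op (X.incl a) • v) = ydTwist k C V (comulTwice k C (X.incl a)) (coact v))
    (hg : ∀ v, coact (op X.g • v) = ydTwist k C V (comulTwice k C X.g) (coact v)) (c : C) (v : V) :
    coact (op c • v) = ydTwist k C V (comulTwice k C c) (coact v) := by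
  induction c using X.forall_of_incl_of_g generalizing v with
  | hi a => exact hi a v
  | hg => exact hg v
  | hadd c d hc hd => rw [MulOpposite.op_add, add_smul, map_add, hc, hd, map_add, map_add, LinearMap.add_apply]
  | hmul c d hc hd => rw [MulOpposite.op_mul, mul_smul, hd, hc, comulTwice_mul, ydTwist_mul]

/-- The projection onto the part of degree zero commutes with the Yetter-Drinfeld twist: the
grading of `C` with components `A` and `A g` is cocentral. -/
theorem lTensor_inclProj_ydTwist (c : C) (z : V ⊗[k] C) :
    X.inclProj.lTensor V (ydTwist k C V (comulTwice k C c) z) =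
      ydTwist k C V (comulTwice k C c) (X.inclProj.lTensor V z) := by
  induction c using X.forall_of_incl_of_g generalizing z with
  | hi a =>
    rw [X.isHopfMap_incl.comulTwice_map]
    generalize comulTwice k A a = t
    induction z with
    | zero => simp
    | add x y hx hy => simp only [map_add, hx, hy]
    | tmul v x =>
      induction t with
      | zero => simp
      | add t t' h h' => simp only [map_add, LinearMap.add_apply, h, h']
      | tmul a s =>
        induction s with
        | zero => simp
        | add t t' h h' => simp only [map_add, tmul_add, LinearMap.add_apply, h, h']
        | tmul b c =>
          simp [X.isHopfMap_incl.antipode, inclProj, X.proj_incl_mul, X.proj_mul_incl]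
  | hg =>
    induction z with
    | zero => simp
    | add x y hx hy => simp only [map_add, hx, hy]
    | tmul v x =>
      rw [X.ydTwist_g_tmul, LinearMap.lTensor_tmul, LinearMap.lTensor_tmul, X.ydTwist_g_tmul,
        ← mul_assoc, ← mul_assoc, inclProj, LinearMap.comp_apply, LinearMap.comp_apply,
        X.proj_g_mul_mul_g]
      exact congrArg _ (X.g_mul_incl_mul_g _).symm
  | hadd c d hc hd => simp only [map_add, LinearMap.add_apply, hc, hd]
  | hmul c d hc hd => rw [comulTwice_mul, ydTwist_mul, ydTwist_mul, hd, hc]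

end HopfIndexTwo

end HopfIndexTwo

namespace HopfIndexTwo

open YetterDrinfeld

variable {k A C : Type u} [Field k] [Ring A] [HopfAlgebra k A] [Ring C] [HopfAlgebra k C]
  (X : HopfIndexTwo k A C)

/-! ### Induction of Yetter-Drinfeld modules -/

section Induction

/-- The carrier of the module induced from `A` to `C`: the pair `(w, w')` stands for
`w ⊗ 1 + w' ⊗ g` in `W ⊗_A C`. -/
def IndCarrier (_X : HopfIndexTwo k A C) (W : Type u) : Type u := W × W

section

variable {W : Type u}

variable {X} in
theorem IndCarrier.ext {w w' : X.IndCarrier W} (h : w.1 = w'.1) (h' : w.2 = w'.2) : w = w' :=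
  Prod.ext h h'

variable [AddCommGroup W]

instance : AddCommGroup (X.IndCarrier W) := inferInstanceAs (AddCommGroup (W × W))

@[simp] theorem IndCarrier.zero_fst : (0 : X.IndCarrier W).1 = 0 := rfl

@[simp] theorem IndCarrier.zero_snd : (0 : X.IndCarrier W).2 = 0 := rfl

@[simp] theorem IndCarrier.add_fst (w w' : X.IndCarrier W) : (w + w').1 = w.1 + w'.1 := rfl

@[simp] theorem IndCarrier.add_snd (w w' : X.IndCarrier W) : (w + w').2 = w.2 + w'.2 := rfl

section

variable [Module k W]

instance : Module k (X.IndCarrier W) := inferInstanceAs (Module k (W × W))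

@[simp] theorem IndCarrier.field_smul_fst (r : k) (w : X.IndCarrier W) : (r • w).1 = r • w.1 := rfl

@[simp] theorem IndCarrier.field_smul_snd (r : k) (w : X.IndCarrier W) : (r • w).2 = r • w.2 := rfl

variable (W) in
/-- The inclusion `w ↦ w ⊗ 1`. -/
def indInl : W →ₗ[k] X.IndCarrier W := LinearMap.inl k W W

variable (W) in
/-- The inclusion `w ↦ w ⊗ g`. -/
def indInr : W →ₗ[k] X.IndCarrier W := LinearMap.inr k W W

variable (W) in
/-- The first coordinate. -/
def indFst : X.IndCarrier W →ₗ[k] W := LinearMap.fst k W W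

theorem indInl_add_indInr (w : X.IndCarrier W) : X.indInl W w.1 + X.indInr W w.2 = w :=
  IndCarrier.ext (add_zero _) (zero_add _)

theorem indFst_comp_indInl : X.indFst W ∘ₗ X.indInl W = LinearMap.id := rfl

theorem indFst_comp_indInr : X.indFst W ∘ₗ X.indInr W = 0 := rfl

end

variable {X} in
@[elab_as_elim]
theorem IndCarrier.induction [Module k W] {motive : X.IndCarrier W → Prop}
    (hl : ∀ w, motive (X.indInl W w)) (hr : ∀ w, motive (X.indInr W w))
    (hadd : ∀ w w', motive w → motive w' → motive (w + w')) (w : X.IndCarrier W) : motive w := by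
  rw [← X.indInl_add_indInr w]
  exact hadd _ _ (hl _) (hr _)

variable [Module Aᵐᵒᵖ W]

instance : SMul Cᵐᵒᵖ (X.IndCarrier W) where
  smul c w := (op (X.proj (unop c)) • w.1 + op (X.proj (X.g * unop c)) • w.2,
    op (X.proj (unop c * X.g)) • w.1 + op (X.proj (X.g * (unop c * X.g))) • w.2)

variable {X} in
theorem IndCarrier.smul_fst (c : Cᵐᵒᵖ) (w : X.IndCarrier W) :
    (c • w).1 = op (X.proj (unop c)) • w.1 + op (X.proj (X.g * unop c)) • w.2 := rfl

variable {X} in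
theorem IndCarrier.smul_snd (c : Cᵐᵒᵖ) (w : X.IndCarrier W) :
    (c • w).2 = op (X.proj (unop c * X.g)) • w.1 + op (X.proj (X.g * (unop c * X.g))) • w.2 := rfl

instance : Module Cᵐᵒᵖ (X.IndCarrier W) where
  one_smul w := IndCarrier.ext (by simp [IndCarrier.smul_fst, X.proj_one, X.proj_g])
    (by simp [IndCarrier.smul_snd, X.proj_one, X.proj_g, X.g_mul_g])
  mul_smul c d w := by
    refine IndCarrier.ext ?_ ?_
    · simp only [IndCarrier.smul_fst, IndCarrier.smul_snd, unop_mul]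
      rw [← mul_assoc X.g, X.proj_mul (unop d) (unop c), X.proj_mul (X.g * unop d) (unop c)]
      simp only [mul_assoc, MulOpposite.op_add, MulOpposite.op_mul, add_smul, mul_smul, smul_add]
      abel
    · simp only [IndCarrier.smul_fst, IndCarrier.smul_snd, unop_mul]
      rw [mul_assoc, ← mul_assoc X.g (unop d), X.proj_mul (unop d) (unop c * X.g),
        X.proj_mul (X.g * unop d) (unop c * X.g)]
      simp only [mul_assoc, MulOpposite.op_add, MulOpposite.op_mul, add_smul, mul_smul, smul_add]
      abel
  smul_zero c := IndCarrier.ext (by simp [IndCarrier.smul_fst]) (by simp [IndCarrier.smul_snd])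
  smul_add c w w' := by
    refine IndCarrier.ext ?_ ?_ <;>
      simp only [IndCarrier.smul_fst, IndCarrier.smul_snd, IndCarrier.add_fst, IndCarrier.add_snd,
        smul_add] <;> abel
  zero_smul w := IndCarrier.ext (by simp [IndCarrier.smul_fst]) (by simp [IndCarrier.smul_snd])
  add_smul c d w := by
    refine IndCarrier.ext ?_ ?_ <;>
      simp only [IndCarrier.smul_fst, IndCarrier.smul_snd, IndCarrier.add_fst, IndCarrier.add_snd,
        MulOpposite.unop_add, add_mul, mul_add, map_add, MulOpposite.op_add, add_smul] <;> abel

variable [Module k W]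

theorem indInl_smul (a : A) (w : W) :
    X.indInl W (op a • w) = op (X.incl a) • X.indInl W w := by
  refine IndCarrier.ext ?_ ?_
  · rw [IndCarrier.smul_fst, unop_op, X.proj_incl]
    exact ((congrArg _ (smul_zero _)).trans (add_zero _)).symm
  · rw [IndCarrier.smul_snd, unop_op, X.proj_incl_mul_g]
    exact ((congrArg _ (smul_zero _)).trans ((add_zero _).trans (zero_smul _ _))).symm

theorem g_smul_indInl (w : W) : op X.g • X.indInl W w = X.indInr W w := by
  refine IndCarrier.ext ?_ ?_
  · rw [IndCarrier.smul_fst, unop_op, X.proj_g]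
    exact (congrArg _ (smul_zero _)).trans (by simp; rfl)
  · rw [IndCarrier.smul_snd, unop_op, X.g_mul_g, X.proj_one, mul_one, X.proj_g]
    exact (congrArg _ (smul_zero _)).trans (by simp; rfl)

theorem g_smul_indInr (w : W) : op X.g • X.indInr W w = X.indInl W w := by
  rw [← g_smul_indInl, ← mul_smul, ← MulOpposite.op_mul, X.g_mul_g, op_one, one_smul]

theorem indInr_smul (a : A) (w : W) :
    X.indInr W (op a • w) = op (X.twistedIncl a) • X.indInr W w := by
  rw [← g_smul_indInl, indInl_smul, ← g_smul_indInl, ← mul_smul, ← mul_smul, ← MulOpposite.op_mul,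
    ← MulOpposite.op_mul, twistedIncl_apply, ← mul_assoc, ← mul_assoc, X.g_mul_g, one_mul]

instance [IsScalarTower k Aᵐᵒᵖ W] : IsScalarTower k Cᵐᵒᵖ (X.IndCarrier W) where
  smul_assoc r c w := by
    refine IndCarrier.ext ?_ ?_ <;> simp [IndCarrier.smul_fst, IndCarrier.smul_snd]

end

variable (W : YetterDrinfeld k A)

/-- The coaction of the induced module. -/
def indCoact : X.IndCarrier W.carrier →ₗ[k] X.IndCarrier W.carrier ⊗[k] C :=
  LinearMap.coprod (TensorProduct.map (X.indInl W.carrier) X.incl.toLinearMap ∘ₗ W.coact)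
    (TensorProduct.map (X.indInr W.carrier) X.twistedIncl.toLinearMap ∘ₗ W.coact)

theorem indCoact_indInl (w : W.carrier) : X.indCoact W (X.indInl W.carrier w) =
    TensorProduct.map (X.indInl W.carrier) X.incl.toLinearMap (W.coact w) :=
  LinearMap.congr_fun (LinearMap.coprod_inl _ _) w

theorem indCoact_indInr (w : W.carrier) : X.indCoact W (X.indInr W.carrier w) =
    TensorProduct.map (X.indInr W.carrier) X.twistedIncl.toLinearMap (W.coact w) :=
  LinearMap.congr_fun (LinearMap.coprod_inr _ _) w

end Induction

end HopfIndexTwo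

section Transport

variable {k A C : Type u} [Field k] [Ring A] [HopfAlgebra k A] [Ring C] [HopfAlgebra k C]
  {f : A →ₐ[k] C} {W : YetterDrinfeld k A} {V : Type u} [AddCommGroup V]
  [Module k V] (coact : V →ₗ[k] V ⊗[k] C) {j : W.carrier →ₗ[k] V}

/-- Coassociativity is inherited along a map of comodules. -/
theorem IsHopfMap.coassoc_of_comodule (hf : IsHopfMap f)
    (hj : ∀ w, coact (j w) = TensorProduct.map j f.toLinearMap (W.coact w)) (w : W.carrier) :
    TensorProduct.assoc k V C C (coact.rTensor C (coact (j w))) =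
      (Coalgebra.comul (R := k) (A := C)).lTensor V (coact (j w)) := by
  have h1 (z : W.carrier ⊗[k] A) : coact.rTensor C (TensorProduct.map j f.toLinearMap z) =
      TensorProduct.map (TensorProduct.map j f.toLinearMap) f.toLinearMap
        (W.coact.rTensor A z) := by
    induction z with
    | zero => simp
    | add x y hx hy => simp only [map_add, hx, hy]
    | tmul w x => simp [hj]
  rw [hj, h1, TensorProduct.assoc_map_map, hf.lTensor_comul_map]
  exact congrArg _ (LinearMap.congr_fun W.coact_coassoc w)

/-- Counitality is inherited along a map of comodules. -/
theorem IsHopfMap.counit_of_comodule (hf : IsHopfMap f)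
    (hj : ∀ w, coact (j w) = TensorProduct.map j f.toLinearMap (W.coact w)) (w : W.carrier) :
    TensorProduct.rid k V ((Coalgebra.counit (R := k) (A := C)).lTensor V (coact (j w))) = j w := by
  rw [hj, hf.lTensor_counit_map]
  exact congrArg j (LinearMap.congr_fun W.coact_counit w)

/-- The Yetter-Drinfeld condition is inherited along a map of modules and comodules. -/
theorem IsHopfMap.coact_smul_of_comodule (hf : IsHopfMap f)
    (hj : ∀ w, coact (j w) = TensorProduct.map j f.toLinearMap (W.coact w)) [Module Cᵐᵒᵖ V] [IsScalarTower k Cᵐᵒᵖ V]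
    (hj' : ∀ b w, j (op b • w) = op (f b) • j w) (a : A) (w : W.carrier) :
    coact (op (f a) • j w) = ydTwist k C V (comulTwice k C (f a)) (coact (j w)) := by
  rw [← hj', hj, W.coact_smul, hf.comulTwice_map, hj, hf.ydTwist_map hj']

end Transport

namespace HopfIndexTwo

open YetterDrinfeld

variable {k A C : Type u} [Field k] [Ring A] [HopfAlgebra k A] [Ring C] [HopfAlgebra k C]
  (X : HopfIndexTwo k A C)

section Induction

variable (W : YetterDrinfeld k A)

/-- The Yetter-Drinfeld module over `C` induced from `W`: the module `W ⊗_A C` with coaction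
`w ⊗ c ↦ w₍₀₎ ⊗ c₍₂₎ ⊗ S(c₍₁₎) w₍₁₎ c₍₃₎`. -/
@[reducible]
def ind : YetterDrinfeld k C where
  carrier := X.IndCarrier W.carrier
  coact := X.indCoact W
  coact_coassoc := by
    apply LinearMap.ext
    intro w
    simp only [LinearMap.comp_apply, LinearEquiv.coe_coe]
    induction w using IndCarrier.induction with
    | hl w => exact X.isHopfMap_incl.coassoc_of_comodule _ (X.indCoact_indInl W) w
    | hr w => exact X.isHopfMap_twistedIncl.coassoc_of_comodule _ (X.indCoact_indInr W) w
    | hadd w w' h h' => simp only [map_add, h, h']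
  coact_counit := by
    apply LinearMap.ext
    intro w
    simp only [LinearMap.comp_apply, LinearEquiv.coe_coe, LinearMap.id_apply]
    induction w using IndCarrier.induction with
    | hl w => exact X.isHopfMap_incl.counit_of_comodule _ (X.indCoact_indInl W) w
    | hr w => exact X.isHopfMap_twistedIncl.counit_of_comodule _ (X.indCoact_indInr W) w
    | hadd w w' h h' => simp only [map_add, h, h']
  coact_smul := by
    have key (z : W.carrier ⊗[k] A) : ydTwist k C _ (comulTwice k C X.g)
        (TensorProduct.map (X.indInl W.carrier) X.incl.toLinearMap z) =
        TensorProduct.map (X.indInr W.carrier) X.twistedIncl.toLinearMap z := by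
      induction z with
      | zero => simp
      | add x y hx hy => simp only [map_add, hx, hy]
      | tmul w x =>
        rw [TensorProduct.map_tmul, TensorProduct.map_tmul, X.ydTwist_g_tmul, g_smul_indInl,
          ← mul_assoc]
        exact congrArg _ (X.twistedIncl_apply x).symm
    have hl (w : W.carrier) : X.indCoact W (op X.g • X.indInl W.carrier w) =
        ydTwist k C _ (comulTwice k C X.g) (X.indCoact W (X.indInl W.carrier w)) := by
      rw [g_smul_indInl, indCoact_indInl, indCoact_indInr, key]
    apply X.coact_smul_of
    · intro a w
      induction w using IndCarrier.induction with
      | hl w =>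
        exact X.isHopfMap_incl.coact_smul_of_comodule _ (X.indCoact_indInl W) X.indInl_smul a w
      | hr w =>
        have := X.isHopfMap_twistedIncl.coact_smul_of_comodule _ (X.indCoact_indInr W)
          X.indInr_smul (X.twist a) w
        rwa [twistedIncl, AlgHom.comp_apply, X.twist_twist] at this
      | hadd w w' h h' => rw [smul_add, map_add, map_add, map_add, h, h']
    · intro w
      induction w using IndCarrier.induction with
      | hl w => exact hl w
      | hr w =>
        rw [← g_smul_indInl, hl, ← ydTwist_mul, ← comulTwice_mul, ← mul_smul,
          ← MulOpposite.op_mul, X.g_mul_g, op_one, one_smul, ydTwist_comulTwice_one]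
      | hadd w w' h h' => rw [smul_add, map_add, map_add, map_add, h, h']

end Induction

/-! ### Restriction of Yetter-Drinfeld modules -/

section Restriction

variable (V : YetterDrinfeld k C)

theorem _root_.YetterDrinfeld.coact_injective : Function.Injective V.coact := by
  intro v w h
  have h1 := LinearMap.congr_fun V.coact_counit v
  have h2 := LinearMap.congr_fun V.coact_counit w
  simp only [LinearMap.comp_apply, LinearEquiv.coe_coe, LinearMap.id_apply] at h1 h2
  rw [← h1, ← h2, h]

theorem proj_inclProj (c : C) : X.proj (X.inclProj c) = X.proj c := X.proj_incl _

/-- The projection of a Yetter-Drinfeld module over `C` onto its part of degree zero, that is, onto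
the elements with coaction in `V ⊗ A`. -/
def degZero : V.carrier →ₗ[k] V.carrier :=
  (TensorProduct.rid k V.carrier).toLinearMap ∘ₗ
    (Coalgebra.counit (R := k) ∘ₗ X.proj).lTensor V.carrier ∘ₗ V.coact

theorem coact_degZero (v : V.carrier) :
    V.coact (X.degZero V v) = X.inclProj.lTensor V.carrier (V.coact v) := by
  have h1 (z : V.carrier ⊗[k] C) : V.coact (TensorProduct.rid k V.carrier
      ((Coalgebra.counit (R := k) ∘ₗ X.proj).lTensor V.carrier z)) =
      ((TensorProduct.rid k C).toLinearMap ∘ₗ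
        (Coalgebra.counit (R := k) ∘ₗ X.proj).lTensor C).lTensor V.carrier
        (TensorProduct.assoc k V.carrier C C (V.coact.rTensor C z)) := by
    induction z with
    | zero => simp
    | add x y hx hy => simp only [map_add, hx, hy]
    | tmul v x =>
      rw [LinearMap.lTensor_tmul, TensorProduct.rid_tmul, map_smul, LinearMap.rTensor_tmul]
      generalize V.coact v = z
      induction z with
      | zero => simp
      | add x y hx hy => simp only [map_add, add_tmul, smul_add, hx, hy]
      | tmul w y => simp
  have h2 := LinearMap.congr_fun V.coact_coassoc v
  simp only [LinearMap.comp_apply, LinearEquiv.coe_coe] at h2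
  rw [degZero, LinearMap.comp_apply, LinearMap.comp_apply, LinearEquiv.coe_coe, h1, h2,
    ← LinearMap.lTensor_comp_apply]
  congr 2
  exact LinearMap.ext X.rid_counit_proj_comul

theorem rTensor_degZero_coact (v : V.carrier) :
    (X.degZero V).rTensor C (V.coact v) = X.inclProj.lTensor V.carrier (V.coact v) := by
  have h1 (z : (V.carrier ⊗[k] C) ⊗[k] C) : ((TensorProduct.rid k V.carrier).toLinearMap ∘ₗ
      (Coalgebra.counit (R := k) ∘ₗ X.proj).lTensor V.carrier).rTensor C z =
      ((TensorProduct.lid k C).toLinearMap ∘ₗ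
        (Coalgebra.counit (R := k) ∘ₗ X.proj).rTensor C).lTensor V.carrier
        (TensorProduct.assoc k V.carrier C C z) := by
    induction z with
    | zero => simp
    | add x y hx hy => simp only [map_add, hx, hy]
    | tmul z x =>
      induction z with
      | zero => simp
      | add x y hx hy => simp only [map_add, add_tmul, hx, hy]
      | tmul w y => simp [smul_tmul]
  have h2 := LinearMap.congr_fun V.coact_coassoc v
  simp only [LinearMap.comp_apply, LinearEquiv.coe_coe] at h2
  rw [degZero, ← LinearMap.comp_assoc, LinearMap.rTensor_comp_apply, h1, h2,
    ← LinearMap.lTensor_comp_apply]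
  congr 2
  exact LinearMap.ext X.lid_counit_proj_comul

theorem degZero_smul (c : C) (v : V.carrier) :
    X.degZero V (op c • v) = op c • X.degZero V v := by
  apply V.coact_injective
  rw [coact_degZero, V.coact_smul, V.coact_smul, coact_degZero, lTensor_inclProj_ydTwist]

theorem degZero_degZero (v : V.carrier) : X.degZero V (X.degZero V v) = X.degZero V v := by
  apply V.coact_injective
  rw [coact_degZero, coact_degZero, ← LinearMap.lTensor_comp_apply]
  congr 2
  exact LinearMap.ext fun c => congrArg X.incl (X.proj_inclProj c)

/-- The underlying space of the restriction of `V` to `A`: the part of degree zero. -/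
def ResCarrier : Type u := LinearMap.range (X.degZero V)

instance : AddCommGroup (X.ResCarrier V) := inferInstanceAs (AddCommGroup (LinearMap.range _))

instance : Module k (X.ResCarrier V) := inferInstanceAs (Module k (LinearMap.range _))

/-- The inclusion of the part of degree zero. -/
def resIncl : X.ResCarrier V →ₗ[k] V.carrier := (LinearMap.range (X.degZero V)).subtype

/-- The projection onto the part of degree zero. -/
def resProj : V.carrier →ₗ[k] X.ResCarrier V := (X.degZero V).rangeRestrict

theorem resIncl_injective : Function.Injective (X.resIncl V) := Subtype.val_injective

theorem resIncl_resProj (v : V.carrier) : X.resIncl V (X.resProj V v) = X.degZero V v := rfl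

theorem degZero_resIncl (w : X.ResCarrier V) : X.degZero V (X.resIncl V w) = X.resIncl V w := by
  obtain ⟨_, v, rfl⟩ := w
  exact X.degZero_degZero V v

theorem resProj_resIncl (w : X.ResCarrier V) : X.resProj V (X.resIncl V w) = w :=
  X.resIncl_injective V (X.degZero_resIncl V w)

instance : SMul Aᵐᵒᵖ (X.ResCarrier V) where
  smul a w := X.resProj V (op (X.incl (unop a)) • X.resIncl V w)

theorem resIncl_smul (a : A) (w : X.ResCarrier V) :
    X.resIncl V (op a • w) = op (X.incl a) • X.resIncl V w := by
  refine (X.resIncl_resProj V _).trans ?_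
  rw [degZero_smul, degZero_resIncl, unop_op]

theorem resIncl_smul' (a : Aᵐᵒᵖ) (w : X.ResCarrier V) :
    X.resIncl V (a • w) = op (X.incl (unop a)) • X.resIncl V w := X.resIncl_smul V (unop a) w

instance : Module Aᵐᵒᵖ (X.ResCarrier V) where
  one_smul w := X.resIncl_injective V (by simp [resIncl_smul'])
  mul_smul a b w := X.resIncl_injective V (by simp [resIncl_smul', mul_smul])
  smul_zero a := X.resIncl_injective V (by simp [resIncl_smul'])
  smul_add a w w' := X.resIncl_injective V (by simp [resIncl_smul'])
  zero_smul w := X.resIncl_injective V (by simp [resIncl_smul'])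
  add_smul a b w := X.resIncl_injective V (by simp [resIncl_smul', add_smul])

instance : IsScalarTower k Aᵐᵒᵖ (X.ResCarrier V) where
  smul_assoc r a w := X.resIncl_injective V (by simp [resIncl_smul'])

theorem resProj_smul (a : A) (v : V.carrier) :
    X.resProj V (op (X.incl a) • v) = op a • X.resProj V v := by
  apply X.resIncl_injective V
  rw [resIncl_smul, resIncl_resProj, resIncl_resProj, degZero_smul]

/-- The coaction of the restriction. -/
def resCoact : X.ResCarrier V →ₗ[k] X.ResCarrier V ⊗[k] A :=
  TensorProduct.map (X.resProj V) X.proj ∘ₗ V.coact ∘ₗ X.resIncl V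

theorem resCoact_resProj (v : V.carrier) : X.resCoact V (X.resProj V v) =
    TensorProduct.map (X.resProj V) X.proj (V.coact v) := by
  rw [resCoact, LinearMap.comp_apply, LinearMap.comp_apply, resIncl_resProj, coact_degZero]
  generalize V.coact v = z
  induction z with
  | zero => simp
  | add x y hx hy => simp only [map_add, hx, hy]
  | tmul v x => simp [proj_inclProj]

theorem map_resIncl_resCoact (w : X.ResCarrier V) :
    TensorProduct.map (X.resIncl V) X.incl.toLinearMap (X.resCoact V w) =
      V.coact (X.resIncl V w) := by
  have h (z : V.carrier ⊗[k] C) : TensorProduct.map (X.resIncl V) X.incl.toLinearMap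
      (TensorProduct.map (X.resProj V) X.proj z) =
      (X.degZero V).rTensor C (X.inclProj.lTensor V.carrier z) := by
    induction z with
    | zero => simp
    | add x y hx hy => simp only [map_add, hx, hy]
    | tmul v x => rfl
  rw [resCoact, LinearMap.comp_apply, LinearMap.comp_apply, h, ← coact_degZero, degZero_resIncl,
    rTensor_degZero_coact, ← coact_degZero, degZero_resIncl]

theorem map_resIncl_incl_injective : Function.Injective
    (TensorProduct.map (X.resIncl V) X.incl.toLinearMap) :=
  TensorProduct.map_injective_of_flat_flat _ _ (X.resIncl_injective V) X.incl_injective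

/-- The restriction of a Yetter-Drinfeld module over `C` to `A`: the part of degree zero. -/
@[reducible]
def res : YetterDrinfeld k A where
  carrier := X.ResCarrier V
  coact := X.resCoact V
  coact_coassoc := by
    apply LinearMap.ext
    intro w
    have h1 (z : X.ResCarrier V ⊗[k] A) : V.coact.rTensor C
        (TensorProduct.map (X.resIncl V) X.incl.toLinearMap z) =
        TensorProduct.map (TensorProduct.map (X.resIncl V) X.incl.toLinearMap) X.incl.toLinearMap
          ((X.resCoact V).rTensor A z) := by
      induction z with
      | zero => simp
      | add x y hx hy => simp only [map_add, hx, hy]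
      | tmul w x => simp [map_resIncl_resCoact]
    apply TensorProduct.map_injective_of_flat_flat (X.resIncl V)
      (TensorProduct.map X.incl.toLinearMap X.incl.toLinearMap) (X.resIncl_injective V)
      (TensorProduct.map_injective_of_flat_flat _ _ X.incl_injective X.incl_injective)
    simp only [LinearMap.comp_apply, LinearEquiv.coe_coe]
    rw [← TensorProduct.assoc_map_map, ← h1, ← X.isHopfMap_incl.lTensor_comul_map,
      map_resIncl_resCoact]
    exact LinearMap.congr_fun V.coact_coassoc _
  coact_counit := by
    apply LinearMap.ext
    intro w
    apply X.resIncl_injective V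
    simp only [LinearMap.comp_apply, LinearEquiv.coe_coe]
    rw [← X.isHopfMap_incl.lTensor_counit_map, map_resIncl_resCoact]
    exact LinearMap.congr_fun V.coact_counit _
  coact_smul a w := by
    apply X.map_resIncl_incl_injective V
    rw [← X.isHopfMap_incl.ydTwist_map (X.resIncl_smul V), map_resIncl_resCoact,
      map_resIncl_resCoact, resIncl_smul, V.coact_smul, X.isHopfMap_incl.comulTwice_map]

end Restriction

/-! ### Functoriality -/

section Functors

theorem degZero_hom {V V' : YetterDrinfeld k C} (f : V ⟶ V') (v : V.carrier) :
    X.degZero V' (Hom.lin f v) = Hom.lin f (X.degZero V v) := by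
  rw [degZero, degZero, LinearMap.comp_apply, LinearMap.comp_apply, Hom.colinear]
  simp only [LinearMap.comp_apply, LinearEquiv.coe_coe]
  generalize V.coact v = z
  induction z with
  | zero => simp
  | add x y hx hy => simp only [map_add, hx, hy]
  | tmul v x => exact (map_smul ((Hom.lin f).restrictScalars k) _ _).symm

/-- The linear map induced on the parts of degree zero. -/
def resMap {V V' : YetterDrinfeld k C} (f : V ⟶ V') : X.ResCarrier V →ₗ[k] X.ResCarrier V' :=
  X.resProj V' ∘ₗ (Hom.lin f).restrictScalars k ∘ₗ X.resIncl V

theorem resIncl_resMap {V V' : YetterDrinfeld k C} (f : V ⟶ V') (w : X.ResCarrier V) :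
    X.resIncl V' (X.resMap f w) = Hom.lin f (X.resIncl V w) := by
  refine (X.resIncl_resProj V' _).trans ((X.degZero_hom f _).trans ?_)
  rw [degZero_resIncl]

theorem resMap_smul {V V' : YetterDrinfeld k C} (f : V ⟶ V') (a : Aᵐᵒᵖ) (w : X.ResCarrier V) :
    X.resMap f (a • w) = a • X.resMap f w := by
  apply X.resIncl_injective V'
  rw [resIncl_resMap, resIncl_smul', resIncl_smul', resIncl_resMap, map_smul]

theorem resCoact_resMap {V V' : YetterDrinfeld k C} (f : V ⟶ V') (w : X.ResCarrier V) :
    X.resCoact V' (X.resMap f w) = (X.resMap f).rTensor A (X.resCoact V w) := by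
  apply X.map_resIncl_incl_injective V'
  rw [map_resIncl_resCoact, resIncl_resMap, Hom.colinear, ← map_resIncl_resCoact]
  generalize X.resCoact V w = z
  induction z with
  | zero => simp
  | add x y hx hy => simp only [map_add, hx, hy]
  | tmul w x => simp [resIncl_resMap]

/-- Restriction of Yetter-Drinfeld modules, as a functor. -/
def resFunctor : YetterDrinfeld k C ⥤ YetterDrinfeld k A where
  obj V := X.res V
  map {V V'} f := Hom.mk (V := X.res V) (W := X.res V')
    { toFun := X.resMap f
      map_add' := map_add _
      map_smul' := X.resMap_smul f } (X.resCoact_resMap f)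
  map_id V := hom_ext fun w => X.resProj_resIncl V w
  map_comp {V V' V''} f g := hom_ext fun w => X.resIncl_injective V'' (by
    refine (X.resIncl_resMap (f ≫ g) w).trans ?_
    refine .trans ?_ (X.resIncl_resMap g _).symm
    exact congrArg (Hom.lin g) (X.resIncl_resMap f w).symm)

/-- The linear map induced on induced modules. -/
def indMap {W W' : YetterDrinfeld k A} (f : W ⟶ W') :
    X.IndCarrier W.carrier →ₗ[k] X.IndCarrier W'.carrier :=
  ((Hom.lin f).restrictScalars k).prodMap ((Hom.lin f).restrictScalars k)

theorem indMap_indInl {W W' : YetterDrinfeld k A} (f : W ⟶ W') (w : W.carrier) :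
    X.indMap f (X.indInl _ w) = X.indInl _ (Hom.lin f w) :=
  IndCarrier.ext rfl (map_zero (Hom.lin f))

theorem indMap_indInr {W W' : YetterDrinfeld k A} (f : W ⟶ W') (w : W.carrier) :
    X.indMap f (X.indInr _ w) = X.indInr _ (Hom.lin f w) :=
  IndCarrier.ext (map_zero (Hom.lin f)) rfl

theorem indMap_smul {W W' : YetterDrinfeld k A} (f : W ⟶ W') (c : Cᵐᵒᵖ)
    (w : X.IndCarrier W.carrier) : X.indMap f (c • w) = c • X.indMap f w :=
  IndCarrier.ext ((map_add (Hom.lin f) _ _).trans (by rw [map_smul, map_smul]; rfl))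
    ((map_add (Hom.lin f) _ _).trans (by rw [map_smul, map_smul]; rfl))

theorem indCoact_indMap {W W' : YetterDrinfeld k A} (f : W ⟶ W') (w : X.IndCarrier W.carrier) :
    X.indCoact W' (X.indMap f w) = (X.indMap f).rTensor C (X.indCoact W w) := by
  have h (j : W.carrier →ₗ[k] X.IndCarrier W.carrier)
      (j' : W'.carrier →ₗ[k] X.IndCarrier W'.carrier)
      (h : ∀ w, X.indMap f (j w) = j' (Hom.lin f w)) (i : A →ₗ[k] C) (z : W.carrier ⊗[k] A) :
      TensorProduct.map j' i (((Hom.lin f).restrictScalars k).rTensor A z) =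
        (X.indMap f).rTensor C (TensorProduct.map j i z) := by
    induction z with
    | zero => simp
    | add x y hx hy => simp only [map_add, hx, hy]
    | tmul w x => simp [h]
  induction w using IndCarrier.induction with
  | hl w =>
    rw [indMap_indInl, indCoact_indInl, indCoact_indInl, Hom.colinear, h _ _ (X.indMap_indInl f)]
  | hr w =>
    rw [indMap_indInr, indCoact_indInr, indCoact_indInr, Hom.colinear, h _ _ (X.indMap_indInr f)]
  | hadd w w' h h' => simp only [map_add, h, h']

/-- Induction of Yetter-Drinfeld modules, as a functor. -/
def indFunctor : YetterDrinfeld k A ⥤ YetterDrinfeld k C where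
  obj W := X.ind W
  map {W W'} f := Hom.mk (V := X.ind W) (W := X.ind W')
    { toFun := X.indMap f
      map_add' := map_add _
      map_smul' := X.indMap_smul f } (X.indCoact_indMap f)
  map_id _ := rfl
  map_comp _ _ := rfl

end Functors

/-! ### Induction is both left and right adjoint to restriction -/

section Adjunctions

variable (W : YetterDrinfeld k A) (V : YetterDrinfeld k C)

/-- The induced module is concentrated in degree zero. -/
theorem degZero_ind (w : X.IndCarrier W.carrier) : X.degZero (X.ind W) w = w := by
  have h (j : W.carrier →ₗ[k] X.IndCarrier W.carrier) (i : A →ₐ[k] C)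
      (hi : ∀ a, Coalgebra.counit (R := k) (X.proj (i a)) = Coalgebra.counit (R := k) a)
      (z : W.carrier ⊗[k] A) :
      TensorProduct.rid k _ ((Coalgebra.counit (R := k) ∘ₗ X.proj).lTensor (X.IndCarrier W.carrier)
        (TensorProduct.map j i.toLinearMap z)) =
      j (TensorProduct.rid k _ ((Coalgebra.counit (R := k)).lTensor W.carrier z)) := by
    induction z with
    | zero => simp
    | add x y hx hy => simp only [map_add, hx, hy]
    | tmul w x => simp [hi]
  have hc (w : W.carrier) := LinearMap.congr_fun W.coact_counit w
  simp only [LinearMap.comp_apply, LinearEquiv.coe_coe, LinearMap.id_apply] at hc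
  change TensorProduct.rid k _ ((Coalgebra.counit (R := k) ∘ₗ X.proj).lTensor
    (X.IndCarrier W.carrier) (X.indCoact W w)) = w
  induction w using IndCarrier.induction with
  | hl w => rw [indCoact_indInl, h _ _ fun a => by rw [X.proj_incl], hc]
  | hr w =>
    rw [indCoact_indInr, h _ _ fun a => ?_, hc]
    rw [twistedIncl, AlgHom.comp_apply, X.proj_incl, ← X.isHopfMap_incl.counit]
    exact X.isHopfMap_twistedIncl.counit a
  | hadd w w' h h' => rw [map_add, map_add, map_add, h, h']

theorem resIncl_resProj_ind (w : X.IndCarrier W.carrier) :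
    X.resIncl (X.ind W) (X.resProj (X.ind W) w) = w := X.degZero_ind W w

/-- The unit `w ↦ w ⊗ 1` of the adjunction between induction and restriction. -/
def indResUnit : W ⟶ X.res (X.ind W) :=
  Hom.mk (W := X.res (X.ind W))
    { toFun := fun w => X.resProj (X.ind W) (X.indInl W.carrier w)
      map_add' := fun w w' => (congrArg _ (map_add _ w w')).trans (map_add _ _ _)
      map_smul' := fun a w => (congrArg _ (X.indInl_smul (unop a) w)).trans
        (X.resProj_smul (X.ind W) (unop a) _) } (fun w => by
      apply X.map_resIncl_incl_injective (X.ind W)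
      refine (X.map_resIncl_resCoact (X.ind W) _).trans ?_
      refine (congrArg (X.indCoact W) (X.resIncl_resProj_ind W _)).trans ?_
      rw [indCoact_indInl]
      generalize W.coact w = z
      induction z with
      | zero => simp
      | add x y hx hy => simp only [map_add, hx, hy]
      | tmul w x => exact congrArg (· ⊗ₜ[k] X.incl x) (X.resIncl_resProj_ind W _).symm)

/-- The action map `(w, w') ↦ w + w' · g` from the induced module. -/
def indResCounitMap : X.IndCarrier (X.ResCarrier V) →ₗ[k] V.carrier :=
  LinearMap.coprod (X.resIncl V) (rightAct k C V.carrier X.g ∘ₗ X.resIncl V)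

theorem indResCounitMap_apply (w : X.IndCarrier (X.ResCarrier V)) :
    X.indResCounitMap V w = X.resIncl V w.1 + op X.g • X.resIncl V w.2 := rfl

theorem indResCounitMap_indInl (w : X.ResCarrier V) :
    X.indResCounitMap V (X.indInl _ w) = X.resIncl V w := by
  rw [indResCounitMap_apply]
  refine (congrArg (_ + op X.g • ·) (map_zero _)).trans ?_
  rw [smul_zero, add_zero]
  rfl

theorem indResCounitMap_indInr (w : X.ResCarrier V) :
    X.indResCounitMap V (X.indInr _ w) = op X.g • X.resIncl V w := by
  rw [indResCounitMap_apply]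
  exact (congrArg (· + _) (map_zero _)).trans (zero_add _)

theorem indResCounitMap_smul (c : Cᵐᵒᵖ) (w : X.IndCarrier (X.ResCarrier V)) :
    X.indResCounitMap V (c • w) = c • X.indResCounitMap V w := by
  rw [indResCounitMap_apply, indResCounitMap_apply, IndCarrier.smul_fst, IndCarrier.smul_snd,
    map_add, map_add]
  simp only [resIncl_smul, smul_add, ← mul_smul, ← MulOpposite.op_mul]
  rw [add_add_add_comm, ← add_smul, ← add_smul, ← MulOpposite.op_add, ← MulOpposite.op_add,
    ← X.decomp]
  rw [← mul_assoc X.g (unop c), ← X.decomp, MulOpposite.op_mul]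
  rfl

theorem coact_indResCounitMap (w : X.IndCarrier (X.ResCarrier V)) :
    V.coact (X.indResCounitMap V w) =
      (X.indResCounitMap V).rTensor C (X.indCoact (X.res V) w) := by
  have h (i : A →ₗ[k] C) (j : X.ResCarrier V →ₗ[k] X.IndCarrier (X.ResCarrier V))
      (z : X.ResCarrier V ⊗[k] A) : (X.indResCounitMap V).rTensor C (TensorProduct.map j i z) =
        TensorProduct.map (X.indResCounitMap V ∘ₗ j) i z := by
    rw [LinearMap.rTensor, ← LinearMap.comp_apply, ← TensorProduct.map_comp, LinearMap.id_comp]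
  induction w using IndCarrier.induction with
  | hl w =>
    rw [indResCounitMap_indInl, indCoact_indInl, h, ← map_resIncl_resCoact]
    congr 2
    exact (LinearMap.ext fun w => (X.indResCounitMap_indInl V w)).symm
  | hr w =>
    rw [indResCounitMap_indInr, indCoact_indInr, h, V.coact_smul, ← map_resIncl_resCoact]
    generalize X.resCoact V w = z
    induction z with
    | zero => simp
    | add x y hx hy => simp only [map_add, hx, hy]
    | tmul w x =>
      rw [TensorProduct.map_tmul, TensorProduct.map_tmul, X.ydTwist_g_tmul, ← mul_assoc,
        LinearMap.comp_apply, indResCounitMap_indInr]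
      exact congrArg _ (X.twistedIncl_apply x).symm
  | hadd w w' h h' => simp only [map_add, h, h']

/-- The counit `w ⊗ c ↦ w · c` of the adjunction between induction and restriction. -/
def indResCounit : X.ind (X.res V) ⟶ V :=
  Hom.mk (V := X.ind (X.res V))
    { toFun := X.indResCounitMap V
      map_add' := map_add _
      map_smul' := X.indResCounitMap_smul V } (X.coact_indResCounitMap V)

theorem resMap_indResCounit (w : X.ResCarrier V) : X.resMap (X.indResCounit V)
    (X.resProj (X.ind (X.res V)) (X.indInl (X.ResCarrier V) w)) = w := by
  apply X.resIncl_injective V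
  rw [resIncl_resMap, resIncl_resProj_ind]
  exact X.indResCounitMap_indInl V w

theorem indResCounitMap_indMap (w : X.IndCarrier W.carrier) :
    X.indResCounitMap (X.ind W) (X.indMap (X.indResUnit W) w) = w := by
  rw [indResCounitMap_apply]
  refine (congrArg₂ (fun x y => x + op X.g • y) (X.resIncl_resProj_ind W _)
    (X.resIncl_resProj_ind W _)).trans ?_
  rw [g_smul_indInl]
  exact X.indInl_add_indInr w

/-- Induction is left adjoint to restriction. -/
def indResAdj : X.indFunctor ⊣ X.resFunctor where
  unit :=
    { app := X.indResUnit
      naturality := fun W W' f => hom_ext fun w => by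
        apply X.resIncl_injective (X.ind W')
        refine (X.resIncl_resProj_ind W' _).trans ?_
        refine .trans ?_ (X.resIncl_resMap _ _).symm
        refine .trans ?_ (congrArg (X.indMap f) (X.resIncl_resProj_ind W _)).symm
        exact (X.indMap_indInl f w).symm }
  counit :=
    { app := X.indResCounit
      naturality := fun V V' f => hom_ext fun w => by
        refine (congrArg₂ (fun x y => x + op X.g • y) (X.resIncl_resMap f _)
          (X.resIncl_resMap f _)).trans ?_
        refine .trans ?_ (map_add (Hom.lin f) _ _).symm
        exact congrArg (_ + ·) (map_smul (Hom.lin f) _ _).symm }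
  left_triangle_components W := hom_ext fun w => X.indResCounitMap_indMap W w
  right_triangle_components V := hom_ext fun w => X.resMap_indResCounit V w

/-- The map `v ↦ v₀ ⊗ 1 + (v · g)₀ ⊗ g`, where the index denotes the part of degree zero. -/
def resIndUnitMap : V.carrier →ₗ[k] X.IndCarrier (X.ResCarrier V) :=
  X.indInl _ ∘ₗ X.resProj V + X.indInr _ ∘ₗ X.resProj V ∘ₗ rightAct k C V.carrier X.g

theorem resIndUnitMap_fst (v : V.carrier) : (X.resIndUnitMap V v).1 = X.resProj V v := add_zero _

theorem resIndUnitMap_snd (v : V.carrier) :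
    (X.resIndUnitMap V v).2 = X.resProj V (op X.g • v) := zero_add _

theorem resProj_eq_zero_add (c : C) (v : V.carrier) : X.resProj V (op c • v) =
    op (X.proj c) • X.resProj V v + op (X.proj (X.g * c)) • X.resProj V (op X.g • v) := by
  conv_lhs => rw [← X.decomp_left c]
  rw [MulOpposite.op_add, add_smul, map_add, resProj_smul, MulOpposite.op_mul, mul_smul,
    resProj_smul]

theorem resIndUnitMap_smul (c : Cᵐᵒᵖ) (v : V.carrier) :
    X.resIndUnitMap V (c • v) = c • X.resIndUnitMap V v := by
  refine IndCarrier.ext ?_ ?_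
  · rw [IndCarrier.smul_fst, resIndUnitMap_fst, resIndUnitMap_fst, resIndUnitMap_snd,
      ← resProj_eq_zero_add, op_unop]
  · rw [IndCarrier.smul_snd, resIndUnitMap_snd, resIndUnitMap_fst, resIndUnitMap_snd,
      ← resProj_eq_zero_add, MulOpposite.op_mul, mul_smul, op_unop]

theorem resProj_degZero (v : V.carrier) : X.resProj V (X.degZero V v) = X.resProj V v :=
  X.resProj_resIncl V (X.resProj V v)

theorem coact_resIndUnitMap (v : V.carrier) : X.indCoact (X.res V) (X.resIndUnitMap V v) =
    (X.resIndUnitMap V).rTensor C (V.coact v) := by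
  have h0 (j : V.carrier →ₗ[k] X.IndCarrier (X.ResCarrier V))
      (hj : ∀ v, j (X.degZero V v) = j v) : TensorProduct.map j X.inclProj (V.coact v) =
      j.rTensor C (V.coact v) := by
    have : TensorProduct.map j X.inclProj = j.rTensor C ∘ₗ X.inclProj.lTensor V.carrier :=
      (LinearMap.rTensor_comp_lTensor _ _ _).symm
    rw [this, LinearMap.comp_apply, ← rTensor_degZero_coact, ← LinearMap.rTensor_comp_apply]
    congr 2
    exact LinearMap.ext hj
  have h1 : X.indCoact (X.res V) (X.indInl _ (X.resProj V v)) =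
      (X.indInl _ ∘ₗ X.resProj V).rTensor C (V.coact v) := by
    rw [← h0 _ fun v => congrArg (X.indInl _) (X.resProj_degZero V v), indCoact_indInl,
      resCoact_resProj, inclProj, TensorProduct.map_comp]
    rfl
  have h2 : X.indCoact (X.res V) (X.indInr _ (X.resProj V (op X.g • v))) =
      (X.indInr _ ∘ₗ X.resProj V ∘ₗ rightAct k C V.carrier X.g).rTensor C (V.coact v) := by
    rw [← h0 _ fun v => by
      simp only [LinearMap.comp_apply, rightAct_apply, ← degZero_smul, resProj_degZero],
      indCoact_indInr, resCoact_resProj, V.coact_smul]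
    generalize V.coact v = z
    induction z with
    | zero => simp
    | add x y hx hy => simp only [map_add, hx, hy]
    | tmul v x =>
      rw [X.ydTwist_g_tmul, TensorProduct.map_tmul, TensorProduct.map_tmul,
        TensorProduct.map_tmul, ← mul_assoc, X.proj_g_mul_mul_g]
      refine congrArg (_ ⊗ₜ[k] ·) (congrArg X.incl (X.twist_twist _))
  rw [resIndUnitMap, LinearMap.add_apply, map_add, LinearMap.rTensor_add, LinearMap.add_apply,
    ← h1, ← h2]
  rfl

/-- The unit of the adjunction between restriction and induction. -/
def resIndUnit : V ⟶ X.ind (X.res V) :=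
  Hom.mk (W := X.ind (X.res V))
    { toFun := X.resIndUnitMap V
      map_add' := map_add _
      map_smul' := X.resIndUnitMap_smul V } (X.coact_resIndUnitMap V)

/-- The projection `w ⊗ 1 + w' ⊗ g ↦ w`, on the restriction of the induced module. -/
def resIndCounitMap : X.ResCarrier (X.ind W) →ₗ[k] W.carrier :=
  X.indFst W.carrier ∘ₗ X.resIncl (X.ind W)

theorem proj_g_mul_incl (a : A) : X.proj (X.g * X.incl a) = 0 := by
  rw [X.g_mul_incl, X.proj_incl_mul_g]

theorem resIndCounitMap_smul (a : Aᵐᵒᵖ) (w : X.ResCarrier (X.ind W)) :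
    X.resIndCounitMap W (a • w) = a • X.resIndCounitMap W w := by
  refine (congrArg (X.indFst W.carrier) (X.resIncl_smul' (X.ind W) a w)).trans ?_
  refine (IndCarrier.smul_fst _ _).trans ?_
  rw [unop_op, X.proj_incl, proj_g_mul_incl, op_zero, zero_smul, add_zero, op_unop]
  rfl

theorem coact_resIndCounitMap (w : X.ResCarrier (X.ind W)) : W.coact (X.resIndCounitMap W w) =
    (X.resIndCounitMap W).rTensor A (X.resCoact (X.ind W) w) := by
  have h1 (w : X.IndCarrier W.carrier) : (X.indFst W.carrier).rTensor C (X.indCoact W w) =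
      X.incl.toLinearMap.lTensor W.carrier (W.coact (X.indFst W.carrier w)) := by
    induction w using IndCarrier.induction with
    | hl w =>
      rw [indCoact_indInl, LinearMap.rTensor, LinearMap.lTensor, ← LinearMap.comp_apply,
        ← TensorProduct.map_comp, LinearMap.id_comp, indFst_comp_indInl]
      rfl
    | hr w =>
      rw [indCoact_indInr, LinearMap.rTensor, ← LinearMap.comp_apply,
        ← TensorProduct.map_comp, LinearMap.id_comp, indFst_comp_indInr, TensorProduct.map_zero_left]
      have : X.indFst W.carrier (X.indInr W.carrier w) = 0 := rfl
      rw [this, map_zero, map_zero, LinearMap.zero_apply]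
    | hadd w w' h h' => simp only [map_add, h, h']
  apply Module.Flat.lTensor_preserves_injective_linearMap (M := W.carrier) X.incl.toLinearMap
    X.incl_injective
  refine (h1 (X.resIncl (X.ind W) w)).symm.trans ?_
  refine (congrArg _ (X.map_resIncl_resCoact (X.ind W) w).symm).trans ?_
  generalize X.resCoact (X.ind W) w = z
  induction z with
  | zero => simp
  | add x y hx hy => simp only [map_add, hx, hy]
  | tmul w x => rfl

/-- The counit of the adjunction between restriction and induction. -/
def resIndCounit : X.res (X.ind W) ⟶ W :=
  Hom.mk (V := X.res (X.ind W))
    { toFun := X.resIndCounitMap W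
      map_add' := map_add _
      map_smul' := X.resIndCounitMap_smul W } (X.coact_resIndCounitMap W)

theorem indMap_resIndCounit (w : X.IndCarrier W.carrier) :
    X.indMap (X.resIndCounit W) (X.resIndUnitMap (X.ind W) w) = w := by
  refine IndCarrier.ext ?_ ?_
  · refine (congrArg (X.resIndCounitMap W) (X.resIndUnitMap_fst (X.ind W) w)).trans ?_
    exact congrArg (X.indFst _) (X.resIncl_resProj_ind W w)
  · refine (congrArg (X.resIndCounitMap W) (X.resIndUnitMap_snd (X.ind W) w)).trans ?_
    refine (congrArg (X.indFst _) (X.resIncl_resProj_ind W _)).trans ?_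
    have h : op X.g • w = X.indInr W.carrier w.1 + X.indInl W.carrier w.2 := by
      conv_lhs => rw [← X.indInl_add_indInr w, smul_add, g_smul_indInl, g_smul_indInr]
    exact (congrArg (X.indFst _) h).trans (zero_add _)

/-- Induction is right adjoint to restriction. -/
def resIndAdj : X.resFunctor ⊣ X.indFunctor where
  unit :=
    { app := X.resIndUnit
      naturality := fun V V' f => hom_ext fun v => by
        have h (v : V.carrier) : X.resProj V' (Hom.lin f v) = X.resMap f (X.resProj V v) := by
          apply X.resIncl_injective V'
          rw [resIncl_resMap, resIncl_resProj, resIncl_resProj, degZero_hom]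
        refine IndCarrier.ext (X := X) ?_ ?_
        · refine (X.resIndUnitMap_fst V' _).trans ((h v).trans ?_)
          exact congrArg (X.resMap f) (X.resIndUnitMap_fst V v).symm
        · refine (X.resIndUnitMap_snd V' _).trans ?_
          refine (congrArg (X.resProj V') (map_smul (Hom.lin f) _ _).symm).trans ((h _).trans ?_)
          exact congrArg (X.resMap f) (X.resIndUnitMap_snd V v).symm }
  counit :=
    { app := X.resIndCounit
      naturality := fun W W' f => hom_ext fun w =>
        congrArg (X.indFst W'.carrier) (X.resIncl_resMap (X.indFunctor.map f) w) }
  left_triangle_components V := hom_ext fun w => by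
    refine (congrArg (X.indFst _) (X.resIncl_resMap (X.resIndUnit V) w)).trans ?_
    exact (X.resIndUnitMap_fst V _).trans (X.resProj_resIncl V w)
  right_triangle_components W := hom_ext fun w => X.indMap_resIndCounit W w

end Adjunctions

end HopfIndexTwo

/-! ### Gerstenhaber-Schack cohomology along an extension of index two -/

/-- A nonzero multiple of the identity of a Yetter-Drinfeld module is an isomorphism. -/
theorem YetterDrinfeld.isIso_of_forall_eq_smul {k A : Type u} [Field k] [Ring A] [HopfAlgebra k A]
    {V : YetterDrinfeld k A} (f : V ⟶ V) {r : k} (hr : r ≠ 0) (hf : ∀ v, Hom.lin f v = r • v) :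
    IsIso f := by
  have := IsScalarTower.to_smulCommClass (R := k) (A := Aᵐᵒᵖ) (M := V.carrier)
  let e : V ⟶ V := Hom.mk
    { toFun := fun v => r⁻¹ • v
      map_add' := smul_add _
      map_smul' := smul_comm r⁻¹ } (fun v => by
      refine (map_smul V.coact r⁻¹ v).trans ?_
      generalize V.coact v = z
      induction z with
      | zero => simp
      | add x y hx hy => simp only [map_add, smul_add, hx, hy]
      | tmul v x => rfl)
  refine ⟨e, hom_ext fun v => ?_, hom_ext fun v => ?_⟩
  · rw [comp_lin, hf]
    exact inv_smul_smul₀ hr v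
  · rw [comp_lin, hf]
    exact smul_inv_smul₀ hr v

namespace HopfIndexTwo

open YetterDrinfeld

variable {k A C : Type u} [Field k] [Ring A] [HopfAlgebra k A] [Ring C] [HopfAlgebra k C]
  (X : HopfIndexTwo k A C)

theorem degZero_triv (c : k) : X.degZero (triv k C) c = c := by
  change TensorProduct.rid k k ((Coalgebra.counit (R := k) ∘ₗ X.proj).lTensor k (c ⊗ₜ[k] 1)) = c
  simp [X.proj_one]

theorem resIncl_resProj_triv (c : k) :
    X.resIncl (triv k C) (X.resProj (triv k C) c) = c := X.degZero_triv c

/-- The identity of `k`, from the trivial module to the restriction of the trivial module. -/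
def trivToRes : triv k A ⟶ X.res (triv k C) :=
  Hom.mk (V := triv k A) (W := X.res (triv k C))
    { toFun := X.resProj (triv k C)
      map_add' := map_add (X.resProj (triv k C))
      map_smul' := fun a c => by
        apply X.resIncl_injective (triv k C)
        refine (X.resIncl_resProj_triv _).trans ?_
        refine .trans ?_ (X.resIncl_smul' (triv k C) a _).symm
        refine .trans ?_ (congrArg _ (X.resIncl_resProj_triv c).symm)
        exact congrArg (fun x : k => x * (show k from c)) (X.isHopfMap_incl.counit (unop a)).symm } (fun c => by
      refine (X.resCoact_resProj (triv k C) c).trans ?_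
      exact congrArg (X.resProj (triv k C) c ⊗ₜ[k] ·) X.proj_one)

theorem coact_resIncl_triv (w : X.ResCarrier (triv k C)) :
    (triv k A).coact (X.resIncl (triv k C) w) =
      (X.resIncl (triv k C)).rTensor A (X.resCoact (triv k C) w) := by
  rw [← X.resProj_resIncl (triv k C) w]
  generalize X.resIncl (triv k C) w = c
  rw [resCoact_resProj]
  have h : X.resIncl (triv k C) (X.resProj (triv k C) c) = c := X.resIncl_resProj_triv c
  rw [h]
  exact (congrArg₂ (fun (x : k) (y : A) => x ⊗ₜ[k] y) h X.proj_one).symm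

/-- The identity of `k`, from the restriction of the trivial module to the trivial module. -/
def resToTriv : X.res (triv k C) ⟶ triv k A :=
  Hom.mk (V := X.res (triv k C)) (W := triv k A)
    { toFun := X.resIncl (triv k C)
      map_add' := map_add (X.resIncl (triv k C))
      map_smul' := fun a w => by
        refine (X.resIncl_smul' (triv k C) a w).trans ?_
        exact congrArg (fun x : k => x * (show k from X.resIncl (triv k C) w)) (X.isHopfMap_incl.counit (unop a)) } X.coact_resIncl_triv

/-- A Hopf algebra extension of index two preserves the Gerstenhaber-Schack cohomological
dimension. -/
theorem gerstenhaberSchackDim_eq [CharZero k] (X : HopfIndexTwo k A C) :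
    gerstenhaberSchackDim k A = gerstenhaberSchackDim k C := by
  let s := X.trivToRes
  let p := X.resToTriv
  have : IsIso (s ≫ p) := isIso_of_forall_eq_smul (s ≫ p) one_ne_zero fun c =>
    (X.resIncl_resProj_triv c).trans (one_smul k c).symm
  let s' := (X.resIndAdj.homEquiv _ _) p
  let r' := (X.indResAdj.homEquiv _ _).symm s
  -- the composite is the sum over the two cosets
  have hc (c : (triv k C).carrier) : Hom.lin (s' ≫ r') c = (2 : k) • c := by
    have h (c : (triv k C).carrier) : X.resIncl (triv k C) (X.resProj (triv k C)
        (X.resIncl (triv k C) (X.resProj (triv k C) c))) = c :=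
      (congrArg _ (X.resProj_resIncl (triv k C) _)).trans (X.resIncl_resProj_triv c)
    have hg (c : (triv k C).carrier) : op X.g • c = c :=
      (congrArg (fun x : k => x * (show k from c)) X.counit_g).trans (one_mul (show k from c))
    have hf : Hom.lin (s' ≫ r') c = X.resIncl (triv k C) (X.resProj (triv k C)
        (X.resIncl (triv k C) (X.resIndUnitMap (triv k C) c).1)) +
        op X.g • X.resIncl (triv k C) (X.resProj (triv k C)
          (X.resIncl (triv k C) (X.resIndUnitMap (triv k C) c).2)) := rfl
    rw [hf, resIndUnitMap_fst, resIndUnitMap_snd, h, h, hg, hg, two_smul]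
  have : IsIso (s' ≫ r') := isIso_of_forall_eq_smul (s' ≫ r') two_ne_zero hc
  have key := Abelian.Ext.exists_nontrivial_iff_of_ambidextrous X.indResAdj X.resIndAdj s p s' r'
  unfold gerstenhaberSchackDim
  congr 1
  ext d
  constructor
  · rintro ⟨m, M, hM, rfl⟩
    obtain ⟨N, hN⟩ := (key m).1 ⟨M, hM⟩
    exact ⟨m, N, hN, rfl⟩
  · rintro ⟨m, M, hM, rfl⟩
    obtain ⟨N, hN⟩ := (key m).2 ⟨M, hM⟩
    exact ⟨m, N, hN, rfl⟩

end HopfIndexTwo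

/-! ### Recognizing extensions of index two -/

section Recognition

variable {k A C : Type*} [Field k] [Ring A] [Algebra k A] [Ring C] [Algebra k C]

/-- The representation `a ↦ diag(a, σ(a))` of an algebra by two-by-two matrices over itself. -/
def diagTwist (σ : A →ₐ[k] A) : A →ₐ[k] Matrix (Fin 2) (Fin 2) A where
  toFun a := !![a, 0; 0, σ a]
  map_one' := by simp [Matrix.one_fin_two]
  map_mul' a b := by simp
  map_zero' := by ext i j; fin_cases i <;> fin_cases j <;> simp
  map_add' a b := by ext i j; fin_cases i <;> fin_cases j <;> simp
  commutes' r := by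
    ext i j
    fin_cases i <;> fin_cases j <;> simp [Matrix.algebraMap_matrix_apply]

theorem diagTwist_apply (σ : A →ₐ[k] A) (a : A) : diagTwist σ a = !![a, 0; 0, σ a] := rfl

variable (A) in
/-- The matrix that exchanges the two coordinates. -/
def flipMatrix : Matrix (Fin 2) (Fin 2) A := !![0, 1; 1, 0]

theorem flipMatrix_mul_flipMatrix : flipMatrix A * flipMatrix A = 1 := by
  simp [flipMatrix, Matrix.one_fin_two]

theorem flipMatrix_mul_diagTwist_mul_flipMatrix {σ : A →ₐ[k] A} (hσ : ∀ a, σ (σ a) = a) (a : A) :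
    flipMatrix A * diagTwist σ a * flipMatrix A = diagTwist σ (σ a) := by
  simp [flipMatrix, diagTwist_apply, hσ]

/-- An algebra `C` generated by elements of `A + A g`, where `g` is an involution that normalizes
`A`, is an extension of index two of `A` as soon as the representation of the crossed product of
`A` and `ℤ/2` by two-by-two matrices over `A` extends to `C`. -/
def IndexTwoExtension.ofMatrix (incl : A →ₐ[k] C) (g : C) (twist : A →ₐ[k] A)
    (Φ : C →ₐ[k] Matrix (Fin 2) (Fin 2) A) (g_mul_g : g * g = 1)
    (conj : ∀ a, g * incl a * g = incl (twist a)) (hi : ∀ a, Φ (incl a) = diagTwist twist a)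
    (hg : Φ g = flipMatrix A) (s : Set C) (hs : Algebra.adjoin k s = ⊤)
    (h : ∀ x ∈ s, ∃ a b, x = incl a + incl b * g) : IndexTwoExtension k A C where
  incl := incl
  g := g
  twist := twist
  proj := Matrix.entryLinearMap k A 0 0 ∘ₗ Φ.toLinearMap
  g_mul_g := g_mul_g
  g_mul_incl a := by rw [← conj, mul_assoc, g_mul_g, mul_one]
  proj_incl a := by simp [hi, diagTwist_apply]
  proj_incl_mul_g a := by simp [hi, hg, diagTwist_apply, flipMatrix]
  decomp c := by
    have conj' (a : A) : g * incl a = incl (twist a) * g := by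
      rw [← conj, mul_assoc, g_mul_g, mul_one]
    have key : ∃ a b, c = incl a + incl b * g := by
      have hc : c ∈ Algebra.adjoin k s := hs ▸ Algebra.mem_top
      induction hc using Algebra.adjoin_induction with
      | mem x hx => exact h x hx
      | algebraMap r => exact ⟨algebraMap k A r, 0, by simp⟩
      | add x y _ _ hx hy =>
        obtain ⟨a, b, rfl⟩ := hx
        obtain ⟨a', b', rfl⟩ := hy
        exact ⟨a + a', b + b', by rw [map_add, map_add, add_mul]; abel⟩
      | mul x y _ _ hx hy =>
        obtain ⟨a, b, rfl⟩ := hx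
        obtain ⟨a', b', rfl⟩ := hy
        refine ⟨a * a' + b * twist b', a * b' + b * twist a', ?_⟩
        have h1 : incl b * g * (incl b' * g) = incl (b * twist b') := by
          rw [mul_assoc, ← mul_assoc g, conj, map_mul]
        have h2 : incl b * g * incl a' = incl (b * twist a') * g := by
          rw [mul_assoc, conj', map_mul, mul_assoc]
        rw [add_mul, mul_add, mul_add, h1, h2]
        simp only [map_add, map_mul, add_mul, mul_assoc]
        abel
    obtain ⟨a, b, rfl⟩ := key
    have h1 : Φ (incl a + incl b * g) 0 0 = a := by
      simp [hi, hg, diagTwist_apply, flipMatrix]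
    have h2 : Φ ((incl a + incl b * g) * g) 0 0 = b := by
      rw [add_mul, mul_assoc, g_mul_g, mul_one]
      simp [hi, hg, diagTwist_apply, flipMatrix]
    change _ = incl (Φ _ 0 0) + incl (Φ _ 0 0) * g
    rw [h1, h2]

end Recognition

/-! ### The free product of `B(E)` with the group algebra of `ℤ/2` -/

section Extension

variable {k : Type u} [Field k] {n : ℕ} (E : GL (Fin n) k)

/-- The two factors `B(E)` and `k[ℤ/2]`. -/
def InvolutionFactor : Bool → Type u
  | false => BilinHopf E
  | true => MonoidAlgebra k (Multiplicative (ZMod 2))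

instance : ∀ i, Ring (InvolutionFactor E i)
  | false => inferInstanceAs (Ring (BilinHopf E))
  | true => inferInstanceAs (Ring (MonoidAlgebra k (Multiplicative (ZMod 2))))

instance : ∀ i, HopfAlgebra k (InvolutionFactor E i)
  | false => inferInstanceAs (HopfAlgebra k (BilinHopf E))
  | true => inferInstanceAs (HopfAlgebra k (MonoidAlgebra k (Multiplicative (ZMod 2))))

/-- The free product `B(E) * k[ℤ/2]`: the Hopf algebra obtained from `B(E)` by adjoining a
grouplike involution freely. -/
abbrev InvolutionHopf : Type u := HopfFreeProduct k (InvolutionFactor E)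

namespace InvolutionHopf

/-- The canonical map from `B(E)`. -/
def ofBilin : BilinHopf E →ₐ[k] InvolutionHopf E :=
  HopfFreeProduct.ι k (InvolutionFactor E) false

/-- The canonical map from the group algebra. -/
def ofGroup : MonoidAlgebra k (Multiplicative (ZMod 2)) →ₐ[k] InvolutionHopf E :=
  HopfFreeProduct.ι k (InvolutionFactor E) true

/-- The grouplike involution. -/
def g : InvolutionHopf E := ofGroup E (MonoidAlgebra.single (Multiplicative.ofAdd 1) 1)

theorem g_mul_g : g E * g E = 1 := by
  rw [g, ← map_mul, MonoidAlgebra.single_mul_single, ← ofAdd_add]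
  have : (1 + 1 : ZMod 2) = 0 := rfl
  rw [this, mul_one]
  exact map_one (ofGroup E)

theorem isHopfMap_ofBilin : IsHopfMap (ofBilin E) where
  comul x := HopfFreeProduct.comul_ι k (InvolutionFactor E) false x
  counit x := HopfFreeProduct.counit_ι k (InvolutionFactor E) false x

theorem isHopfMap_ofGroup : IsHopfMap (ofGroup E) where
  comul x := HopfFreeProduct.comul_ι k (InvolutionFactor E) true x
  counit x := HopfFreeProduct.counit_ι k (InvolutionFactor E) true x

theorem comul_g : Coalgebra.comul (R := k) (g E) = g E ⊗ₜ[k] g E := by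
  rw [g, (isHopfMap_ofGroup E).comul]
  simp

theorem counit_g : Coalgebra.counit (R := k) (g E) = 1 := by
  rw [g, (isHopfMap_ofGroup E).counit]
  simp

theorem adjoin_eq_top : Algebra.adjoin k
    (insert (g E) (Set.range fun p : Fin n × Fin n => ofBilin E (BilinHopf.a E p.1 p.2))) = ⊤ := by
  set S := Algebra.adjoin k
    (insert (g E) (Set.range fun p : Fin n × Fin n => ofBilin E (BilinHopf.a E p.1 p.2)))
  have h1 : S.comap (ofBilin E) = ⊤ := by
    rw [eq_top_iff, ← BilinHopf.adjoin_eq_top]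
    apply Algebra.adjoin_le
    rintro _ ⟨p, rfl⟩
    exact Algebra.subset_adjoin (Set.mem_insert_of_mem _ ⟨p, rfl⟩)
  have h2 : S.comap (ofGroup E) = ⊤ := by
    rw [eq_top_iff]
    rintro x -
    induction x using MonoidAlgebra.induction_on with
    | of x =>
      have hx : x = 1 ∨ x = Multiplicative.ofAdd 1 := by revert x; decide
      obtain rfl | rfl := hx
      · exact one_mem (S.comap (ofGroup E))
      · exact Algebra.subset_adjoin (Set.mem_insert _ _)
    | add x y hx hy => exact add_mem hx hy
    | smul r x hx => exact Subalgebra.smul_mem _ hx r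
  rw [eq_top_iff, ← HopfFreeProduct.adjoin_eq_top]
  apply Algebra.adjoin_le
  intro y hy
  obtain ⟨i, x, rfl⟩ := Set.mem_iUnion.1 hy
  cases i with
  | false =>
    have h (x : BilinHopf E) : x ∈ S.comap (ofBilin E) := h1 ▸ Algebra.mem_top
    exact h x
  | true =>
    have h (x : MonoidAlgebra k (Multiplicative (ZMod 2))) : x ∈ S.comap (ofGroup E) :=
      h2 ▸ Algebra.mem_top
    exact h x

variable {E} {R : Type*} [Ring R] [Algebra k R]

/-- An element of square one as a homomorphism from the group of order two. -/
def involutionHom (r : R) (hr : r * r = 1) : Multiplicative (ZMod 2) →* R where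
  toFun x := r ^ x.toAdd.val
  map_one' := by simp
  map_mul' := by
    have h : r ^ 2 = 1 := by rw [sq, hr]
    intro x y
    rw [toAdd_mul, ZMod.val_add, ← pow_add]
    exact (pow_eq_pow_mod _ h).symm

/-- The maps on the two factors given by a map on `B(E)` and an element of square one. -/
def liftFactor (f : BilinHopf E →ₐ[k] R) (r : R) (hr : r * r = 1) :
    ∀ i, InvolutionFactor E i →ₐ[k] R
  | false => f
  | true => MonoidAlgebra.lift k R (Multiplicative (ZMod 2)) (involutionHom r hr)

/-- The algebra map out of `B(E) * k[ℤ/2]` given by a map on `B(E)` and an element of square one. -/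
def lift (f : BilinHopf E →ₐ[k] R) (r : R) (hr : r * r = 1) : InvolutionHopf E →ₐ[k] R :=
  HopfFreeProduct.lift k (liftFactor f r hr)

theorem lift_ofBilin (f : BilinHopf E →ₐ[k] R) (r : R) (hr : r * r = 1) (x : BilinHopf E) :
    lift f r hr (ofBilin E x) = f x :=
  HopfFreeProduct.lift_ι (liftFactor f r hr) false x

theorem lift_g (f : BilinHopf E →ₐ[k] R) (r : R) (hr : r * r = 1) : lift f r hr (g E) = r := by
  refine (HopfFreeProduct.lift_ι (liftFactor f r hr) true _).trans ?_
  refine (MonoidAlgebra.lift_single _ _ _).trans ?_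
  simp [involutionHom, ZMod.val_one]

end InvolutionHopf

end Extension

section DoubleExtension

variable {k : Type u} [Field k] {n : ℕ} (E : GL (Fin n) k)

/-! ### The free square of `B(E)` -/

namespace InvolutionHopf

/-- The exchange of the two factors of the free square of `B(E)`. -/
def swap : HopfFreeProduct k (fun _ : Fin 2 => BilinHopf E) →ₐ[k]
    HopfFreeProduct k (fun _ : Fin 2 => BilinHopf E) :=
  HopfFreeProduct.lift k fun i => HopfFreeProduct.ι k (fun _ : Fin 2 => BilinHopf E) (Equiv.swap 0 1 i)

theorem swap_ι (i : Fin 2) (x : BilinHopf E) :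
    swap E (HopfFreeProduct.ι k (fun _ : Fin 2 => BilinHopf E) i x) =
      HopfFreeProduct.ι k (fun _ : Fin 2 => BilinHopf E) (Equiv.swap 0 1 i) x :=
  HopfFreeProduct.lift_ι (A := fun _ : Fin 2 => BilinHopf E) _ i x

theorem swap_swap (x : HopfFreeProduct k (fun _ : Fin 2 => BilinHopf E)) :
    swap E (swap E x) = x := by
  have h : (swap E).comp (swap E) = AlgHom.id k _ := by
    apply HopfFreeProduct.algHom_ext
    intro i x
    rw [AlgHom.comp_apply, swap_ι, swap_ι, Equiv.swap_apply_self]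
    rfl
  exact DFunLike.congr_fun h x

/-- The two embeddings of `B(E)`, the second one conjugated by the involution. -/
def squareFactor : Fin 2 → BilinHopf E →ₐ[k] InvolutionHopf E :=
  ![ofBilin E, (conjInvolution k (g E) (g_mul_g E)).comp (ofBilin E)]

theorem isHopfMap_squareFactor (i : Fin 2) : IsHopfMap (squareFactor E i) := by
  fin_cases i
  · exact isHopfMap_ofBilin E
  · exact (isHopfMap_conjInvolution (g_mul_g E) (comul_g E) (counit_g E)).comp (isHopfMap_ofBilin E)

/-- The embedding of the free square of `B(E)`. -/
def ofSquare : HopfFreeProduct k (fun _ : Fin 2 => BilinHopf E) →ₐ[k] InvolutionHopf E :=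
  HopfFreeProduct.lift k (squareFactor E)

theorem ofSquare_ι (i : Fin 2) (x : BilinHopf E) :
    ofSquare E (HopfFreeProduct.ι k (fun _ : Fin 2 => BilinHopf E) i x) = squareFactor E i x :=
  HopfFreeProduct.lift_ι (A := fun _ : Fin 2 => BilinHopf E) _ i x

theorem isHopfMap_ofSquare : IsHopfMap (ofSquare E) := by
  have hι (i : Fin 2) : (ofSquare E).toLinearMap ∘ₗ
      (HopfFreeProduct.ι k (fun _ : Fin 2 => BilinHopf E) i).toLinearMap =
      (squareFactor E i).toLinearMap := LinearMap.ext (ofSquare_ι E i)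
  apply IsHopfMap.of_algHom_eq
  · apply HopfFreeProduct.algHom_ext
    intro i x
    refine (congrArg (Coalgebra.comul (R := k)) (ofSquare_ι E i x)).trans ?_
    refine ((isHopfMap_squareFactor E i).comul x).trans ?_
    rw [← hι, TensorProduct.map_comp]
    exact congrArg _ (HopfFreeProduct.comul_ι k (fun _ : Fin 2 => BilinHopf E) i x).symm
  · apply HopfFreeProduct.algHom_ext
    intro i x
    refine (congrArg (Coalgebra.counit (R := k)) (ofSquare_ι E i x)).trans ?_
    refine ((isHopfMap_squareFactor E i).counit x).trans ?_
    exact (HopfFreeProduct.counit_ι k (fun _ : Fin 2 => BilinHopf E) i x).symm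

theorem g_mul_squareFactor_mul_g (i : Fin 2) (x : BilinHopf E) :
    g E * squareFactor E i x * g E = squareFactor E (Equiv.swap 0 1 i) x := by
  fin_cases i
  · rfl
  · change g E * (g E * ofBilin E x * g E) * g E = ofBilin E x
    rw [← mul_assoc, ← mul_assoc, g_mul_g, one_mul, mul_assoc, g_mul_g, mul_one]

/-- The free square of `B(E)` is of index two in `B(E) * k[ℤ/2]`. -/
def squareExtension : HopfIndexTwo k (HopfFreeProduct k (fun _ : Fin 2 => BilinHopf E))
    (InvolutionHopf E) where
  toIndexTwoExtension := IndexTwoExtension.ofMatrix (ofSquare E) (g E) (swap E)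
    (lift ((diagTwist (swap E)).comp (HopfFreeProduct.ι k (fun _ : Fin 2 => BilinHopf E) 0))
      (flipMatrix _) flipMatrix_mul_flipMatrix)
    (g_mul_g E)
    (fun a => by
      have h : (conjInvolution k (g E) (g_mul_g E)).comp (ofSquare E) =
          (ofSquare E).comp (swap E) := by
        apply HopfFreeProduct.algHom_ext
        intro i x
        simp only [AlgHom.comp_apply, conjInvolution_apply, ofSquare_ι, swap_ι,
          g_mul_squareFactor_mul_g]
      exact DFunLike.congr_fun h a)
    (fun a => by
      set Φ := lift ((diagTwist (swap E)).comp
        (HopfFreeProduct.ι k (fun _ : Fin 2 => BilinHopf E) 0)) (flipMatrix _)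
        flipMatrix_mul_flipMatrix with hΦ
      have h : Φ.comp (ofSquare E) = diagTwist (swap E) := by
        apply HopfFreeProduct.algHom_ext
        intro i x
        rw [AlgHom.comp_apply, ofSquare_ι]
        fin_cases i
        · exact lift_ofBilin _ _ _ x
        · change Φ (g E * ofBilin E x * g E) = _
          rw [map_mul, map_mul, hΦ, lift_g, lift_ofBilin, AlgHom.comp_apply,
            flipMatrix_mul_diagTwist_mul_flipMatrix (swap_swap E), swap_ι]
          rfl
      exact DFunLike.congr_fun h a)
    (lift_g _ _ _) _ (adjoin_eq_top E)
    (by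
      rintro _ (rfl | ⟨p, rfl⟩)
      · exact ⟨0, 1, by simp⟩
      · exact ⟨HopfFreeProduct.ι k (fun _ : Fin 2 => BilinHopf E) 0 (BilinHopf.a E p.1 p.2), 0, by
          rw [ofSquare_ι, map_zero, zero_mul, add_zero]; rfl⟩)
  isHopfMap_incl := isHopfMap_ofSquare E
  comul_g := comul_g E
  counit_g := counit_g E

end InvolutionHopf

end DoubleExtension

/-! ### Dual pairs of matrices -/

section DualPairs

variable {k : Type*} [Field k] {n : ℕ} {R : Type*} [Ring R]

theorem diagonal_mul_diagonal_of_mul_self {g : R} (hg : g * g = 1) :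
    (Matrix.diagonal fun _ : Fin n => g) * (Matrix.diagonal fun _ : Fin n => g) = 1 := by
  rw [Matrix.diagonal_mul_diagonal, hg, Matrix.diagonal_one]

theorem transpose_mul_diagonal (x : Matrix (Fin n) (Fin n) R) (g : R) :
    (x * Matrix.diagonal fun _ => g)ᵀ = xᵀ * Matrix.diagonal fun _ => g := by
  ext i j
  simp

theorem transpose_diagonal_mul (x : Matrix (Fin n) (Fin n) R) (g : R) :
    ((Matrix.diagonal fun _ => g) * x)ᵀ = (Matrix.diagonal fun _ => g) * xᵀ := by
  ext i j
  simp

variable [Algebra k R]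

theorem commute_diagonal_scalarMat (g : R) (M : Matrix (Fin n) (Fin n) k) :
    Commute (Matrix.diagonal fun _ : Fin n => g) (scalarMat R M) := by
  ext i j
  simp [Algebra.commutes]

/-- Two matrices `x` and `y` over a `k`-algebra form a dual pair with respect to `E` if
`E⁻¹ yᵗ E` is inverse to `x`. The algebra `B(E)` is generated by a matrix that forms a dual pair
with itself. -/
structure IsDualPair (E : GL (Fin n) k) (x y : Matrix (Fin n) (Fin n) R) : Prop where
  left : scalarMat R E⁻¹.val * yᵀ * scalarMat R E.val * x = 1
  right : x * scalarMat R E⁻¹.val * yᵀ * scalarMat R E.val = 1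

namespace IsDualPair

variable {E : GL (Fin n) k} {x y : Matrix (Fin n) (Fin n) R}

theorem map {S : Type*} [Ring S] [Algebra k S] (h : IsDualPair E x y) (f : R →ₐ[k] S) :
    IsDualPair E (x.map f) (y.map f) where
  left := by
    rw [← scalarMat_map f, ← scalarMat_map f, ← Matrix.transpose_map, ← map_mul_mat, ← map_mul_mat,
      ← map_mul_mat, h.left]
    simp
  right := by
    rw [← scalarMat_map f, ← scalarMat_map f, ← Matrix.transpose_map, ← map_mul_mat, ← map_mul_mat,
      ← map_mul_mat, h.right]
    simp

theorem mul_diagonal (h : IsDualPair E x y) {g : R} (hg : g * g = 1) :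
    IsDualPair E (x * Matrix.diagonal fun _ => g) ((Matrix.diagonal fun _ => g) * y) := by
  have hG := diagonal_mul_diagonal_of_mul_self (n := n) hg
  have c1 := (commute_diagonal_scalarMat g E⁻¹.val).eq
  constructor
  · rw [transpose_diagonal_mul, ← mul_assoc (scalarMat R E⁻¹.val), ← c1]
    have := congrArg (fun z => Matrix.diagonal (fun _ => g) * z * Matrix.diagonal fun _ => g) h.left
    simpa only [mul_assoc, mul_one, one_mul, hG] using this
  · rw [transpose_diagonal_mul, mul_assoc x, c1, ← h.right]
    simp only [mul_assoc]
    rw [← mul_assoc (Matrix.diagonal fun _ => g) (Matrix.diagonal fun _ => g), hG, one_mul]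

theorem diagonal_mul (h : IsDualPair E x y) {g : R} (hg : g * g = 1) :
    IsDualPair E ((Matrix.diagonal fun _ => g) * x) (y * Matrix.diagonal fun _ => g) := by
  have hG := diagonal_mul_diagonal_of_mul_self (n := n) hg
  have c1 := (commute_diagonal_scalarMat g E.val).eq
  constructor
  · rw [transpose_mul_diagonal, ← h.left]
    simp only [mul_assoc]
    rw [← mul_assoc (scalarMat R E.val) (Matrix.diagonal fun _ => g), ← c1, mul_assoc,
      ← mul_assoc (Matrix.diagonal fun _ => g) (Matrix.diagonal fun _ => g), hG, one_mul]
  · rw [transpose_mul_diagonal]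
    have := congrArg (fun z => Matrix.diagonal (fun _ => g) * z * Matrix.diagonal fun _ => g)
      h.right
    simpa only [mul_assoc, mul_one, one_mul, hG, c1] using this

end IsDualPair

end DualPairs

/-! ### Conjugation by scalar matrices -/

section Conjugation

variable {k : Type*} [Field k] {n : ℕ}

/-- The transpose of an invertible matrix. -/
def transposeGL (E : GL (Fin n) k) : GL (Fin n) k where
  val := E.valᵀ
  inv := E⁻¹.valᵀ
  val_inv := by rw [← Matrix.transpose_mul, ← Units.val_mul, inv_mul_cancel]; simp
  inv_val := by rw [← Matrix.transpose_mul, ← Units.val_mul, mul_inv_cancel]; simp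

/-- Conjugation of a matrix over a `k`-algebra by an invertible matrix over `k`. -/
def scalarConj {R : Type*} [Ring R] [Algebra k R] (P : GL (Fin n) k)
    (x : Matrix (Fin n) (Fin n) R) : Matrix (Fin n) (Fin n) R :=
  scalarMat R P.val * x * scalarMat R P⁻¹.val

variable {R : Type*} [Ring R] [Algebra k R] (P : GL (Fin n) k) (x y : Matrix (Fin n) (Fin n) R)

theorem scalarConj_inv : scalarConj P (scalarConj P⁻¹ x) = x := by
  have h : scalarConj P (scalarConj P⁻¹ x) = scalarMat R P.val * scalarMat R P⁻¹.val * x *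
      (scalarMat R P.val * scalarMat R P⁻¹.val) := by
    simp only [scalarConj, mul_assoc, inv_inv]
  rw [h, scalarMat_mul_inv, one_mul, mul_one]

theorem scalarConj_inv' : scalarConj P⁻¹ (scalarConj P x) = x := by
  conv_lhs => rw [← inv_inv P, inv_inv P⁻¹]
  exact scalarConj_inv P⁻¹ x

theorem scalarConj_mul : scalarConj P (x * y) = scalarConj P x * scalarConj P y := by
  have h : scalarConj P x * scalarConj P y = scalarMat R P.val * x *
      (scalarMat R P⁻¹.val * scalarMat R P.val) * y * scalarMat R P⁻¹.val := by
    simp only [scalarConj, mul_assoc]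
  rw [h, scalarMat_inv_mul, mul_one, scalarConj, mul_assoc (scalarMat R P.val) x y]

theorem scalarConj_one : scalarConj P (1 : Matrix (Fin n) (Fin n) R) = 1 := by
  rw [scalarConj, mul_one, scalarMat_mul_inv]

theorem scalarConj_map {S : Type*} [Ring S] [Algebra k S] (f : R →ₐ[k] S) :
    (scalarConj P x).map f = scalarConj P (x.map f) := by
  rw [scalarConj, map_mul_mat, map_mul_mat, scalarMat_map, scalarMat_map, scalarConj]

theorem scalarConj_transposeGL_transpose (E : GL (Fin n) k) :
    (scalarConj (transposeGL E) x)ᵀ = scalarMat R E⁻¹.val * xᵀ * scalarMat R E.val := by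
  rw [scalarConj, transpose_mul_scalarMat, transpose_scalarMat_mul, ← mul_assoc]
  rfl

end Conjugation

/-! ### The universal cosovereign Hopf algebra in terms of dual pairs -/

namespace CosovHopf

variable {k : Type u} [Field k] {n : ℕ} {E F : GL (Fin n) k}

theorem val_eq (hF : F.val = E.valᵀ * E⁻¹.val) : F = transposeGL E * E⁻¹ := Units.ext hF

section

variable {R : Type*} [Ring R] [Algebra k R]

theorem scalarMat_val (hF : F.val = E.valᵀ * E⁻¹.val) :
    scalarMat R F.val = scalarMat R (transposeGL E).val * scalarMat R E⁻¹.val := by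
  rw [scalarMat_mul, hF]
  rfl

theorem scalarMat_inv_val (hF : F.val = E.valᵀ * E⁻¹.val) :
    scalarMat R F⁻¹.val = scalarMat R E.val * scalarMat R (transposeGL E)⁻¹.val := by
  rw [val_eq hF, mul_inv_rev, inv_inv, Units.val_mul, scalarMat_mul]

theorem scalarConj_mul_left (hF : F.val = E.valᵀ * E⁻¹.val) (x y : Matrix (Fin n) (Fin n) R) :
    scalarMat R F.val * xᵀ * scalarMat R F⁻¹.val * scalarConj (transposeGL E) y =
      scalarConj (transposeGL E) (scalarMat R E⁻¹.val * xᵀ * scalarMat R E.val * y) := by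
  rw [scalarConj_mul]
  congr 1
  rw [scalarMat_val hF, scalarMat_inv_val hF]
  simp only [scalarConj, mul_assoc]

theorem scalarConj_mul_right (hF : F.val = E.valᵀ * E⁻¹.val) (x y : Matrix (Fin n) (Fin n) R) :
    scalarConj (transposeGL E) y * scalarMat R F.val * xᵀ * scalarMat R F⁻¹.val =
      scalarConj (transposeGL E) (y * scalarMat R E⁻¹.val * xᵀ * scalarMat R E.val) := by
  rw [mul_assoc, mul_assoc, mul_assoc y, mul_assoc y, scalarConj_mul]
  congr 1
  rw [scalarMat_val hF, scalarMat_inv_val hF]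
  simp only [scalarConj, mul_assoc]

end

variable (E F) in
/-- The matrix `E⁻ᵗ v Eᵗ`, which forms dual pairs with `u` in both orders. The algebra `H(F)` is
the universal algebra with such a pair of matrices. -/
def w : Matrix (Fin n) (Fin n) (CosovHopf F) := scalarConj (transposeGL E)⁻¹ (v F)

variable (E F) in
theorem scalarConj_w : scalarConj (transposeGL E) (w E F) = v F := scalarConj_inv _ _

theorem isDualPair_u_w : IsDualPair E (u F) (w E F) where
  left := by
    rw [← scalarConj_transposeGL_transpose, scalarConj_w, vt_mul_u]
  right := by
    rw [mul_assoc, mul_assoc, ← mul_assoc (scalarMat _ _), ← scalarConj_transposeGL_transpose,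
      scalarConj_w, u_mul_vt]

theorem isDualPair_w_u (hF : F.val = E.valᵀ * E⁻¹.val) : IsDualPair E (w E F) (u F) where
  left := by
    rw [← scalarConj_inv' (transposeGL E) (_ * w E F), ← scalarConj_mul_left hF, scalarConj_w,
      ut_mul_v, scalarConj_one]
  right := by
    rw [← scalarConj_inv' (transposeGL E) (_ * scalarMat _ _), ← scalarConj_mul_right hF,
      scalarConj_w, v_mul_ut, scalarConj_one]

section

variable {R : Type*} [Ring R] [Algebra k R] (hF : F.val = E.valᵀ * E⁻¹.val)

/-- The algebra map out of `H(F)` given by two matrices that form dual pairs in both orders. -/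
def liftPair (x y : Matrix (Fin n) (Fin n) R) (h : IsDualPair E x y) (h' : IsDualPair E y x) :
    CosovHopf F →ₐ[k] R :=
  lift F x (scalarConj (transposeGL E) y)
    (by
      rw [scalarConj_transposeGL_transpose, ← h.right]
      simp only [mul_assoc])
    (by rw [scalarConj_transposeGL_transpose, h.left])
    (by rw [scalarConj_mul_right hF, h'.right, scalarConj_one])
    (by rw [scalarConj_mul_left hF, h'.left, scalarConj_one])

theorem liftPair_u (x y : Matrix (Fin n) (Fin n) R) (h : IsDualPair E x y)
    (h' : IsDualPair E y x) : (u F).map (liftPair hF x y h h') = x :=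
  Matrix.ext fun _ _ => lift_u ..

theorem liftPair_w (x y : Matrix (Fin n) (Fin n) R) (h : IsDualPair E x y)
    (h' : IsDualPair E y x) : (w E F).map (liftPair hF x y h h') = y := by
  have hv : (v F).map (liftPair hF x y h h') = scalarConj (transposeGL E) y :=
    Matrix.ext fun _ _ => lift_v ..
  rw [w, scalarConj_map, hv, scalarConj_inv']

variable (E) in
theorem algHom_ext_pair {f f' : CosovHopf F →ₐ[k] R} (hu : (u F).map f = (u F).map f')
    (hw : (w E F).map f = (w E F).map f') : f = f' := by
  apply algHom_ext
  · exact fun i j => congrFun (congrFun hu i) j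
  · intro i j
    have : (v F).map f = (v F).map f' := by
      rw [← scalarConj_w E F, scalarConj_map, scalarConj_map, hw]
    exact congrFun (congrFun this i) j

end

end CosovHopf

/-! ### Multiplicative matrices -/

section Multiplicative

variable {k : Type*} [Field k] {n : ℕ} {A C : Type*} [Ring A] [HopfAlgebra k A] [Ring C]
  [HopfAlgebra k C]

/-- A matrix over a Hopf algebra is multiplicative if its entries are the coefficients of a
comodule: `Δ(mᵢⱼ) = ∑ mᵢₗ ⊗ mₗⱼ` and `ε(mᵢⱼ) = δᵢⱼ`. -/
structure IsMultiplicative (k : Type*) [Field k] {n : ℕ} {A : Type*} [Ring A] [HopfAlgebra k A]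
    (M : Matrix (Fin n) (Fin n) A) : Prop where
  comul (i j : Fin n) : Coalgebra.comul (R := k) (M i j) = ∑ l, M i l ⊗ₜ[k] M l j
  counit (i j : Fin n) : Coalgebra.counit (R := k) (M i j) = (1 : Matrix (Fin n) (Fin n) k) i j

namespace IsMultiplicative

variable {M : Matrix (Fin n) (Fin n) A}

theorem map (hM : IsMultiplicative k M) {f : A →ₐ[k] C} (hf : IsHopfMap f) :
    IsMultiplicative k (M.map f) where
  comul i j := by simp [hf.comul, hM.comul]
  counit i j := by simp [hf.counit, hM.counit]

theorem mul_diagonal (hM : IsMultiplicative k M) {g : A}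
    (hg : Coalgebra.comul (R := k) g = g ⊗ₜ[k] g) (hg' : Coalgebra.counit (R := k) g = 1) :
    IsMultiplicative k (M * Matrix.diagonal fun _ => g) where
  comul i j := by simp [Bialgebra.comul_mul, hM.comul, hg, Finset.sum_mul]
  counit i j := by simp [hM.counit, hg']

theorem diagonal_mul (hM : IsMultiplicative k M) {g : A}
    (hg : Coalgebra.comul (R := k) g = g ⊗ₜ[k] g) (hg' : Coalgebra.counit (R := k) g = 1) :
    IsMultiplicative k ((Matrix.diagonal fun _ => g) * M) where
  comul i j := by simp [Bialgebra.comul_mul, hM.comul, hg, Finset.mul_sum]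
  counit i j := by simp [hM.counit, hg']

theorem scalarConj (hM : IsMultiplicative k M) (P : GL (Fin n) k) :
    IsMultiplicative k (scalarConj P M) where
  comul i j := by
    have h : M.map (Bialgebra.comulAlgHom k A) =
        M.map (Algebra.TensorProduct.includeLeft : A →ₐ[k] A ⊗[k] A) *
          M.map (Algebra.TensorProduct.includeRight : A →ₐ[k] A ⊗[k] A) := by
      ext i j
      rw [includeLeft_mul_includeRight_apply]
      exact hM.comul i j
    have h' := scalarConj_map P M (Bialgebra.comulAlgHom k A)
    rw [h, scalarConj_mul, ← scalarConj_map, ← scalarConj_map] at h'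
    refine (congrFun (congrFun h' i) j).trans ?_
    rw [includeLeft_mul_includeRight_apply]
  counit i j := by
    have h : M.map (Bialgebra.counitAlgHom k A) = 1 := Matrix.ext hM.counit
    have h' := scalarConj_map P M (Bialgebra.counitAlgHom k A)
    rw [h, scalarConj_one] at h'
    exact congrFun (congrFun h' i) j

end IsMultiplicative

end Multiplicative

namespace CosovHopf

variable {k : Type u} [Field k] {n : ℕ} {E F : GL (Fin n) k}

variable (F) in
theorem isMultiplicative_u : IsMultiplicative k (u F) := ⟨comul_u F, counit_u F⟩

variable (F) in
theorem isMultiplicative_v : IsMultiplicative k (v F) := ⟨comul_v F, counit_v F⟩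

/-- An algebra map out of `H(F)` is a Hopf map if it sends the generating matrices to
multiplicative matrices. -/
theorem isHopfMap_of_isMultiplicative {C : Type*} [Ring C] [HopfAlgebra k C] {f : CosovHopf F →ₐ[k] C}
    (hu : IsMultiplicative k ((u F).map f)) (hw : IsMultiplicative k ((w E F).map f)) :
    IsHopfMap f := by
  have hv : IsMultiplicative k ((v F).map f) := by
    rw [← scalarConj_w E F, scalarConj_map]
    exact hw.scalarConj _
  have key {M : Matrix (Fin n) (Fin n) (CosovHopf F)} (hM : IsMultiplicative k M)
      (hfM : IsMultiplicative k (M.map f)) (i j : Fin n) : Coalgebra.comul (R := k) (f (M i j)) =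
      TensorProduct.map f.toLinearMap f.toLinearMap (Coalgebra.comul (R := k) (M i j)) := by
    rw [hM.comul]
    refine (hfM.comul i j).trans ?_
    simp
  apply IsHopfMap.of_algHom_eq
  · exact algHom_ext (key (isMultiplicative_u F) hu) (key (isMultiplicative_v F) hv)
  · exact algHom_ext (fun i j => (hu.counit i j).trans (counit_u F i j).symm)
      (fun i j => (hv.counit i j).trans (counit_v F i j).symm)

end CosovHopf

/-! ### `H(F)` is of index two in `B(E) * k[ℤ/2]` -/

namespace CosovHopf

open InvolutionHopf

variable {k : Type u} [Field k] {n : ℕ} {E F : GL (Fin n) k} (hF : F.val = E.valᵀ * E⁻¹.val)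

theorem _root_.BilinHopf.isDualPair_a : IsDualPair E (BilinHopf.a E) (BilinHopf.a E) where
  left := BilinHopf.antipodeA_mul E
  right := by simpa only [BilinHopf.antipodeA, mul_assoc] using BilinHopf.mul_antipodeA E

/-- The exchange of `u` and `E⁻ᵗ v Eᵗ`. -/
def twist : CosovHopf F →ₐ[k] CosovHopf F :=
  liftPair hF (w E F) (u F) (isDualPair_w_u hF) isDualPair_u_w

theorem twist_twist (x : CosovHopf F) : twist hF (twist hF x) = x := by
  have h : (twist hF).comp (twist hF) = AlgHom.id k _ := by
    apply algHom_ext_pair E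
    · rw [AlgHom.coe_comp, ← Matrix.map_map, twist, liftPair_u, liftPair_w]
      simp
    · rw [AlgHom.coe_comp, ← Matrix.map_map, twist, liftPair_w, liftPair_u]
      simp
  exact DFunLike.congr_fun h x

variable (E) in
/-- The generating matrix of `B(E)`, in `B(E) * k[ℤ/2]`. -/
def bilinMat : Matrix (Fin n) (Fin n) (InvolutionHopf E) := (BilinHopf.a E).map (ofBilin E)

theorem isDualPair_bilinMat : IsDualPair E (bilinMat E) (bilinMat E) :=
  BilinHopf.isDualPair_a.map _

variable (E) in
theorem isMultiplicative_bilinMat : IsMultiplicative k (bilinMat E) :=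
  IsMultiplicative.map ⟨BilinHopf.comul_a E, BilinHopf.counit_a E⟩ (isHopfMap_ofBilin E)

/-- The embedding `u ↦ a g`, `v ↦ Eᵗ g a E⁻ᵗ` of `H(F)` in `B(E) * k[ℤ/2]`. -/
def toInvolution : CosovHopf F →ₐ[k] InvolutionHopf E :=
  liftPair hF (bilinMat E * Matrix.diagonal fun _ => g E)
    ((Matrix.diagonal fun _ => g E) * bilinMat E)
    (isDualPair_bilinMat.mul_diagonal (g_mul_g E)) (isDualPair_bilinMat.diagonal_mul (g_mul_g E))

theorem isHopfMap_toInvolution : IsHopfMap (toInvolution hF) := by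
  apply isHopfMap_of_isMultiplicative (E := E)
  · rw [toInvolution, liftPair_u]
    exact (isMultiplicative_bilinMat E).mul_diagonal (comul_g E) (counit_g E)
  · rw [toInvolution, liftPair_w]
    exact (isMultiplicative_bilinMat E).diagonal_mul (comul_g E) (counit_g E)

theorem map_conjInvolution {R : Type*} [Ring R] [Algebra k R] (g : R) (hg : g * g = 1)
    (M : Matrix (Fin n) (Fin n) R) : M.map (conjInvolution k g hg) =
      (Matrix.diagonal fun _ => g) * M * Matrix.diagonal fun _ => g := by
  ext i j
  simp [conjInvolution_apply]

theorem g_mul_toInvolution_mul_g (x : CosovHopf F) :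
    g E * toInvolution hF x * g E = toInvolution hF (twist hF x) := by
  have hG := diagonal_mul_diagonal_of_mul_self (n := n) (g_mul_g E)
  have h : (conjInvolution k (g E) (g_mul_g E)).comp (toInvolution hF) =
      (toInvolution hF).comp (twist hF) := by
    apply algHom_ext_pair E
    · rw [AlgHom.coe_comp, AlgHom.coe_comp, ← Matrix.map_map, ← Matrix.map_map, twist,
        map_conjInvolution, liftPair_u, toInvolution, liftPair_u, liftPair_w, mul_assoc,
        mul_assoc, hG, mul_one]
    · rw [AlgHom.coe_comp, AlgHom.coe_comp, ← Matrix.map_map, ← Matrix.map_map, twist,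
        map_conjInvolution, liftPair_w, toInvolution, liftPair_w, liftPair_u, ← mul_assoc,
        hG, one_mul]
  exact DFunLike.congr_fun h x

theorem map_u_diagTwist : (Matrix.diagonal fun _ => flipMatrix (CosovHopf F)) *
    (u F).map (diagTwist (twist hF)) * (Matrix.diagonal fun _ => flipMatrix (CosovHopf F)) =
      (w E F).map (diagTwist (twist hF)) := by
  have h : (w E F).map (diagTwist (twist hF)) =
      ((u F).map (twist hF)).map (diagTwist (twist hF)) := by rw [twist, liftPair_u]
  rw [h]
  refine Matrix.ext fun i j => ?_
  simp only [Matrix.mul_diagonal, Matrix.diagonal_mul, Matrix.map_apply]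
  exact flipMatrix_mul_diagTwist_mul_flipMatrix (twist_twist hF) _

theorem isDualPair_map_u_diagTwist :
    IsDualPair E ((u F).map (diagTwist (twist hF)) * Matrix.diagonal fun _ => flipMatrix _)
      ((u F).map (diagTwist (twist hF)) * Matrix.diagonal fun _ => flipMatrix _) := by
  have h := (isDualPair_u_w (E := E).map (diagTwist (twist hF))).mul_diagonal
    flipMatrix_mul_flipMatrix
  rwa [← map_u_diagTwist, ← mul_assoc, ← mul_assoc,
    diagonal_mul_diagonal_of_mul_self flipMatrix_mul_flipMatrix, one_mul] at h

/-- The representation of `B(E) * k[ℤ/2]` by two-by-two matrices over `H(F)`. -/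
def involutionRep : InvolutionHopf E →ₐ[k] Matrix (Fin 2) (Fin 2) (CosovHopf F) :=
  InvolutionHopf.lift (BilinHopf.lift E _ (isDualPair_map_u_diagTwist hF).left
    (isDualPair_map_u_diagTwist hF).right) (flipMatrix _) flipMatrix_mul_flipMatrix

theorem involutionRep_g : involutionRep hF (g E) = flipMatrix _ := lift_g _ _ _

theorem map_bilinMat : (bilinMat E).map (involutionRep hF) =
    (u F).map (diagTwist (twist hF)) * Matrix.diagonal fun _ => flipMatrix _ :=
  Matrix.ext fun i j => (lift_ofBilin _ _ _ _).trans (BilinHopf.lift_a _ _ _ i j)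

theorem map_diagonal_g : (Matrix.diagonal fun _ : Fin n => g E).map (involutionRep hF) =
    Matrix.diagonal fun _ => flipMatrix _ := by
  rw [Matrix.diagonal_map (map_zero _), involutionRep_g]

theorem involutionRep_toInvolution (x : CosovHopf F) :
    involutionRep hF (toInvolution hF x) = diagTwist (twist hF) x := by
  have hG := diagonal_mul_diagonal_of_mul_self (n := n)
    (flipMatrix_mul_flipMatrix (A := CosovHopf F))
  have h : (involutionRep hF).comp (toInvolution hF) = diagTwist (twist hF) := by
    apply algHom_ext_pair E
    · rw [AlgHom.coe_comp, ← Matrix.map_map, toInvolution, liftPair_u, map_mul_mat, map_bilinMat,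
        map_diagonal_g, mul_assoc, hG, mul_one]
    · rw [AlgHom.coe_comp, ← Matrix.map_map, toInvolution, liftPair_w, map_mul_mat, map_bilinMat,
        map_diagonal_g, ← mul_assoc, map_u_diagTwist]
  exact DFunLike.congr_fun h x

/-- The universal cosovereign Hopf algebra `H(F)` is of index two in `B(E) * k[ℤ/2]`. -/
def involutionExtension : HopfIndexTwo k (CosovHopf F) (InvolutionHopf E) where
  toIndexTwoExtension := IndexTwoExtension.ofMatrix (toInvolution hF) (g E) (twist hF)
    (involutionRep hF) (g_mul_g E) (g_mul_toInvolution_mul_g hF) (involutionRep_toInvolution hF)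
    (involutionRep_g hF) _ (InvolutionHopf.adjoin_eq_top E)
    (by
      rintro x (rfl | ⟨p, rfl⟩)
      · exact ⟨0, 1, by simp⟩
      · refine ⟨0, u F p.1 p.2, ?_⟩
        have h : toInvolution hF (u F p.1 p.2) = bilinMat E p.1 p.2 * g E := by
          have := congrFun (congrFun (liftPair_u hF _ _
            (isDualPair_bilinMat.mul_diagonal (g_mul_g E))
            (isDualPair_bilinMat.diagonal_mul (g_mul_g E))) p.1) p.2
          exact this.trans (Matrix.mul_diagonal _ _ _ _)
        rw [h, mul_assoc, g_mul_g, mul_one, map_zero, zero_add]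
        rfl)
  isHopfMap_incl := isHopfMap_toInvolution hF
  comul_g := comul_g E
  counit_g := counit_g E

end CosovHopf

end

theorem corollary4 {k : Type u} [Field k] [IsAlgClosed k] [CharZero k] {n : ℕ} (hn : 2 ≤ n)
    (E F : GL (Fin n) k) (hF : F.val = E.valᵀ * E⁻¹.val) :
    hochschildDim k (CosovHopf F) =
        hochschildDim k (HopfFreeProduct k fun _ : Fin 2 => BilinHopf E) ∧
      (IsGeneric F →
        gerstenhaberSchackDim k (CosovHopf F) =
          gerstenhaberSchackDim k (HopfFreeProduct k fun _ : Fin 2 => BilinHopf E)) :=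
  ⟨(CosovHopf.involutionExtension hF).hochschildDim_eq.trans
      (InvolutionHopf.squareExtension E).hochschildDim_eq.symm,
    fun _ => (CosovHopf.involutionExtension hF).gerstenhaberSchackDim_eq.trans
      (InvolutionHopf.squareExtension E).gerstenhaberSchackDim_eq.symm⟩
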